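/- Let $\Gamma\subset\mathbb R^n$ be a finite topological network: $V=\{v_i\}_{i\in I}$ is a finite set of points, $\pi_j:[0,l_j]\to\mathbb R^n$ ($j\in J$ finite, $l_j>0$) are smooth injective curves with open and closed edges $e_j=\pi_j((0,l_j))$, $\bar e_j=\pi_j([0,l_j])$, such that $\pi_j(0),\pi_j(l_j)\in V$, $\#(\bar e_j\cap V)=2$, and for $j\ne k$ one has $\bar e_j\cap\bar e_k\subset V$ and $\#(\bar e_j\cap\bar e_k)\le 1$; any two vertices are joined by a finite chain of edges in which consecutive closed edges meet in exactly one point; and $\Gamma=\bigcup_j\bar e_j$. For $u:\Gamma\to\mathbb R$ put $u^j=u\circ\pi_j$ on $[0,l_j]$ and $\partial_j^m u=\frac{d^m u^j}{dy^m}$ (one-sided at the end-points). Let $Inc_i$ be the set of edges incident to $v_i$, and $a_{ij}=1$ if $v_i=\pi_j(0)$, $a_{ij}=-1$ if $v_i=\pi_j(l_j)$. Let $I_B\subset I$ be a nonempty set of boundary vertices containing every $i$ with $\#Inc_i=1$, and $I_T=I\setminus I_B$. Let $f:\Gamma\to\mathbb R$ be Lipschitz continuous (along the edges) with $f\ge\alpha$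 for a constant $\alpha>0$, and let $\beta_{ij}>0$ for $i\in I_T$, $j\in Inc_i$. A continuous $u:\Gamma\to\mathbb R$ is a viscosity solution of $$|\partial u|=f\ \text{ on }\Gamma,\qquad u(v_i)=0\ \ (i\in I_B) \tag{1}$$ if the boundary condition holds and the following are satisfied for continuous $\phi:\Gamma\to\mathbb R$. (a) If $x\in e_j$, $\phi^j$ is differentiable at $\pi_j^{-1}(x)$ and $u-\phi$ has a local maximum (resp. minimum) at $x$, then $|\partial_j\phi(x)|\le f(x)$ (resp. $\ge f(x)$). (b) For $i\in I_T$ and distinct $j,k\in Inc_i$, call $\phi$ a $(j,k)$-test function at $v_i$ if $\phi^j,\phi^k$ are differentiable at the parameters of $v_i$ and $a_{ij}\partial_j\phi(v_i)+a_{ik}\partial_k\phi(v_i)=0$. Then for all distinct $j,k\in Inc_i$ and every $(j,k)$-test function $\phi$ such that $u-\phi$ has a local maximum at $v_i$ relative to $\bar e_j\cup\bar e_k$, one has $|\partial_j\phi(v_i)|\le f(v_i)$; and for every $j\in Inc_i$ there is $k\in Inc_i$, $k\ne j$, such that for every $(j,k)$-test function $\phi$ for which $u-\phi$ has a local minimum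 at $v_i$ relative to $\bar e_j\cup\bar e_k$, one has $|\partial_j\phi(v_i)|\ge f(v_i)$. For $\varepsilon>0$ consider classical solutions, i.e. continuous $u_\varepsilon:\Gamma\to\mathbb R$ with $u_\varepsilon^j\in C^2([0,l_j])$ for all $j$, of $$-\varepsilon\,\partial_j^2u_\varepsilon+|\partial_j u_\varepsilon|^2=f^2\ \text{ on each } e_j,\qquad \sum_{j\in Inc_i}\beta_{ij}a_{ij}\,\partial_j u_\varepsilon(v_i)=0\ \ (i\in I_T),\qquad u_\varepsilon(v_i)=0\ \ (i\in I_B). \tag{2}$$ Then (1) has a unique viscosity solution $u$; for every $\varepsilon>0$ problem (2) has a unique classical solution $u_\varepsilon$; and $u_\varepsilon\to u$ uniformly on $\Gamma$ as $\varepsilon\to0^+$. -/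

import Mathlib

open Set Filter Topology
open scoped ContDiff

/-- A finite topological network in `ℝⁿ`: finitely many vertices `v i`, joined by finitely many smooth
non self-intersecting curves `π j : [0, l j] → ℝⁿ` (only the values of `π j` on `[0, l j]` matter). -/
structure TopologicalNetwork (n : ℕ) (I J : Type*) [Fintype I] [Fintype J] where
  /-- the vertices -/
  v : I → EuclideanSpace ℝ (Fin n)
  /-- the lengths of the parameter intervals -/
  l : J → ℝ
  /-- the parametrizations of the edges -/
  π : J → ℝ → EuclideanSpace ℝ (Fin n)
  v_injective : Function.Injective v
  l_pos : ∀ j, 0 < l j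
  smooth : ∀ j, ContDiffOn ℝ ∞ (π j) (Icc 0 (l j))
  injOn : ∀ j, InjOn (π j) (Icc 0 (l j))
  start_mem : ∀ j, π j 0 ∈ range v
  end_mem : ∀ j, π j (l j) ∈ range v
  edge_vertices : ∀ j, (π j '' Icc 0 (l j) ∩ range v).encard = 2
  inter_subset : ∀ j k, j ≠ k → π j '' Icc 0 (l j) ∩ π k '' Icc 0 (l k) ⊆ range v
  inter_card : ∀ j k, j ≠ k → (π j '' Icc 0 (l j) ∩ π k '' Icc 0 (l k)).encard ≤ 1
  /-- any two vertices are joined by a finite chain of edges, consecutive ones meeting in one point -/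
  connected : ∀ i i' : I, ∃ j k : J, v i ∈ π j '' Icc 0 (l j) ∧ v i' ∈ π k '' Icc 0 (l k) ∧
    Relation.ReflTransGen
      (fun a b : J => (π a '' Icc 0 (l a) ∩ π b '' Icc 0 (l b)).encard = 1) j k

namespace TopologicalNetwork

variable {n : ℕ} {I J : Type*} [Fintype I] [Fintype J] (G : TopologicalNetwork n I J)

/-- The closed edge `ē_j = π_j([0, l_j])`. -/
def closedEdge (j : J) : Set (EuclideanSpace ℝ (Fin n)) := G.π j '' Icc 0 (G.l j)

/-- The network `Γ = ⋃ j, ē_j` as a subset of `ℝⁿ`; functions on the network are functions on this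
set, which carries the subspace topology. -/
def carrier : Set (EuclideanSpace ℝ (Fin n)) := ⋃ j, G.closedEdge j

/-- The point `π_j(y)` of the network, for `y ∈ [0, l_j]`. -/
def point (j : J) (y : Icc 0 (G.l j)) : G.carrier :=
  ⟨G.π j y, mem_iUnion.2 ⟨j, mem_image_of_mem _ y.2⟩⟩

/-- The vertex `v_i` as a point of the network. -/
def vertex (i : I) : G.carrier :=
  ⟨G.v i, by
    obtain ⟨j, _, hj, _⟩ := G.connected i i
    exact mem_iUnion.2 ⟨j, hj⟩⟩

open Classical in
/-- `Inc_i`: the edges incident to `v_i`. -/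
noncomputable def inc (i : I) : Finset J := Finset.univ.filter fun j => G.v i ∈ G.closedEdge j

open Classical in
/-- The signed incidence matrix `a_{ij}`. -/
noncomputable def sign (i : I) (j : J) : ℝ :=
  if G.π j 0 = G.v i then 1 else if G.π j (G.l j) = G.v i then -1 else 0

open Classical in
/-- The parameter `π_j⁻¹(v_i)`, for `j ∈ Inc_i`; see `vertexParam_spec`. -/
noncomputable def vertexParam (i : I) (j : J) : ℝ := if G.π j 0 = G.v i then 0 else G.l j

theorem vertexParam_spec {i : I} {j : J} (h : j ∈ G.inc i) :
    G.vertexParam i j ∈ Icc 0 (G.l j) ∧ G.π j (G.vertexParam i j) = G.v i := by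
  classical
  have hl := G.l_pos j
  have h0 : (0 : ℝ) ∈ Icc 0 (G.l j) := ⟨le_rfl, hl.le⟩
  have h1 : G.l j ∈ Icc 0 (G.l j) := ⟨hl.le, le_rfl⟩
  unfold vertexParam
  split_ifs with h'
  · exact ⟨h0, h'⟩
  · refine ⟨h1, ?_⟩
    have hi : G.v i ∈ G.π j '' Icc 0 (G.l j) := by simpa [inc, closedEdge] using h
    have hne : G.π j 0 ≠ G.π j (G.l j) := fun e => hl.ne (G.injOn j h0 h1 e)
    have hsub : ({G.π j 0, G.π j (G.l j)} : Set (EuclideanSpace ℝ (Fin n))) ⊆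
        G.π j '' Icc 0 (G.l j) ∩ range G.v := by
      rintro x (rfl | rfl)
      · exact ⟨mem_image_of_mem _ h0, G.start_mem j⟩
      · exact ⟨mem_image_of_mem _ h1, G.end_mem j⟩
    have hfin : (G.π j '' Icc 0 (G.l j) ∩ range G.v).Finite := (finite_range G.v).inter_of_right _
    have heq := Finite.eq_of_subset_of_encard_le (hfin.subset hsub) hsub
      (by rw [G.edge_vertices j, encard_pair hne])
    have : G.v i ∈ ({G.π j 0, G.π j (G.l j)} : Set (EuclideanSpace ℝ (Fin n))) :=
      heq ▸ ⟨hi, mem_range_self i⟩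
    rcases this with e | e
    · exact absurd e.symm h'
    · exact e.symm

/-- The restriction `u^j = u ∘ π_j` of `u` to the edge `ē_j`, as a function of `y ∈ [0, l_j]`
(extended to `ℝ` by constants; below only its behaviour on `[0, l_j]` is used). -/
noncomputable def restr (u : G.carrier → ℝ) (j : J) : ℝ → ℝ :=
  IccExtend (G.l_pos j).le fun y => u (G.point j y)

/-- `∂_j^α u` at the point of `ē_j` with parameter `y ∈ [0, l_j]` (one-sided at the end-points). -/
noncomputable def edgeDeriv (α : ℕ) (j : J) (u : G.carrier → ℝ) (y : ℝ) : ℝ :=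
  iteratedDerivWithin α (G.restr u j) (Icc 0 (G.l j)) y

/-- `u ∈ C^k(Γ)`. -/
def IsCk (k : ℕ) (u : G.carrier → ℝ) : Prop :=
  Continuous u ∧ ∀ j, ContDiffOn ℝ k (G.restr u j) (Icc 0 (G.l j))

/-- The Kirchhoff operator `S^i_β u = ∑_{j ∈ Inc_i} β_{ij} a_{ij} ∂_j u(v_i)`. -/
noncomputable def kirchhoff (β : I → J → ℝ) (u : G.carrier → ℝ) (i : I) : ℝ :=
  ∑ j ∈ G.inc i, β i j * G.sign i j * G.edgeDeriv 1 j u (G.vertexParam i j)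

/-- `u ∈ C^k_{*,β}(Γ)`, where `B` is the set of (indices of) boundary vertices. -/
def IsCkStar (B : Set I) (β : I → J → ℝ) (k : ℕ) (u : G.carrier → ℝ) : Prop :=
  G.IsCk k u ∧ ∀ i ∉ B, G.kirchhoff β u i = 0

/-- `f` is Lipschitz continuous along the network, i.e. on every edge. -/
def IsLipschitz (f : G.carrier → ℝ) : Prop :=
  ∀ j, ∃ K, LipschitzOnWith K (G.restr f j) (Icc 0 (G.l j))

/-- `φ` is a test function at the point `π_j(y)`, `y ∈ (0, l_j)`. -/
def IsTestAt (φ : G.carrier → ℝ) (j : J) (y : ℝ) : Prop :=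
  Continuous φ ∧ DifferentiableWithinAt ℝ (G.restr φ j) (Icc 0 (G.l j)) y

/-- `φ` is a `(j,k)`-test function at the vertex `v_i`, for distinct `j, k ∈ Inc_i`. -/
def IsVertexTest (φ : G.carrier → ℝ) (i : I) (j k : J) : Prop :=
  Continuous φ ∧
  DifferentiableWithinAt ℝ (G.restr φ j) (Icc 0 (G.l j)) (G.vertexParam i j) ∧
  DifferentiableWithinAt ℝ (G.restr φ k) (Icc 0 (G.l k)) (G.vertexParam i k) ∧
  G.sign i j * G.edgeDeriv 1 j φ (G.vertexParam i j) +
    G.sign i k * G.edgeDeriv 1 k φ (G.vertexParam i k) = 0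

/-- The set `ē_j ∪ ē_k`, as a subset of the network. -/
def edgePair (j k : J) : Set G.carrier := {x | x.1 ∈ G.closedEdge j ∪ G.closedEdge k}

/-- Viscosity subsolutions of `H(x, u, ∂u) = 0`, for a Hamiltonian `H j y r p`
(`y ∈ [0, l_j]`), with boundary vertices indexed by `B`. -/
def IsSubsolution (B : Set I) (H : J → ℝ → ℝ → ℝ → ℝ) (u : G.carrier → ℝ) : Prop :=
  UpperSemicontinuous u ∧
  (∀ (j : J) (y : Icc 0 (G.l j)), y.1 ∈ Ioo 0 (G.l j) → ∀ φ : G.carrier → ℝ, G.IsTestAt φ j y →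
    IsLocalMax (fun x => u x - φ x) (G.point j y) →
      H j y (u (G.point j y)) (G.edgeDeriv 1 j φ y) ≤ 0) ∧
  (∀ i ∉ B, ∀ j ∈ G.inc i, ∀ k ∈ G.inc i, j ≠ k → ∀ φ : G.carrier → ℝ, G.IsVertexTest φ i j k →
    IsLocalMaxOn (fun x => u x - φ x) (G.edgePair j k) (G.vertex i) →
      H j (G.vertexParam i j) (u (G.vertex i)) (G.edgeDeriv 1 j φ (G.vertexParam i j)) ≤ 0)

/-- Viscosity supersolutions; at a transition vertex every incident edge `j` has a feasible
incident edge `k ≠ j`, chosen independently of the test function. -/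
def IsSupersolution (B : Set I) (H : J → ℝ → ℝ → ℝ → ℝ) (u : G.carrier → ℝ) : Prop :=
  LowerSemicontinuous u ∧
  (∀ (j : J) (y : Icc 0 (G.l j)), y.1 ∈ Ioo 0 (G.l j) → ∀ φ : G.carrier → ℝ, G.IsTestAt φ j y →
    IsLocalMin (fun x => u x - φ x) (G.point j y) →
      0 ≤ H j y (u (G.point j y)) (G.edgeDeriv 1 j φ y)) ∧
  (∀ i ∉ B, ∀ j ∈ G.inc i, ∃ k ∈ G.inc i, k ≠ j ∧ ∀ φ : G.carrier → ℝ, G.IsVertexTest φ i j k →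
    IsLocalMinOn (fun x => u x - φ x) (G.edgePair j k) (G.vertex i) →
      0 ≤ H j (G.vertexParam i j) (u (G.vertex i)) (G.edgeDeriv 1 j φ (G.vertexParam i j)))

/-- Viscosity solutions of `H(x, u, ∂u) = 0`. -/
def IsViscositySolution (B : Set I) (H : J → ℝ → ℝ → ℝ → ℝ) (u : G.carrier → ℝ) : Prop :=
  Continuous u ∧ G.IsSubsolution B H u ∧ G.IsSupersolution B H u

/-- `u` is a viscosity solution of `|∂u| = f` on `Γ`, `u = 0` at the boundary vertices. -/
def SolvesEikonal (B : Set I) (f u : G.carrier → ℝ) : Prop :=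
  G.IsViscositySolution B (fun j y _ p => |p| - G.restr f j y) u ∧ ∀ i ∈ B, u (G.vertex i) = 0

/-- `u` is a classical solution of `-ε ∂²u + |∂u|² = f²` on every edge, with the Kirchhoff condition
`S^i_β u = 0` at the transition vertices and `u = 0` at the boundary vertices. -/
def SolvesViscousEikonal (B : Set I) (β : I → J → ℝ) (f : G.carrier → ℝ) (ε : ℝ)
    (u : G.carrier → ℝ) : Prop :=
  G.IsCkStar B β 2 u ∧
  (∀ j, ∀ y ∈ Ioo 0 (G.l j),
    -ε * G.edgeDeriv 2 j u y + |G.edgeDeriv 1 j u y| ^ 2 = G.restr f j y ^ 2) ∧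
  ∀ i ∈ B, u (G.vertex i) = 0

end TopologicalNetwork

namespace TopologicalNetwork

variable {n : ℕ} {I J : Type*} [Fintype I] [Fintype J] (G : TopologicalNetwork n I J)

/-! ### Combinatorics of a network -/

/-! Both problems reduce to finite systems for the values at the vertices, and the limit is a
Laplace-type passage from one system to the other. Give each edge its optical length L_j, the
integral of f along it (`edgeLen`).

Eikonal problem. On an edge a viscosity subsolution is 1-Lipschitz for optical length
(`ViscositySubOn.abs_sub_le`), and a supersolution lies above the lower envelope of the two profiles
issuing from the end-points (`ViscositySuperOn.min_le`). So a solution equals that envelope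
(`SolvesEikonal.restr_eq`). The vertex conditions then say that U_i is the minimum over incident
edges of U_other + L_j at every transition vertex. On a finite graph this system has a comparison
principle (`vertex_comparison`) and, by Perron's method, a solution (`exists_vertex_solution`). This
gives uniqueness, and gluing envelopes gives existence (`exists_solvesEikonal`).

Viscous problem. The Hopf–Cole substitution w = exp(-u/ε) turns the equation into ε² w'' = f² w. The
Kirchhoff condition keeps its form, because w' = -w u'/ε and w takes a single value at a vertex.
Solving on each edge in terms of the end-point values leaves a linear system on the vertices with
strictly dominant diagonal, hence a unique and positive solution (`SolvesViscousEikonal.unique`,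
`exists_solvesViscousEikonal`).

Limit. The fundamental solutions behave like exp((F + o(1))/ε), with F a primitive of f
(`SolvesLinear.exists_exp_bounds`). Under -ε log a sum of exponentials becomes a minimum, while the
weights β and powers of ε disappear. The vertex values of u_ε therefore satisfy the discrete eikonal
system up to δ, and comparison with the multiples (1 ± κ)u gives their convergence
(`eventually_vertex_close`). The same computation inside the edges gives uniform convergence
(`eventually_edge_close`). -/

theorem zero_mem_Icc (j : J) : (0 : ℝ) ∈ Icc 0 (G.l j) := ⟨le_rfl, (G.l_pos j).le⟩

theorem length_mem_Icc (j : J) : G.l j ∈ Icc 0 (G.l j) := ⟨(G.l_pos j).le, le_rfl⟩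

/-- The initial vertex of an edge. -/
noncomputable def src (j : J) : I := (G.start_mem j).choose

/-- The terminal vertex of an edge. -/
noncomputable def tgt (j : J) : I := (G.end_mem j).choose

theorem v_src (j : J) : G.v (G.src j) = G.π j 0 := (G.start_mem j).choose_spec

theorem v_tgt (j : J) : G.v (G.tgt j) = G.π j (G.l j) := (G.end_mem j).choose_spec

theorem π_zero_ne (j : J) : G.π j 0 ≠ G.π j (G.l j) := fun e =>
  (G.l_pos j).ne (G.injOn j (G.zero_mem_Icc j) (G.length_mem_Icc j) e)

theorem src_ne_tgt (j : J) : G.src j ≠ G.tgt j := fun h =>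
  G.π_zero_ne j (by rw [← v_src, ← v_tgt, h])

theorem π_zero_eq_iff {i : I} {j : J} : G.π j 0 = G.v i ↔ G.src j = i := by
  rw [← v_src]; exact G.v_injective.eq_iff

theorem π_length_eq_iff {i : I} {j : J} : G.π j (G.l j) = G.v i ↔ G.tgt j = i := by
  rw [← v_tgt]; exact G.v_injective.eq_iff

theorem mem_closedEdge_iff {i : I} {j : J} : G.v i ∈ G.closedEdge j ↔ G.src j = i ∨ G.tgt j = i := by
  constructor
  · intro h
    have hj : j ∈ G.inc i := by simpa [inc] using h
    have := (G.vertexParam_spec hj).2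
    unfold vertexParam at this
    split_ifs at this with h'
    · exact Or.inl (G.π_zero_eq_iff.1 h')
    · exact Or.inr (G.π_length_eq_iff.1 this)
  · rintro (h | h)
    · exact ⟨0, G.zero_mem_Icc j, G.π_zero_eq_iff.2 h⟩
    · exact ⟨G.l j, G.length_mem_Icc j, G.π_length_eq_iff.2 h⟩

theorem mem_inc {i : I} {j : J} : j ∈ G.inc i ↔ G.src j = i ∨ G.tgt j = i := by
  simp [inc, mem_closedEdge_iff]

open Classical in
/-- The end-point of the edge `j` opposite to the vertex `i`. -/
noncomputable def other (i : I) (j : J) : I := if G.src j = i then G.tgt j else G.src j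

theorem inc_cases {i : I} {j : J} (h : j ∈ G.inc i) :
    (G.src j = i ∧ G.vertexParam i j = 0 ∧ G.sign i j = 1 ∧ G.other i j = G.tgt j) ∨
    (G.tgt j = i ∧ G.vertexParam i j = G.l j ∧ G.sign i j = -1 ∧ G.other i j = G.src j) := by
  by_cases h' : G.src j = i
  · left
    simp [vertexParam, sign, other, G.π_zero_eq_iff, h']
  · right
    have := (G.mem_inc.1 h).resolve_left h'
    simp [vertexParam, sign, other, G.π_zero_eq_iff, G.π_length_eq_iff, h', this]

theorem sign_mul_self {i : I} {j : J} (h : j ∈ G.inc i) : G.sign i j * G.sign i j = 1 := by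
  rcases G.inc_cases h with ⟨-, -, h, -⟩ | ⟨-, -, h, -⟩ <;> rw [h] <;> norm_num

theorem abs_sign {i : I} {j : J} (h : j ∈ G.inc i) : |G.sign i j| = 1 := by
  rcases G.inc_cases h with ⟨-, -, h, -⟩ | ⟨-, -, h, -⟩ <;> rw [h] <;> norm_num

theorem vertexParam_mem {i : I} {j : J} (h : j ∈ G.inc i) : G.vertexParam i j ∈ Icc 0 (G.l j) :=
  (G.vertexParam_spec h).1

theorem src_inc (j : J) : j ∈ G.inc (G.src j) := G.mem_inc.2 (Or.inl rfl)

theorem tgt_inc (j : J) : j ∈ G.inc (G.tgt j) := G.mem_inc.2 (Or.inr rfl)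

theorem other_src (j : J) : G.other (G.src j) j = G.tgt j := by simp [other]

theorem other_tgt (j : J) : G.other (G.tgt j) j = G.src j := by simp [other, G.src_ne_tgt]

theorem other_ne {i : I} {j : J} (h : j ∈ G.inc i) : G.other i j ≠ i := by
  rcases G.inc_cases h with ⟨h1, -, -, h2⟩ | ⟨h1, -, -, h2⟩ <;> rw [h2, ← h1]
  · exact (G.src_ne_tgt j).symm
  · exact G.src_ne_tgt j

theorem inc_nonempty (i : I) : (G.inc i).Nonempty := by
  obtain ⟨j, _, hj, _⟩ := G.connected i i
  exact ⟨j, G.mem_inc.2 (G.mem_closedEdge_iff.1 hj)⟩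

/-- A property of vertices that is inherited along edges, and holds somewhere, holds everywhere. -/
theorem vertex_induction {p : I → Prop} (h : ∀ i, ∀ j ∈ G.inc i, p i → p (G.other i j))
    {i : I} (hi : p i) (i' : I) : p i' := by
  have key : ∀ j : J, ∀ a b : I, j ∈ G.inc a → j ∈ G.inc b → p a → p b := by
    intro j a b ha hb hp
    by_cases hab : a = b
    · exact hab ▸ hp
    have : G.other a j = b := by
      rcases G.inc_cases ha with ⟨h1, -, -, h2⟩ | ⟨h1, -, -, h2⟩ <;> rw [h2] <;>
        rcases G.mem_inc.1 hb with h3 | h3 <;> first | exact h3 | exact absurd (h1.symm.trans h3) hab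
    exact this ▸ h a j ha hp
  obtain ⟨j, k, hj, hk, hjk⟩ := G.connected i i'
  -- The induction along the chain carries the property at every end-point of the current edge.
  -- Consecutive edges share a vertex, through which it passes on.
  have hq : ∀ a, k ∈ G.inc a → p a := by
    clear hk
    induction hjk with
    | refl => exact fun a ha => key j i a (G.mem_inc.2 (G.mem_closedEdge_iff.1 hj)) ha hi
    | @tail b c _ hbc ih =>
      intro a ha
      by_cases hne : b = c
      · exact ih a (hne ▸ ha)
      obtain ⟨x, hx⟩ := encard_eq_one.1 hbc
      have hx' : x ∈ G.π b '' Icc 0 (G.l b) ∩ G.π c '' Icc 0 (G.l c) := hx ▸ mem_singleton x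
      obtain ⟨m, rfl⟩ := G.inter_subset b c hne hx'
      exact key c m a (G.mem_inc.2 (G.mem_closedEdge_iff.1 hx'.2)) ha
        (ih m (G.mem_inc.2 (G.mem_closedEdge_iff.1 hx'.1)))
  exact hq i' (G.mem_inc.2 (G.mem_closedEdge_iff.1 hk))

/-! ### Topology of a network -/

theorem exists_point (x : G.carrier) : ∃ j y, G.point j y = x := by
  obtain ⟨x, hx⟩ := x
  obtain ⟨j, y, hy, rfl⟩ := mem_iUnion.1 hx
  exact ⟨j, ⟨y, hy⟩, rfl⟩

theorem isClosedEmbedding_point (j : J) : IsClosedEmbedding (G.point j) := by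
  refine Continuous.isClosedEmbedding ?_ ?_
  · exact Continuous.subtype_mk (continuousOn_iff_continuous_domRestrict.1 (G.smooth j).continuousOn) _
  · intro y z h
    exact Subtype.ext (G.injOn j y.2 z.2 (congrArg Subtype.val h))

theorem iUnion_range_point : ⋃ j, range (G.point j) = univ :=
  eq_univ_of_forall fun x => by
    obtain ⟨j, y, rfl⟩ := G.exists_point x
    exact mem_iUnion.2 ⟨j, mem_range_self y⟩

/-- The edges are finitely many and cover the network, so continuity and local extrema can be tested
edge by edge. -/
theorem nhds_eq_iSup (x : G.carrier) : 𝓝 x = ⨆ j, 𝓝[range (G.point j)] x := by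
  rw [← nhdsWithin_iUnion, iUnion_range_point, nhdsWithin_univ]

theorem nhdsWithin_range_point (j : J) (y : Icc 0 (G.l j)) :
    𝓝[range (G.point j)] (G.point j y) = map (G.point j) (𝓝 y) :=
  ((G.isClosedEmbedding_point j).isEmbedding.map_nhds_eq y).symm

theorem nhdsWithin_range_eq_bot {j : J} {x : G.carrier} (hx : x ∉ range (G.point j)) :
    𝓝[range (G.point j)] x = ⊥ := by
  rwa [← notMem_closure_iff_nhdsWithin_eq_bot,
    (G.isClosedEmbedding_point j).isClosed_range.closure_eq]

theorem continuous_iff_edges {u : G.carrier → ℝ} :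
    Continuous u ↔ ∀ j, Continuous fun y => u (G.point j y) := by
  refine ⟨fun h j => h.comp (G.isClosedEmbedding_point j).continuous, fun h => ?_⟩
  rw [continuous_iff_continuousAt]
  intro x
  rw [ContinuousAt, nhds_eq_iSup, tendsto_iSup]
  intro j
  by_cases hx : x ∈ range (G.point j)
  · obtain ⟨y, rfl⟩ := hx
    rw [nhdsWithin_range_point, tendsto_map'_iff]
    exact (h j).tendsto y
  · rw [G.nhdsWithin_range_eq_bot hx]
    exact tendsto_bot

theorem restr_apply (u : G.carrier → ℝ) (j : J) (y : Icc 0 (G.l j)) :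
    G.restr u j y = u (G.point j y) := IccExtend_val _ _ _

theorem restr_of_mem (u : G.carrier → ℝ) {j : J} {y : ℝ} (hy : y ∈ Icc 0 (G.l j)) :
    G.restr u j y = u (G.point j ⟨y, hy⟩) := G.restr_apply u j ⟨y, hy⟩

theorem continuous_restr {u : G.carrier → ℝ} (hu : Continuous u) (j : J) :
    Continuous (G.restr u j) :=
  (G.continuous_iff_edges.1 hu j).Icc_extend'

theorem point_zero (j : J) : G.point j ⟨0, G.zero_mem_Icc j⟩ = G.vertex (G.src j) :=
  Subtype.ext (G.v_src j).symm

theorem point_length (j : J) : G.point j ⟨G.l j, G.length_mem_Icc j⟩ = G.vertex (G.tgt j) :=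
  Subtype.ext (G.v_tgt j).symm

theorem restr_zero (u : G.carrier → ℝ) (j : J) : G.restr u j 0 = u (G.vertex (G.src j)) := by
  rw [G.restr_of_mem u (G.zero_mem_Icc j), point_zero]

theorem restr_length (u : G.carrier → ℝ) (j : J) :
    G.restr u j (G.l j) = u (G.vertex (G.tgt j)) := by
  rw [G.restr_of_mem u (G.length_mem_Icc j), point_length]

theorem restr_vertexParam (u : G.carrier → ℝ) {i : I} {j : J} (h : j ∈ G.inc i) :
    G.restr u j (G.vertexParam i j) = u (G.vertex i) := by
  rcases G.inc_cases h with ⟨h1, h2, -⟩ | ⟨h1, h2, -⟩ <;> rw [h2, ← h1]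
  · exact G.restr_zero u j
  · exact G.restr_length u j

theorem ext_restr {u w : G.carrier → ℝ}
    (h : ∀ j, ∀ y ∈ Icc 0 (G.l j), G.restr u j y = G.restr w j y) : u = w := by
  funext x
  obtain ⟨j, y, rfl⟩ := G.exists_point x
  simpa only [restr_apply] using h j y y.2

theorem point_vertexParam {i : I} {j : J} (h : j ∈ G.inc i) :
    G.point j ⟨_, G.vertexParam_mem h⟩ = G.vertex i :=
  Subtype.ext (G.vertexParam_spec h).2

/-- A point of an open edge lies on no other edge. -/
theorem notMem_range_point {j k : J} (hjk : j ≠ k) {y : Icc 0 (G.l j)} (hy : y.1 ∈ Ioo 0 (G.l j)) :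
    G.point j y ∉ range (G.point k) := by
  rintro ⟨z, hz⟩
  have hz' : G.π k z = G.π j y := congrArg Subtype.val hz
  obtain ⟨i, hi⟩ := G.inter_subset j k hjk ⟨mem_image_of_mem _ y.2, hz' ▸ mem_image_of_mem _ z.2⟩
  have hi' : G.π j y ∈ G.closedEdge j := mem_image_of_mem _ y.2
  rw [← hi, G.mem_closedEdge_iff, ← G.π_zero_eq_iff, ← G.π_length_eq_iff, hi] at hi'
  rcases hi' with h | h
  · exact hy.1.ne (G.injOn j (G.zero_mem_Icc j) y.2 h)
  · exact hy.2.ne' (G.injOn j (G.length_mem_Icc j) y.2 h)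

theorem nhds_point {j : J} {y : Icc 0 (G.l j)} (hy : y.1 ∈ Ioo 0 (G.l j)) :
    𝓝 (G.point j y) = map (G.point j) (𝓝 y) := by
  rw [← nhdsWithin_range_point, nhds_eq_iSup]
  refine le_antisymm (iSup_le fun k => ?_) (le_iSup (fun k => 𝓝[range (G.point k)] (G.point j y)) j)
  by_cases hjk : j = k
  · subst hjk; exact le_rfl
  · rw [G.nhdsWithin_range_eq_bot (G.notMem_range_point hjk hy)]; exact bot_le

theorem edgePair_eq (j k : J) : G.edgePair j k = range (G.point j) ∪ range (G.point k) := by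
  ext x
  have : ∀ j, x.1 ∈ G.closedEdge j ↔ x ∈ range (G.point j) := fun j =>
    ⟨fun ⟨y, hy, e⟩ => ⟨⟨y, hy⟩, Subtype.ext e⟩, fun ⟨y, e⟩ => e ▸ mem_image_of_mem _ y.2⟩
  simp only [edgePair, mem_ofPred_eq, mem_union, this]

/-- Functions on the edges with common values at the vertices can be glued. -/
theorem exists_glue (U : I → ℝ) (g : J → ℝ → ℝ) (hg : ∀ j, ContinuousOn (g j) (Icc 0 (G.l j)))
    (h0 : ∀ j, g j 0 = U (G.src j)) (h1 : ∀ j, g j (G.l j) = U (G.tgt j)) :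
    ∃ u : G.carrier → ℝ, Continuous u ∧ (∀ j, ∀ y ∈ Icc 0 (G.l j), G.restr u j y = g j y) ∧
      ∀ i, u (G.vertex i) = U i := by
  choose e p hp using G.exists_point
  have hval : ∀ i : I, ∀ j : J, ∀ y : Icc 0 (G.l j), G.point j y = G.vertex i → g j y = U i := by
    intro i j y hy
    have hy' : G.π j y = G.v i := congrArg Subtype.val hy
    rcases G.mem_closedEdge_iff.1 (hy' ▸ mem_image_of_mem _ y.2 : G.v i ∈ G.closedEdge j) with h | h
    · rw [← G.injOn j (G.zero_mem_Icc j) y.2 ((G.π_zero_eq_iff.2 h).trans hy'.symm), h0, h]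
    · rw [← G.injOn j (G.length_mem_Icc j) y.2 ((G.π_length_eq_iff.2 h).trans hy'.symm), h1, h]
  -- The glued function uses a chosen parametrization of each point. The choice is harmless:
  -- distinct edges meet only at vertices, where `hval` fixes the value.
  have key : ∀ j (y : Icc 0 (G.l j)), g (e (G.point j y)) (p (G.point j y)) = g j y := by
    intro j y
    have same : ∀ k (z : Icc 0 (G.l k)), k = j → G.point k z = G.point j y → g k z = g j y := by
      rintro k z rfl h
      rw [(G.isClosedEmbedding_point k).injective h]
    have hx := hp (G.point j y)
    set x := G.point j y with hxd
    by_cases hej : e x = j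
    · exact same _ _ hej hx
    · have hx1 : x.1 ∈ G.π j '' Icc 0 (G.l j) := mem_image_of_mem _ y.2
      have hx2 : x.1 ∈ G.π (e x) '' Icc 0 (G.l (e x)) :=
        (congrArg Subtype.val hx : G.π (e x) (p x) = x.1) ▸ mem_image_of_mem _ (p x).2
      obtain ⟨i, hi⟩ := G.inter_subset _ _ hej ⟨hx2, hx1⟩
      have hi' : x = G.vertex i := Subtype.ext hi.symm
      rw [hval i _ _ (hx.trans hi'), hval i _ _ (hxd.symm.trans hi')]
  refine ⟨fun x => g (e x) (p x), ?_, ?_, ?_⟩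
  · rw [continuous_iff_edges]
    intro j
    simp only [key]
    exact continuousOn_iff_continuous_domRestrict.1 (hg j)
  · intro j y hy
    rw [restr_of_mem _ _ hy]
    exact key j ⟨y, hy⟩
  · intro i
    exact hval i _ _ (hp _)

/-- A continuous function on an edge extends to the network. -/
theorem exists_extension (j : J) {g : ℝ → ℝ} (hg : ContinuousOn g (Icc 0 (G.l j))) :
    ∃ φ : G.carrier → ℝ, Continuous φ ∧ ∀ y ∈ Icc 0 (G.l j), G.restr φ j y = g y := by
  obtain ⟨φ, hφ⟩ := ContinuousMap.exists_extension (G.isClosedEmbedding_point j)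
    ⟨_, continuousOn_iff_continuous_domRestrict.1 hg⟩
  refine ⟨φ, φ.continuous, fun y hy => ?_⟩
  rw [restr_of_mem _ _ hy]
  exact DFunLike.congr_fun hφ ⟨y, hy⟩

end TopologicalNetwork

/-! ### Second order linear equations on an interval -/

theorem contDiffOn_two_of_hasDerivWithinAt {z z1 z2 : ℝ → ℝ} {l : ℝ} (hl : 0 < l)
    (h1 : ∀ y ∈ Icc 0 l, HasDerivWithinAt z (z1 y) (Icc 0 l) y)
    (h2 : ∀ y ∈ Icc 0 l, HasDerivWithinAt z1 (z2 y) (Icc 0 l) y)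
    (hc : ContinuousOn z2 (Icc 0 l)) :
    ContDiffOn ℝ 2 z (Icc 0 l) ∧ ∀ y ∈ Icc 0 l,
      iteratedDerivWithin 1 z (Icc 0 l) y = z1 y ∧ iteratedDerivWithin 2 z (Icc 0 l) y = z2 y := by
  have hu := uniqueDiffOn_Icc hl
  have e1 : ∀ y ∈ Icc 0 l, derivWithin z (Icc 0 l) y = z1 y := fun y hy =>
    (h1 y hy).derivWithin (hu y hy)
  have e2 : ∀ y ∈ Icc 0 l, derivWithin z1 (Icc 0 l) y = z2 y := fun y hy =>
    (h2 y hy).derivWithin (hu y hy)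
  refine ⟨?_, fun y hy => ?_⟩
  · rw [show (2 : WithTop ℕ∞) = 1 + 1 by norm_num, contDiffOn_succ_iff_derivWithin hu]
    refine ⟨fun y hy => (h1 y hy).differentiableWithinAt, by simp, ?_⟩
    rw [contDiffOn_congr e1, show (1 : WithTop ℕ∞) = 0 + 1 by norm_num,
      contDiffOn_succ_iff_derivWithin hu]
    refine ⟨fun y hy => (h2 y hy).differentiableWithinAt, by simp, ?_⟩
    rw [contDiffOn_congr e2]
    exact contDiffOn_zero.2 hc
  · have e1' : ∀ y ∈ Icc 0 l, iteratedDerivWithin 1 z (Icc 0 l) y = z1 y := fun y hy => by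
      rw [iteratedDerivWithin_one, e1 y hy]
    refine ⟨e1' y hy, ?_⟩
    rw [iteratedDerivWithin_succ, derivWithin_congr e1' (e1' y hy), e2 y hy]

theorem hasDerivWithinAt_of_contDiffOn_two {z : ℝ → ℝ} {l : ℝ} (hl : 0 < l)
    (hz : ContDiffOn ℝ 2 z (Icc 0 l)) : ∀ y ∈ Icc 0 l,
      HasDerivWithinAt z (iteratedDerivWithin 1 z (Icc 0 l) y) (Icc 0 l) y ∧
      HasDerivWithinAt (iteratedDerivWithin 1 z (Icc 0 l)) (iteratedDerivWithin 2 z (Icc 0 l) y)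
        (Icc 0 l) y := by
  intro y hy
  have hu := uniqueDiffOn_Icc hl
  constructor
  · rw [iteratedDerivWithin_one]
    exact (hz.differentiableOn (by norm_num) y hy).hasDerivWithinAt
  · have := (hz.differentiableOn_iteratedDerivWithin (m := 1) (by norm_num) hu y hy).hasDerivWithinAt
    rwa [← iteratedDerivWithin_succ] at this

/-- `z` solves `z'' = c z` on `[0, l]`, and `z'` is its derivative. -/
structure SolvesLinear (c : ℝ → ℝ) (l : ℝ) (z z' : ℝ → ℝ) : Prop where
  hasDeriv : ∀ y ∈ Icc 0 l, HasDerivWithinAt z (z' y) (Icc 0 l) y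
  hasDeriv' : ∀ y ∈ Icc 0 l, HasDerivWithinAt z' (c y * z y) (Icc 0 l) y

namespace SolvesLinear

variable {c : ℝ → ℝ} {l : ℝ} {z z' w w' : ℝ → ℝ}

theorem continuousOn (h : SolvesLinear c l z z') : ContinuousOn z (Icc 0 l) :=
  fun y hy => (h.hasDeriv y hy).continuousWithinAt

theorem continuousOn' (h : SolvesLinear c l z z') : ContinuousOn z' (Icc 0 l) :=
  fun y hy => (h.hasDeriv' y hy).continuousWithinAt

theorem hasDerivAt (h : SolvesLinear c l z z') {y : ℝ} (hy : y ∈ Ioo 0 l) :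
    HasDerivAt z (z' y) y :=
  (h.hasDeriv y (Ioo_subset_Icc_self hy)).hasDerivAt (Icc_mem_nhds hy.1 hy.2)

theorem hasDerivAt' (h : SolvesLinear c l z z') {y : ℝ} (hy : y ∈ Ioo 0 l) :
    HasDerivAt z' (c y * z y) y :=
  (h.hasDeriv' y (Ioo_subset_Icc_self hy)).hasDerivAt (Icc_mem_nhds hy.1 hy.2)

theorem comb (h : SolvesLinear c l z z') (hw : SolvesLinear c l w w') (a b : ℝ) :
    SolvesLinear c l (fun y => a * z y + b * w y) (fun y => a * z' y + b * w' y) where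
  hasDeriv y hy := ((h.hasDeriv y hy).const_mul a).add ((hw.hasDeriv y hy).const_mul b)
  hasDeriv' y hy := by
    convert! ((h.hasDeriv' y hy).const_mul a).add ((hw.hasDeriv' y hy).const_mul b) using 1
    ring

theorem reflect (h : SolvesLinear c l z z') :
    SolvesLinear (fun y => c (l - y)) l (fun y => z (l - y)) (fun y => -z' (l - y)) := by
  have hm : MapsTo (fun y => l - y) (Icc 0 l) (Icc 0 l) := fun y hy =>
    ⟨sub_nonneg.2 hy.2, sub_le_self l hy.1⟩
  have hd : ∀ y, HasDerivWithinAt (fun y => l - y) (-1) (Icc 0 l) y := fun y =>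
    ((hasDerivAt_id y).const_sub l).hasDerivWithinAt
  constructor
  · intro y hy
    convert! (h.hasDeriv _ (hm hy)).comp y (hd y) hm using 1
    ring
  · intro y hy
    convert! ((h.hasDeriv' _ (hm hy)).comp y (hd y) hm).neg using 1
    ring

/-- The homogeneous Dirichlet problem has only the trivial solution. -/
theorem eq_zero (hl : 0 < l) {z2 : ℝ → ℝ} (hc : ∀ y ∈ Ioo 0 l, 0 ≤ c y)
    (h1 : ∀ y ∈ Icc 0 l, HasDerivWithinAt z (z' y) (Icc 0 l) y)
    (h2 : ∀ y ∈ Icc 0 l, HasDerivWithinAt z' (z2 y) (Icc 0 l) y)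
    (h3 : ∀ y ∈ Ioo 0 l, z2 y = c y * z y) (hz0 : z 0 = 0) (hzl : z l = 0) :
    ∀ y ∈ Icc 0 l, z y = 0 := by
  have hd : ∀ y ∈ Icc 0 l,
      HasDerivWithinAt (fun y => z y * z' y) (z' y * z' y + z y * z2 y) (Icc 0 l) y :=
    fun y hy => (h1 y hy).mul (h2 y hy)
  -- (z z')' = z'² + c z² ≥ 0, and z z' vanishes at both ends. So z z' = 0 throughout, and z² is
  -- constant.
  have hmono : MonotoneOn (fun y => z y * z' y) (Icc 0 l) := by
    refine monotoneOn_of_hasDerivWithinAt_nonneg (convex_Icc 0 l)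
      (fun y hy => (hd y hy).continuousWithinAt)
      (fun y hy => (hd y (interior_subset hy)).mono interior_subset) fun y hy => ?_
    rw [interior_Icc] at hy
    rw [h3 y hy]
    nlinarith [mul_self_nonneg (z' y), mul_nonneg (hc y hy) (mul_self_nonneg (z y))]
  have h0 : ∀ y ∈ Icc 0 l, z y * z' y = 0 := by
    intro y hy
    have a := hmono ⟨le_rfl, hl.le⟩ hy hy.1
    have b := hmono hy ⟨hl.le, le_rfl⟩ hy.2
    simp only [hz0, hzl, zero_mul] at a b
    exact le_antisymm b a
  have hsq : ∀ y ∈ Icc 0 l, HasDerivWithinAt (fun y => z y * z y) 0 (Icc 0 l) y := by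
    intro y hy
    convert! (h1 y hy).mul (h1 y hy) using 1
    linarith [h0 y hy, mul_comm (z y) (z' y)]
  intro y hy
  have := (convex_Icc 0 l).is_const_of_fderivWithin_eq_zero (𝕜 := ℝ)
    (f := fun y => z y * z y) (fun y hy => (hsq y hy).differentiableWithinAt)
    (fun y hy => by
      have := (hsq y hy).derivWithin (uniqueDiffOn_Icc hl y hy)
      ext
      exact this) hy ⟨le_rfl, hl.le⟩
  simpa [hz0] using this

/-- The solution with `z(0) = 0`, `z'(0) = 1` exists. -/
theorem exists_fundamental (hl : 0 < l) (hc : ContinuousOn c (Icc 0 l)) :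
    ∃ z z', SolvesLinear c l z z' ∧ z 0 = 0 ∧ z' 0 = 1 := by
  -- Taking C ≥ 1 lets the same constant control both components of the first order system (z, z')'
  -- = (z', c z).
  obtain ⟨C, hC1, hC⟩ : ∃ C : ℝ, 1 ≤ C ∧ ∀ t ∈ Icc 0 l, |c t| ≤ C := by
    obtain ⟨C, hC⟩ := isCompact_Icc.exists_bound_of_continuousOn hc
    exact ⟨max 1 C, le_max_left _ _, fun t ht => (hC t ht).trans (le_max_right _ _)⟩
  have hC0 : 0 ≤ C := zero_le_one.trans hC1
  -- R is the Grönwall bound for data of norm 1. Truncating the linear field at height R makes it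
  -- bounded, so Picard–Lindelöf applies on all of [0, l] at once.
  set R : ℝ := Real.exp (C * l)
  have hR : 0 ≤ R := (Real.exp_pos _).le
  let k : ℝ → ℝ := fun x => max (-R) (min x R)
  have hk1 : LipschitzWith 1 k := (LipschitzWith.id.min_const R).const_max (-R)
  have hk2 : ∀ x, |k x| ≤ R := fun x =>
    abs_le.2 ⟨le_max_left _ _, max_le (by linarith) (min_le_right _ _)⟩
  have hk3 : ∀ x, |x| ≤ R → k x = x := fun x hx => by
    have := abs_le.1 hx
    simp only [k]
    rw [min_eq_left this.2, max_eq_right this.1]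
  have hk4 : ∀ x, |k x| ≤ |x| := fun x => by
    have := hk1.dist_le_mul x 0
    rw [hk3 0 (by simpa using hR)] at this
    simpa [Real.dist_eq] using this
  let F : ℝ → ℝ × ℝ → ℝ × ℝ := fun t x => (k x.2, c t * k x.1)
  have hpl : IsPicardLindelof F (tmin := 0) (tmax := l) ⟨0, le_rfl, hl.le⟩ ((0 : ℝ), (1 : ℝ))
      ⟨C * R * l, by positivity⟩ 0 ⟨C * R, by positivity⟩ ⟨C, hC0⟩ := by
    constructor
    · intro t ht
      refine LipschitzOnWith.of_dist_le_mul fun x _ y _ => ?_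
      have ha := hk1.dist_le_mul x.2 y.2
      have hb := hk1.dist_le_mul x.1 y.1
      rw [NNReal.coe_one, one_mul] at ha hb
      have hx1 : dist x.1 y.1 ≤ dist x y := by rw [Prod.dist_eq]; exact le_max_left _ _
      have hx2 : dist x.2 y.2 ≤ dist x y := by rw [Prod.dist_eq]; exact le_max_right _ _
      rw [Prod.dist_eq (x := F t x)]
      refine max_le ?_ ?_
      · calc dist (k x.2) (k y.2) ≤ dist x y := ha.trans hx2
          _ ≤ C * dist x y := le_mul_of_one_le_left dist_nonneg hC1
      · calc dist (c t * k x.1) (c t * k y.1) = |c t| * dist (k x.1) (k y.1) := by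
              rw [Real.dist_eq, Real.dist_eq, ← mul_sub, abs_mul]
          _ ≤ C * dist x y := mul_le_mul (hC t ht) (hb.trans hx1) dist_nonneg hC0
    · intro x _
      exact continuousOn_const.prodMk (hc.mul continuousOn_const)
    · intro t ht x _
      refine max_le ?_ ?_
      · exact (hk2 _).trans (le_mul_of_one_le_left hR hC1)
      · change |c t * k x.1| ≤ C * R
        rw [abs_mul]
        exact mul_le_mul (hC t ht) (hk2 _) (abs_nonneg _) hC0
    · change C * R * max (l - 0) (0 - 0) ≤ C * R * l - 0
      rw [sub_zero, sub_zero, sub_zero, max_eq_left hl.le]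
  obtain ⟨x, hx0, hx⟩ := hpl.exists_eq_forall_mem_Icc_hasDerivWithinAt₀
  have hxc : ContinuousOn x (Icc 0 l) := fun t ht => (hx t ht).continuousWithinAt
  -- Truncation does not increase absolute values, so the Grönwall estimate of the linear system
  -- survives and shows that the truncation is never active.
  have hbound : ∀ t ∈ Icc 0 l, ‖x t‖ ≤ R := by
    intro t ht
    have := norm_le_gronwallBound_of_norm_deriv_right_le (f' := fun t => F t (x t)) (δ := 1)
      (K := C) (ε := 0) hxc
      (fun s hs => (hx s (Ico_subset_Icc_self hs)).mono_of_mem_nhdsWithin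
        (Icc_mem_nhdsGE_of_mem hs))
      (by simp only at hx0; rw [hx0]; simp [Prod.norm_def]) (fun s hs => ?_) t ht
    · refine this.trans ?_
      rw [gronwallBound_ε0, one_mul]
      exact Real.exp_le_exp.2 (by nlinarith [ht.2])
    · have hs' := Ico_subset_Icc_self hs
      rw [add_zero]
      have h1 : ‖(x s).1‖ ≤ ‖x s‖ := norm_fst_le _
      have h2 : ‖(x s).2‖ ≤ ‖x s‖ := norm_snd_le _
      refine max_le ?_ ?_
      · exact ((hk4 _).trans h2).trans (le_mul_of_one_le_left (norm_nonneg _) hC1)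
      · change |c s * k (x s).1| ≤ C * ‖x s‖
        rw [abs_mul]
        exact mul_le_mul (hC s hs') ((hk4 _).trans h1) (abs_nonneg _) hC0
  refine ⟨fun t => (x t).1, fun t => (x t).2, ⟨fun t ht => ?_, fun t ht => ?_⟩, ?_, ?_⟩
  · have := (hasFDerivAt_fst (𝕜 := ℝ) (p := x t)).comp_hasDerivWithinAt t (hx t ht)
    have h2 : ‖(x t).2‖ ≤ R := (norm_snd_le _).trans (hbound t ht)
    convert! this using 1
    exact (hk3 _ h2).symm
  · have := (hasFDerivAt_snd (𝕜 := ℝ) (p := x t)).comp_hasDerivWithinAt t (hx t ht)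
    have h2 : ‖(x t).1‖ ≤ R := (norm_fst_le _).trans (hbound t ht)
    convert! this using 1
    exact congrArg (c t * ·) (hk3 _ h2).symm
  · simp only at hx0; simp [hx0]
  · simp only at hx0; simp [hx0]

theorem monotoneOn_of_nonneg {s : ℝ} (h : SolvesLinear c l z z') (hs : s ≤ l)
    (hz : ∀ y ∈ Ioo 0 s, 0 ≤ c y * z y) : MonotoneOn z' (Icc 0 s) := by
  refine monotoneOn_of_hasDerivWithinAt_nonneg (f' := fun y => c y * z y) (convex_Icc 0 s)
    (h.continuousOn'.mono (Icc_subset_Icc_right hs)) (fun y hy => ?_) fun y hy => ?_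
  · rw [interior_Icc] at hy
    exact (h.hasDerivAt' ⟨hy.1, hy.2.trans_le hs⟩).hasDerivWithinAt
  · rw [interior_Icc] at hy
    exact hz y hy

theorem monotoneOn_self {s : ℝ} (h : SolvesLinear c l z z') (hs : s ≤ l)
    (hz : ∀ y ∈ Ioo 0 s, 0 ≤ z' y) : MonotoneOn z (Icc 0 s) := by
  refine monotoneOn_of_hasDerivWithinAt_nonneg (f' := z') (convex_Icc 0 s)
    (h.continuousOn.mono (Icc_subset_Icc_right hs)) (fun y hy => ?_) fun y hy => ?_
  · rw [interior_Icc] at hy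
    exact (h.hasDerivAt ⟨hy.1, hy.2.trans_le hs⟩).hasDerivWithinAt
  · rw [interior_Icc] at hy
    exact hz y hy

/-- Up to the first point t where z' ≤ 0, the function z increases from 0. Hence z'' = c z ≥ 0 there
and z'(t) ≥ z'(0) = 1, a contradiction. -/
theorem deriv_pos (h : SolvesLinear c l z z') (hc : ∀ y ∈ Icc 0 l, 0 ≤ c y)
    (h0 : z 0 = 0) (h1 : z' 0 = 1) : ∀ y ∈ Icc 0 l, 0 < z' y := by
  by_contra! hcon
  obtain ⟨y, hy, hy0⟩ := hcon
  have hKc : IsCompact (Icc 0 l ∩ z' ⁻¹' Iic 0) := isCompact_Icc.of_isClosed_subset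
    (h.continuousOn'.preimage_isClosed_of_isClosed isClosed_Icc isClosed_Iic) inter_subset_left
  obtain ⟨t, htK, ht⟩ := hKc.exists_isLeast ⟨y, hy, hy0⟩
  have hpos : ∀ s ∈ Ioo 0 t, 0 ≤ z' s := fun s hs => by
    by_contra! hneg
    exact (ht ⟨⟨hs.1.le, hs.2.le.trans htK.1.2⟩, hneg.le⟩).not_gt hs.2
  have hz := h.monotoneOn_self htK.1.2 hpos
  have hz' := h.monotoneOn_of_nonneg htK.1.2 fun s hs =>
    mul_nonneg (hc s ⟨hs.1.le, hs.2.le.trans htK.1.2⟩)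
      (h0 ▸ hz ⟨le_rfl, htK.1.1⟩ ⟨hs.1.le, hs.2.le⟩ hs.1.le)
  have := hz' ⟨le_rfl, htK.1.1⟩ ⟨htK.1.1, le_rfl⟩ htK.1.1
  have htn : z' t ≤ 0 := htK.2
  linarith

theorem nonneg_of_fundamental (h : SolvesLinear c l z z') (hc : ∀ y ∈ Icc 0 l, 0 ≤ c y)
    (h0 : z 0 = 0) (h1 : z' 0 = 1) : ∀ y ∈ Icc 0 l, 0 ≤ z y := fun _ hy =>
  h0 ▸ h.monotoneOn_self le_rfl
    (fun s hs => (h.deriv_pos hc h0 h1 s (Ioo_subset_Icc_self hs)).le)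
    ⟨le_rfl, hy.1.trans hy.2⟩ hy hy.1

theorem one_le_deriv (h : SolvesLinear c l z z') (hc : ∀ y ∈ Icc 0 l, 0 ≤ c y)
    (h0 : z 0 = 0) (h1 : z' 0 = 1) : ∀ y ∈ Icc 0 l, 1 ≤ z' y := fun _ hy =>
  h1 ▸ h.monotoneOn_of_nonneg le_rfl (fun s hs => mul_nonneg (hc s (Ioo_subset_Icc_self hs))
    (h.nonneg_of_fundamental hc h0 h1 s (Ioo_subset_Icc_self hs))) ⟨le_rfl, hy.1.trans hy.2⟩ hy hy.1

theorem le_self_of_fundamental (h : SolvesLinear c l z z') (hc : ∀ y ∈ Icc 0 l, 0 ≤ c y)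
    (h0 : z 0 = 0) (h1 : z' 0 = 1) : ∀ y ∈ Icc 0 l, y ≤ z y := by
  intro y hy
  have : MonotoneOn (fun t => z t - t) (Icc 0 l) := by
    refine monotoneOn_of_hasDerivWithinAt_nonneg (f' := fun t => z' t - 1) (convex_Icc 0 l)
      (h.continuousOn.sub continuousOn_id) (fun t ht => ?_) fun t ht => ?_ <;>
      rw [interior_Icc] at ht
    · exact ((h.hasDerivAt ht).sub (hasDerivAt_id t)).hasDerivWithinAt
    · linarith [h.one_le_deriv hc h0 h1 t (Ioo_subset_Icc_self ht)]
  have := this ⟨le_rfl, hy.1.trans hy.2⟩ hy hy.1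
  simp only [h0] at this
  linarith

/-- (t z' - z)' = t c z > 0. The strict inequality is what makes the diagonal of the vertex system
dominant. -/
theorem lt_mul_deriv (h : SolvesLinear c l z z') (hl : 0 < l) (hc : ∀ y ∈ Icc 0 l, 0 < c y)
    (h0 : z 0 = 0) (h1 : z' 0 = 1) : z l < l * z' l := by
  have : StrictMonoOn (fun t => t * z' t - z t) (Icc 0 l) := by
    refine strictMonoOn_of_hasDerivWithinAt_pos (f' := fun t => 1 * z' t + t * (c t * z t) - z' t)
      (convex_Icc 0 l) ((continuousOn_id.mul h.continuousOn').sub h.continuousOn)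
      (fun t ht => ?_) fun t ht => ?_ <;>
      rw [interior_Icc] at ht
    · exact (((hasDerivAt_id t).mul (h.hasDerivAt' ht)).sub (h.hasDerivAt ht)).hasDerivWithinAt
    · have ht' := Ioo_subset_Icc_self ht
      have := h.le_self_of_fundamental (fun y hy => (hc y hy).le) h0 h1 t ht'
      have := mul_pos ht.1 (mul_pos (hc t ht') (ht.1.trans_le this))
      linarith
  have := this ⟨le_rfl, hl.le⟩ ⟨hl.le, le_rfl⟩ hl
  simp only [h0] at this
  linarith

/-- (M t z - z')' ≥ 0, starting from the value -1. With M of order 1/ε² this bounds z'/z by a power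
of 1/ε, which is negligible on the exponential scale. -/
theorem deriv_le_of_le (h : SolvesLinear c l z z') {M : ℝ} (hc : ∀ y ∈ Icc 0 l, 0 ≤ c y)
    (hM : ∀ y ∈ Icc 0 l, c y ≤ M) (h0 : z 0 = 0) (h1 : z' 0 = 1) :
    ∀ y ∈ Icc 0 l, z' y ≤ 1 + M * (y * z y) := by
  intro y hy
  have : MonotoneOn (fun t => M * (t * z t) - z' t) (Icc 0 l) := by
    refine monotoneOn_of_hasDerivWithinAt_nonneg
      (f' := fun t => M * (1 * z t + t * z' t) - c t * z t)
      (convex_Icc 0 l) ((continuousOn_const.mul (continuousOn_id.mul h.continuousOn)).sub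
        h.continuousOn') (fun t ht => ?_) fun t ht => ?_ <;>
      rw [interior_Icc] at ht
    · exact ((((hasDerivAt_id t).mul (h.hasDerivAt ht)).const_mul M).sub
        (h.hasDerivAt' ht)).hasDerivWithinAt
    · have ht' := Ioo_subset_Icc_self ht
      have a := h.nonneg_of_fundamental hc h0 h1 t ht'
      have b := h.deriv_pos hc h0 h1 t ht'
      have := mul_nonneg ((hc t ht').trans (hM t ht')) (mul_nonneg ht.1.le b.le)
      have := mul_le_mul_of_nonneg_right (hM t ht') a
      linarith
  have := this ⟨le_rfl, hy.1.trans hy.2⟩ hy hy.1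
  simp only [h0, h1] at this
  linarith

end SolvesLinear

/-! ### Primitives and exponential asymptotics of the fundamental solution -/

theorem hasDerivAt_integral {f : ℝ → ℝ} (hf : Continuous f) (y : ℝ) :
    HasDerivAt (fun y => ∫ t in (0 : ℝ)..y, f t) (f y) y :=
  (hf.integral_hasStrictDerivAt 0 y).hasDerivAt

theorem abs_integral_sub_le {f g : ℝ → ℝ} (hf : Continuous f) (hg : Continuous g) {l η : ℝ}
    (h : ∀ y ∈ Icc 0 l, |g y - f y| ≤ η) : ∀ y ∈ Icc 0 l,
    |(∫ t in (0 : ℝ)..y, g t) - ∫ t in (0 : ℝ)..y, f t| ≤ η * l := by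
  intro y hy
  rw [← intervalIntegral.integral_sub (hg.intervalIntegrable _ _) (hf.intervalIntegrable _ _)]
  have hη : 0 ≤ η := (abs_nonneg _).trans (h y hy)
  have := intervalIntegral.norm_integral_le_of_norm_le_const (a := 0) (b := y)
    (f := fun t => g t - f t) (C := η) fun t ht => by
      rw [uIoc_of_le hy.1] at ht
      exact h t ⟨ht.1.le, ht.2.trans hy.2⟩
  rw [sub_zero, abs_of_nonneg hy.1, Real.norm_eq_abs] at this
  exact this.trans (mul_le_mul_of_nonneg_left hy.2 hη)

namespace SolvesLinear

/-- The fundamental solution of `ε² z'' = f² z` is `exp ((F + o(1)) / ε)`, `F` a primitive of `f`. -/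
theorem exists_exp_bounds {f : ℝ → ℝ} {l α δ : ℝ} (hl : 0 < l) (hf : Continuous f) (hα : 0 < α)
    (hfα : ∀ y ∈ Icc 0 l, α ≤ f y) (hδ : 0 < δ) :
    ∃ K > 0, ∀ ε : ℝ, 0 < ε → ε ≤ 1 → ∀ z z', SolvesLinear (fun y => f y ^ 2 / ε ^ 2) l z z' →
      z 0 = 0 → z' 0 = 1 → ∀ y ∈ Icc 0 l,
        z y ≤ K * Real.exp (((∫ t in (0 : ℝ)..y, f t) + δ) / ε) ∧
        y * Real.exp (((∫ t in (0 : ℝ)..y, f t) - δ) / ε) ≤ K / ε ^ 2 * z y := by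
  obtain ⟨M, hM0, hM⟩ : ∃ M : ℝ, α ≤ M ∧ ∀ t ∈ Icc 0 l, f t ≤ M := by
    obtain ⟨C, hC⟩ := isCompact_Icc.exists_bound_of_continuousOn hf.continuousOn (s := Icc 0 l)
    exact ⟨max α C, le_max_left _ _,
      fun t ht => ((le_abs_self _).trans (hC t ht)).trans (le_max_right _ _)⟩
  have hMpos : 0 < M := hα.trans_le hM0
  -- The first entry keeps the approximant g above α/2. The second makes the two errors of size 1/ε
  -- in the exponent, from replacing the primitive F and from κ, total at most δ/ε.
  set η : ℝ := min (α / 2) (δ / (l * (1 + 6 * M / α))) with hη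
  have hη0 : 0 < η := by positivity
  have hηα : η ≤ α / 2 := min_le_left _ _
  have hηδ : η * l + 6 * M * η / α * l ≤ δ := by
    have h1 : η ≤ δ / (l * (1 + 6 * M / α)) := min_le_right _ _
    rw [le_div_iff₀ (by positivity)] at h1
    calc η * l + 6 * M * η / α * l = η * (l * (1 + 6 * M / α)) := by ring
      _ ≤ δ := h1
  -- The argument differentiates the coefficient, so f is replaced by a nearby polynomial g whose
  -- derivative is bounded by N.
  obtain ⟨p, hp⟩ := exists_polynomial_near_of_continuousOn 0 l f hf.continuousOn η hη0
  set g : ℝ → ℝ := fun y => p.eval y with hg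
  have hgc : Continuous g := p.continuous
  obtain ⟨N, hN⟩ := isCompact_Icc.exists_bound_of_continuousOn
    (p.derivative.continuous.continuousOn (s := Icc 0 l))
  have hN0 : 0 ≤ N := (norm_nonneg _).trans (hN 0 ⟨le_rfl, hl.le⟩)
  set F : ℝ → ℝ := fun y => ∫ t in (0 : ℝ)..y, f t
  set Gp : ℝ → ℝ := fun y => ∫ t in (0 : ℝ)..y, g t
  set K0 : ℝ := 2 * N / α * l
  have hgα : ∀ y ∈ Icc 0 l, α / 2 ≤ g y := fun y hy => by
    have := abs_lt.1 (hp y hy)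
    linarith [hfα y hy, this.1]
  have hgM : ∀ y ∈ Icc 0 l, g y ≤ 2 * M := fun y hy => by
    have := abs_lt.1 (hp y hy)
    linarith [hM y hy, this.2]
  have hGF : ∀ y ∈ Icc 0 l, |Gp y - F y| ≤ η * l :=
    abs_integral_sub_le hf hgc fun y hy => (hp y hy).le
  set C1 : ℝ := 1 + M ^ 2 * l ^ 2 + 2 * M * l
  have hC1 : 0 < C1 := by positivity
  refine ⟨max (2 / α * Real.exp K0) (C1 * Real.exp K0), by positivity, ?_⟩
  intro ε hε hε1 z z' hz h0 h1
  have hc : ∀ y ∈ Icc 0 l, 0 ≤ f y ^ 2 / ε ^ 2 := fun y _ => by positivity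
  have hz0 := hz.nonneg_of_fundamental hc h0 h1
  have hz'0 := hz.deriv_pos hc h0 h1
  set κ : ℝ := 2 / α * (3 * M * η / ε + N)
  have hκ0 : 0 ≤ κ := by positivity
  -- Approximate factorization: ε²∂² - f² is close to (ε∂ - g)(ε∂ + g). Hence h = ε z' + g z almost
  -- solves h' = (g/ε) h, with error z ((f² - g²)/ε + g'). Since z ≤ (2/α) h, the relative error is
  -- at most κ.
  set h : ℝ → ℝ := fun y => ε * z' y + g y * z y
  set h' : ℝ → ℝ := fun y => ε * (f y ^ 2 / ε ^ 2 * z y) + (p.derivative.eval y * z y + g y * z' y)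
  have hzh : ∀ y ∈ Icc 0 l, z y ≤ 2 / α * h y := fun y hy => by
    have h2 := mul_le_mul_of_nonneg_right (hgα y hy) (hz0 y hy)
    have h3 := mul_pos hε (hz'0 y hy)
    rw [div_mul_eq_mul_div, le_div_iff₀ hα]
    simp only [h]
    linarith
  have hh' : ∀ y ∈ Icc 0 l, |h' y - g y / ε * h y| ≤ κ * h y := by
    intro y hy
    have e : h' y - g y / ε * h y =
        z y * ((f y - g y) * (f y + g y) / ε + p.derivative.eval y) := by
      simp only [h, h']
      field_simp
      ring
    have b1 : |(f y - g y) * (f y + g y) / ε| ≤ 3 * M * η / ε := by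
      rw [abs_div, abs_mul, abs_of_pos hε, abs_sub_comm]
      refine div_le_div_of_nonneg_right ?_ hε.le
      have h1 := (hp y hy).le
      have h2 : |f y + g y| ≤ 3 * M := by
        rw [abs_of_nonneg (by linarith [hfα y hy, hgα y hy])]
        linarith [hM y hy, hgM y hy]
      calc _ ≤ η * (3 * M) := mul_le_mul h1 h2 (abs_nonneg _) hη0.le
        _ = 3 * M * η := by ring
    rw [e, abs_mul, abs_of_nonneg (hz0 y hy)]
    have b2 := (abs_add_le _ _).trans (add_le_add b1 (hN y hy))
    calc _ ≤ z y * (3 * M * η / ε + N) := mul_le_mul_of_nonneg_left b2 (hz0 y hy)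
      _ ≤ (2 / α * h y) * (3 * M * η / ε + N) :=
        mul_le_mul_of_nonneg_right (hzh y hy) (by positivity)
      _ = κ * h y := by ring
  have hhc : ContinuousOn h (Icc 0 l) := (hz.continuousOn'.const_mul ε).add
    (hgc.continuousOn.mul hz.continuousOn)
  have hhd : ∀ y ∈ Ioo 0 l, HasDerivAt h (h' y) y := fun y hy =>
    ((hz.hasDerivAt' hy).const_mul ε).add ((p.hasDerivAt y).mul (hz.hasDerivAt hy))
  have hGc : Continuous Gp := continuous_iff_continuousAt.2 fun y =>
    (hasDerivAt_integral hgc y).continuousAt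
  have hEd : ∀ σ y : ℝ, HasDerivAt (fun y => Real.exp (-(Gp y / ε + σ * y)))
      (Real.exp (-(Gp y / ε + σ * y)) * -(g y / ε + σ)) y := fun σ y => by
    have := (((hasDerivAt_integral hgc y).div_const ε).add ((hasDerivAt_id y).const_mul σ)).neg.exp
    simpa using this
  have hEc : ∀ σ : ℝ, Continuous fun y => Real.exp (-(Gp y / ε + σ * y)) := fun σ => by fun_prop
  -- Integrating factors with rates g/ε ± κ squeeze h between ε exp(G/ε - κ y) and ε exp(G/ε + κ y),
  -- where G is the primitive of g.
  have hanti : AntitoneOn (fun y => h y * Real.exp (-(Gp y / ε + κ * y))) (Icc 0 l) := by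
    refine antitoneOn_of_hasDerivWithinAt_nonpos (f' := fun y =>
        h' y * Real.exp (-(Gp y / ε + κ * y)) +
          h y * (Real.exp (-(Gp y / ε + κ * y)) * -(g y / ε + κ))) (convex_Icc 0 l) (hhc.mul (hEc κ).continuousOn)
      (fun y hy => ?_) fun y hy => ?_
    · rw [interior_Icc] at hy
      exact ((hhd y hy).mul (hEd κ y)).hasDerivWithinAt
    · have := (abs_le.1 (hh' y (interior_subset hy))).2
      have := mul_nonneg (Real.exp_pos (-(Gp y / ε + κ * y))).le (sub_nonneg.2 this)
      linarith
  have hmono : MonotoneOn (fun y => h y * Real.exp (-(Gp y / ε + -κ * y))) (Icc 0 l) := by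
    refine monotoneOn_of_hasDerivWithinAt_nonneg (f' := fun y =>
        h' y * Real.exp (-(Gp y / ε + -κ * y)) +
          h y * (Real.exp (-(Gp y / ε + -κ * y)) * -(g y / ε + -κ))) (convex_Icc 0 l)
      (hhc.mul (hEc (-κ)).continuousOn)
      (fun y hy => ?_) fun y hy => ?_
    · rw [interior_Icc] at hy
      exact ((hhd y hy).mul (hEd (-κ) y)).hasDerivWithinAt
    · have := (abs_le.1 (hh' y (interior_subset hy))).1
      have := mul_nonneg (Real.exp_pos (-(Gp y / ε + -κ * y))).le (sub_nonneg.2 this)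
      linarith
  intro y hy
  have hl0 : (0 : ℝ) ∈ Icc 0 l := ⟨le_rfl, hl.le⟩
  have hh0 : h 0 = ε := by simp [h, h0, h1]
  have hG0 : Gp 0 = 0 := by simp [Gp]
  have hκy : κ * y ≤ 6 * M * η / α * l / ε + K0 := by
    calc κ * y ≤ κ * l := mul_le_mul_of_nonneg_left hy.2 hκ0
      _ = _ := by simp only [κ, K0]; field_simp; ring
  have hup : h y ≤ ε * Real.exp (Gp y / ε + κ * y) := by
    have := hanti hl0 hy hy.1
    simp only [hh0, hG0, zero_div, mul_zero, add_zero, neg_zero, Real.exp_zero, mul_one] at this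
    rwa [Real.exp_neg, ← div_eq_mul_inv, div_le_iff₀ (Real.exp_pos _)] at this
  have hlo : ε * Real.exp (Gp y / ε + -κ * y) ≤ h y := by
    have := hmono hl0 hy hy.1
    simp only [hh0, hG0, zero_div, mul_zero, add_zero, neg_zero, Real.exp_zero, mul_one] at this
    rwa [Real.exp_neg, ← div_eq_mul_inv, le_div_iff₀ (Real.exp_pos _)] at this
  have hGy := abs_le.1 (hGF y hy)
  have hexp1 : Gp y / ε + κ * y ≤ K0 + (F y + δ) / ε := by
    have : (Gp y + 6 * M * η / α * l) / ε ≤ (F y + δ) / ε :=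
      div_le_div_of_nonneg_right (by linarith [hGy.2]) hε.le
    rw [add_div] at this
    linarith
  have hexp2 : (F y - δ) / ε - K0 ≤ Gp y / ε + -κ * y := by
    have : (F y - δ) / ε ≤ (Gp y - 6 * M * η / α * l) / ε :=
      div_le_div_of_nonneg_right (by linarith [hGy.1]) hε.le
    rw [sub_div (Gp y)] at this
    linarith
  constructor
  · calc z y ≤ 2 / α * h y := hzh y hy
      _ ≤ 2 / α * (1 * Real.exp (K0 + (F y + δ) / ε)) := by
        refine mul_le_mul_of_nonneg_left (hup.trans ?_) (by positivity)
        exact mul_le_mul hε1 (Real.exp_le_exp.2 hexp1) (Real.exp_pos _).le zero_le_one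
      _ = 2 / α * Real.exp K0 * Real.exp ((F y + δ) / ε) := by rw [Real.exp_add]; ring
      _ ≤ _ := mul_le_mul_of_nonneg_right (le_max_left _ _) (Real.exp_pos _).le
  · have hyz := hz.le_self_of_fundamental hc h0 h1 y hy
    have hder := hz.deriv_le_of_le (M := M ^ 2 / ε ^ 2) hc (fun t ht =>
      div_le_div_of_nonneg_right (pow_le_pow_left₀ (hα.le.trans (hfα t ht)) (hM t ht) 2)
        (by positivity)) h0 h1 y hy
    have hzy := hz0 y hy
    -- The lower bound must return from h to z. Both z and h have known sizes only after multiplying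
    -- by y, since z(0) = 0 while h(0) = ε; the estimate for z' and y ≤ z give the three terms of
    -- C1.
    have hyh : y * h y ≤ C1 / ε * z y := by
      have a1 : y * (ε * z' y) ≤ y * (ε * (1 + M ^ 2 / ε ^ 2 * (y * z y))) := by
        have := hy.1
        gcongr
      have a2 : y * (g y * z y) ≤ l * (2 * M * z y) :=
        mul_le_mul hy.2 (mul_le_mul_of_nonneg_right (hgM y hy) hzy)
          (mul_nonneg (by linarith [hgα y hy]) hzy) hl.le
      have a3 : y * (ε * (1 + M ^ 2 / ε ^ 2 * (y * z y))) = ε * y + M ^ 2 * y ^ 2 / ε * z y := by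
        field_simp
      have hε' : 1 ≤ 1 / ε := (one_le_div hε).2 hε1
      have a4 : ε * y ≤ 1 / ε * z y := mul_le_mul (hε1.trans hε') hyz hy.1 (by positivity)
      have a5 : M ^ 2 * y ^ 2 / ε * z y ≤ M ^ 2 * l ^ 2 / ε * z y := by
        have := hy.1; have := hy.2
        gcongr
      have a6 : l * (2 * M * z y) ≤ 1 / ε * (2 * M * l * z y) := by
        have : 0 ≤ 2 * M * l * z y := by positivity
        nlinarith
      calc y * h y = y * (ε * z' y) + y * (g y * z y) := by simp only [h]; ring
        _ ≤ 1 / ε * z y + M ^ 2 * l ^ 2 / ε * z y + 1 / ε * (2 * M * l * z y) := by linarith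
        _ = C1 / ε * z y := by simp only [C1]; ring
    have b1 : ε * Real.exp ((F y - δ) / ε - K0) ≤ h y :=
      (mul_le_mul_of_nonneg_left (Real.exp_le_exp.2 hexp2) hε.le).trans hlo
    have b2 := (mul_le_mul_of_nonneg_left b1 hy.1).trans hyh
    rw [Real.exp_sub] at b2
    calc y * Real.exp ((F y - δ) / ε)
        = (y * (ε * (Real.exp ((F y - δ) / ε) / Real.exp K0))) * (Real.exp K0 / ε) := by
          field_simp
      _ ≤ (C1 / ε * z y) * (Real.exp K0 / ε) := mul_le_mul_of_nonneg_right b2 (by positivity)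
      _ = C1 * Real.exp K0 / ε ^ 2 * z y := by field_simp
      _ ≤ _ := by
        gcongr
        exact le_max_right _ _

end SolvesLinear

namespace TopologicalNetwork

variable {n : ℕ} {I J : Type*} [Fintype I] [Fintype J] (G : TopologicalNetwork n I J)

/-! ### Discrete equations on the vertices -/

theorem other_inc {i : I} {j : J} (h : j ∈ G.inc i) : j ∈ G.inc (G.other i j) := by
  rcases G.inc_cases h with ⟨-, -, -, h2⟩ | ⟨-, -, -, h2⟩ <;> rw [h2]
  · exact G.tgt_inc j
  · exact G.src_inc j

theorem other_other {i : I} {j : J} (h : j ∈ G.inc i) : G.other (G.other i j) j = i := by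
  rcases G.inc_cases h with ⟨h1, -, -, h2⟩ | ⟨h1, -, -, h2⟩ <;> rw [h2, ← h1]
  · exact G.other_tgt j
  · exact G.other_src j

/-- Comparison for the discrete eikonal equation. -/
theorem vertex_comparison {B : Set I} {ℓ : J → ℝ} (hℓ : ∀ j, 0 < ℓ j) {P Q : I → ℝ}
    (hP : ∀ i ∉ B, ∀ j ∈ G.inc i, P i ≤ P (G.other i j) + ℓ j)
    (hQ : ∀ i ∉ B, ∃ j ∈ G.inc i, Q (G.other i j) + ℓ j ≤ Q i)
    (hB : ∀ i ∈ B, P i ≤ Q i) (i : I) : P i ≤ Q i := by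
  by_contra! hi
  -- Take a violating vertex with the least Q. The edge on which Q drops by ℓ leads to a vertex that
  -- also violates the inequality and has smaller Q.
  obtain ⟨m, hm, hmin⟩ := ({i | Q i < P i} : Set I).toFinite.exists_minimalFor Q _ ⟨i, hi⟩
  have hmB : m ∉ B := fun h => (hB m h).not_gt hm
  obtain ⟨j, hj, hjQ⟩ := hQ m hmB
  have hjP := hP m hmB j hj
  have hm' : Q m < P m := hm
  have := hmin (j := G.other m j) (show Q (G.other m j) < P (G.other m j) by linarith)
    (by linarith [hℓ j])
  linarith [hℓ j]

/-- The discrete eikonal equation has a solution. -/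
theorem exists_vertex_solution {B : Set I} (hB : B.Nonempty) {ℓ : J → ℝ} (hℓ : ∀ j, 0 < ℓ j) :
    ∃ U : I → ℝ, (∀ i ∈ B, U i = 0) ∧ (∀ i, 0 ≤ U i) ∧
      (∀ i ∉ B, ∀ j ∈ G.inc i, U i ≤ U (G.other i j) + ℓ j) ∧
      ∀ i ∉ B, ∃ j ∈ G.inc i, U (G.other i j) + ℓ j ≤ U i := by
  classical
  -- Perron's method: U is the pointwise supremum of the discrete subsolutions.
  let K : Set (I → ℝ) := {V | (∀ i ∈ B, V i = 0) ∧
    ∀ i ∉ B, ∀ j ∈ G.inc i, V i ≤ V (G.other i j) + ℓ j}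
  have hK0 : (0 : I → ℝ) ∈ K := ⟨fun _ _ => rfl, fun _ _ j _ => by simpa using (hℓ j).le⟩
  obtain ⟨b, hb⟩ := hB
  -- A bound at one vertex passes to its neighbours through the inequality there, starting from a
  -- boundary vertex; connectedness does the rest.
  have hbdd : ∀ i, ∃ M, ∀ V ∈ K, V i ≤ M := by
    intro i
    refine G.vertex_induction (p := fun i => ∃ M, ∀ V ∈ K, V i ≤ M) (fun i j hj hM => ?_)
      (i := b) ⟨0, fun V hV => (hV.1 b hb).le⟩ i
    obtain ⟨M, hM⟩ := hM
    by_cases ho : G.other i j ∈ B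
    · exact ⟨0, fun V hV => (hV.1 _ ho).le⟩
    · refine ⟨M + ℓ j, fun V hV => ?_⟩
      have := hV.2 _ ho j (G.other_inc hj)
      rw [G.other_other hj] at this
      linarith [hM V hV]
  let U : I → ℝ := fun i => sSup ((fun V => V i) '' K)
  have hle : ∀ V ∈ K, ∀ i, V i ≤ U i := fun V hV i =>
    le_csSup (by obtain ⟨M, hM⟩ := hbdd i; exact ⟨M, forall_mem_image.2 hM⟩)
      (mem_image_of_mem _ hV)
  have hsup : ∀ i M, (∀ V ∈ K, V i ≤ M) → U i ≤ M := fun i M h =>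
    csSup_le ⟨_, mem_image_of_mem _ hK0⟩ (forall_mem_image.2 h)
  have hUB : ∀ i ∈ B, U i = 0 := fun i hi =>
    le_antisymm (hsup i 0 fun V hV => (hV.1 i hi).le) (hle 0 hK0 i)
  have hUK : ∀ i ∉ B, ∀ j ∈ G.inc i, U i ≤ U (G.other i j) + ℓ j := fun i hi j hj =>
    hsup i _ fun V hV => (hV.2 i hi j hj).trans (by linarith [hle V hV (G.other i j)])
  refine ⟨U, hUB, hle 0 hK0, hUK, fun i hi => ?_⟩
  obtain ⟨j, hj, hmin⟩ := (G.inc i).exists_min_image (fun j => U (G.other i j) + ℓ j)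
    (G.inc_nonempty i)
  refine ⟨j, hj, ?_⟩
  -- Raising U at the single vertex i to its smallest neighbouring bound yields another subsolution,
  -- so maximality of U gives the missing inequality.
  have hV : Function.update U i (U (G.other i j) + ℓ j) ∈ K := by
    have hge : ∀ k, U k ≤ Function.update U i (U (G.other i j) + ℓ j) k := fun k => by
      by_cases hk : k = i
      · subst hk; rw [Function.update_self]; exact hUK _ hi j hj
      · rw [Function.update_of_ne hk]
    refine ⟨fun k hk => ?_, fun k hk m hm => ?_⟩
    · rw [Function.update_of_ne (by rintro rfl; exact hi hk), hUB k hk]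
    · by_cases hki : k = i
      · subst hki
        rw [Function.update_self, Function.update_of_ne (G.other_ne hm)]
        exact hmin m hm
      · rw [Function.update_of_ne hki]
        exact (hUK k hk m hm).trans (by linarith [hge (G.other k m)])
  simpa using hle _ hV i

/-! ### Diagonally dominant linear systems on the vertices -/

section Linear

variable {B : Set I} {a : I → J → ℝ} {b : I → ℝ}

/-- Maximum principle: at a vertex where |W| is maximal, strict dominance of b over the sum of the
a's forces W = 0. -/
theorem linear_vertex_eq_zero (ha : ∀ i ∉ B, ∀ j ∈ G.inc i, 0 < a i j)
    (hb : ∀ i ∉ B, ∑ j ∈ G.inc i, a i j < b i) {W : I → ℝ} (hW : ∀ i ∈ B, W i = 0)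
    (hW' : ∀ i ∉ B, b i * W i = ∑ j ∈ G.inc i, a i j * W (G.other i j)) : W = 0 := by
  classical
  by_contra! hne
  obtain ⟨i0, hi0⟩ := Function.ne_iff.1 hne
  obtain ⟨m, -, hmax⟩ := Finset.univ.exists_max_image (fun i => |W i|) ⟨i0, Finset.mem_univ _⟩
  have hm : 0 < |W m| := (abs_pos.2 hi0).trans_le (hmax i0 (Finset.mem_univ _))
  have hmB : m ∉ B := fun h => by simp [hW m h] at hm
  have hs : 0 ≤ ∑ j ∈ G.inc m, a m j := Finset.sum_nonneg fun j hj => (ha m hmB j hj).le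
  have h1 : |b m * W m| ≤ ∑ j ∈ G.inc m, a m j * |W m| := by
    rw [hW' m hmB]
    refine (Finset.abs_sum_le_sum_abs _ _).trans (Finset.sum_le_sum fun j hj => ?_)
    rw [abs_mul, abs_of_pos (ha m hmB j hj)]
    exact mul_le_mul_of_nonneg_left (hmax _ (Finset.mem_univ _)) (ha m hmB j hj).le
  rw [← Finset.sum_mul, abs_mul, abs_of_pos (hs.trans_lt (hb m hmB))] at h1
  exact (hb m hmB).not_ge (le_of_mul_le_mul_right h1 hm)

theorem exists_linear_vertex (ha : ∀ i ∉ B, ∀ j ∈ G.inc i, 0 < a i j)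
    (hb : ∀ i ∉ B, ∑ j ∈ G.inc i, a i j < b i) :
    ∃ W : I → ℝ, (∀ i ∈ B, W i = 1) ∧
      ∀ i ∉ B, b i * W i = ∑ j ∈ G.inc i, a i j * W (G.other i j) := by
  classical
  let T : (I → ℝ) →ₗ[ℝ] (I → ℝ) :=
    { toFun := fun W i => if i ∈ B then W i else
        b i * W i - ∑ j ∈ G.inc i, a i j * W (G.other i j)
      map_add' := fun V W => by
        ext i
        simp only [Pi.add_apply]
        split_ifs
        · rfl
        · simp only [mul_add, Finset.sum_add_distrib]; ring
      map_smul' := fun r W => by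
        ext i
        simp only [Pi.smul_apply, smul_eq_mul, RingHom.id_apply]
        split_ifs
        · rfl
        · rw [mul_sub, Finset.mul_sum]
          congr 1
          · ring
          · exact Finset.sum_congr rfl fun j _ => by ring }
  have hT : Function.Injective T := by
    rw [injective_iff_map_eq_zero]
    intro W hW
    refine G.linear_vertex_eq_zero ha hb (fun i hi => ?_) fun i hi => ?_
    · simpa [T, hi] using congrFun hW i
    · have := congrFun hW i
      simp only [T, LinearMap.coe_mk, AddHom.coe_mk, if_neg hi, Pi.zero_apply] at this
      linarith
  obtain ⟨W, hW⟩ := LinearMap.injective_iff_surjective.1 hT (fun i => if i ∈ B then 1 else 0)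
  refine ⟨W, fun i hi => ?_, fun i hi => ?_⟩
  · simpa [T, hi] using congrFun hW i
  · have := congrFun hW i
    simp only [T, LinearMap.coe_mk, AddHom.coe_mk, if_neg hi] at this
    linarith

theorem linear_vertex_unique (ha : ∀ i ∉ B, ∀ j ∈ G.inc i, 0 < a i j)
    (hb : ∀ i ∉ B, ∑ j ∈ G.inc i, a i j < b i) {V W : I → ℝ} (hB : ∀ i ∈ B, V i = W i)
    (hV : ∀ i ∉ B, b i * V i = ∑ j ∈ G.inc i, a i j * V (G.other i j))
    (hW : ∀ i ∉ B, b i * W i = ∑ j ∈ G.inc i, a i j * W (G.other i j)) : V = W := by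
  rw [← sub_eq_zero]
  refine G.linear_vertex_eq_zero ha hb (fun i hi => sub_eq_zero.2 (hB i hi)) fun i hi => ?_
  simp only [Pi.sub_apply, mul_sub, Finset.sum_sub_distrib, hV i hi, hW i hi]

/-- The minimum principle gives W ≥ 0. A zero at a vertex would make all its neighbours zero, and by
connectedness would reach the boundary, where W = 1. -/
theorem linear_vertex_pos (hne : B.Nonempty) (ha : ∀ i ∉ B, ∀ j ∈ G.inc i, 0 < a i j)
    (hb : ∀ i ∉ B, ∑ j ∈ G.inc i, a i j < b i) {W : I → ℝ} (hW : ∀ i ∈ B, W i = 1)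
    (hW' : ∀ i ∉ B, b i * W i = ∑ j ∈ G.inc i, a i j * W (G.other i j)) (i : I) : 0 < W i := by
  classical
  obtain ⟨i0, hi0⟩ := hne
  have hnn : ∀ i, 0 ≤ W i := by
    obtain ⟨m, -, hmin⟩ := Finset.univ.exists_min_image W ⟨i0, Finset.mem_univ _⟩
    intro i
    refine le_trans ?_ (hmin i (Finset.mem_univ _))
    by_cases hmB : m ∈ B
    · rw [hW m hmB]; exact zero_le_one
    have h1 : (∑ j ∈ G.inc m, a m j) * W m ≤ b m * W m := by
      rw [hW' m hmB, Finset.sum_mul]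
      exact Finset.sum_le_sum fun j hj =>
        mul_le_mul_of_nonneg_left (hmin _ (Finset.mem_univ _)) (ha m hmB j hj).le
    by_contra! hneg
    nlinarith [hb m hmB]
  refine (hnn i).lt_of_ne' fun h0 => ?_
  have : W i0 = 0 := by
    refine G.vertex_induction (p := fun i => W i = 0) (fun i j hj hi => ?_) h0 i0
    have hiB : i ∉ B := fun h => by simp [hW i h] at hi
    have h2 := hW' i hiB
    rw [hi, mul_zero] at h2
    have := (Finset.sum_eq_zero_iff_of_nonneg fun j hj =>
      mul_nonneg (ha i hiB j hj).le (hnn _)).1 h2.symm j hj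
    exact (mul_eq_zero.1 this).resolve_left (ha i hiB j hj).ne'
  simp [hW i0 hi0] at this

end Linear

end TopologicalNetwork

/-! ### The eikonal equation on an interval -/

/-- The function `g` solves `|g'| ≤ f` on `(0, l)` in the viscosity sense. -/
def ViscositySubOn (l : ℝ) (f g : ℝ → ℝ) : Prop :=
  ∀ y ∈ Ioo 0 l, ∀ (ψ : ℝ → ℝ) (p : ℝ), Continuous ψ → HasDerivAt ψ p y →
    IsLocalMax (fun t => g t - ψ t) y → |p| ≤ f y

/-- The function `g` solves `f ≤ |g'|` on `(0, l)` in the viscosity sense. -/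
def ViscositySuperOn (l : ℝ) (f g : ℝ → ℝ) : Prop :=
  ∀ y ∈ Ioo 0 l, ∀ (ψ : ℝ → ℝ) (p : ℝ), Continuous ψ → HasDerivAt ψ p y →
    IsLocalMin (fun t => g t - ψ t) y → f y ≤ |p|

theorem continuous_integral {f : ℝ → ℝ} (hf : Continuous f) :
    Continuous fun y => ∫ t in (0 : ℝ)..y, f t :=
  continuous_iff_continuousAt.2 fun y => (hasDerivAt_integral hf y).continuousAt

theorem monotoneOn_integral {f : ℝ → ℝ} {l : ℝ} (hf : Continuous f)
    (hf0 : ∀ y ∈ Icc 0 l, 0 < f y) :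
    MonotoneOn (fun y => ∫ t in (0 : ℝ)..y, f t) (Icc 0 l) :=
  monotoneOn_of_hasDerivWithinAt_nonneg (convex_Icc 0 l) (continuous_integral hf).continuousOn
    (fun y _ => (hasDerivAt_integral hf y).hasDerivWithinAt)
    fun y hy => (hf0 y (interior_subset hy)).le

theorem integral_reflect {f : ℝ → ℝ} (hf : Continuous f) (l y : ℝ) :
    ∫ t in (0 : ℝ)..y, f (l - t) = (∫ t in (0 : ℝ)..l, f t) - ∫ t in (0 : ℝ)..(l - y), f t := by
  rw [intervalIntegral.integral_comp_sub_left (fun t => f t), sub_zero,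
    intervalIntegral.integral_interval_sub_left (hf.intervalIntegrable _ _)
      (hf.intervalIntegrable _ _)]

/-- If g grew faster than F from a to b, the test function `ψ`, steeper than F, would touch g from
above at an interior point, where its slope exceeds f. -/
theorem ViscositySubOn.sub_le {l : ℝ} {f g : ℝ → ℝ} (h : ViscositySubOn l f g)
    (hf : Continuous f) (hg : Continuous g) (hf0 : ∀ y ∈ Icc 0 l, 0 < f y) {a b : ℝ}
    (ha : 0 ≤ a) (hab : a ≤ b) (hb : b ≤ l) :
    g b - g a ≤ (∫ t in (0 : ℝ)..b, f t) - ∫ t in (0 : ℝ)..a, f t := by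
  set F : ℝ → ℝ := fun y => ∫ t in (0 : ℝ)..y, f t
  have hFc : Continuous F := continuous_integral hf
  have hmono := monotoneOn_integral hf hf0
  rcases hab.eq_or_lt with rfl | hab
  · simp
  have key : ∀ b ∈ Ioo a l, g b - g a ≤ F b - F a := by
    intro b hb
    by_contra! hgap
    have haI : a ∈ Icc 0 l := ⟨ha, (hb.1.trans hb.2).le⟩
    have hbI : b ∈ Icc 0 l := ⟨ha.trans hb.1.le, hb.2.le⟩
    have hlI : l ∈ Icc 0 l := ⟨haI.1.trans haI.2, le_rfl⟩
    have hla : 0 < l - a := sub_pos.2 (hb.1.trans hb.2)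
    have hD : 0 ≤ F b - F a := sub_nonneg.2 (hmono haI hbI hb.1.le)
    set γ : ℝ := g b - g a - (F b - F a)
    have hγ : 0 < γ := sub_pos.2 hgap
    set η : ℝ := γ / (2 * (F b - F a + 1))
    have hη : 0 < η := by positivity
    have hηD : η * (F b - F a) ≤ γ / 2 := by
      simp only [η]
      rw [div_mul_eq_mul_div, div_le_div_iff₀ (by positivity) two_pos]
      nlinarith
    set R : ℝ := |g l - g a| + 1
    have hR : 0 < R := by positivity
    obtain ⟨k, hk⟩ := exists_pow_lt_of_lt_one (show 0 < γ / 2 / R by positivity)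
      (show (b - a) / (l - a) < 1 by rw [div_lt_one hla]; linarith [hb.2])
    rw [lt_div_iff₀ hR] at hk
    -- The increasing penalty exceeds g at l but costs less than γ/2 at b, because a high power of a
    -- ratio below 1 is small. The factor 1 + η costs at most γ/2 more. So the maximum of g - ψ on
    -- [a, l] is at neither end.
    let ψ : ℝ → ℝ := fun y => (1 + η) * (F y - F a) + R * ((y - a) / (l - a)) ^ (k + 1)
    have hψc : Continuous ψ := by fun_prop
    have hψd : ∀ y, HasDerivAt ψ ((1 + η) * f y +
        R * ((k + 1 : ℕ) * ((y - a) / (l - a)) ^ k * (1 / (l - a)))) y := fun y => by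
      refine (((hasDerivAt_integral hf y).sub_const _).const_mul _).add (HasDerivAt.const_mul _ ?_)
      exact (((hasDerivAt_id y).sub_const a).div_const (l - a)).pow (k + 1)
    obtain ⟨y, hyI, hy⟩ := isCompact_Icc.exists_isMaxOn (nonempty_Icc.2 haI.2)
      (hg.sub hψc).continuousOn (s := Icc a l)
    have hψa : ψ a = 0 := by simp [ψ]
    have hψb : ψ b < g b - g a := by
      have h01 : 0 ≤ (b - a) / (l - a) := div_nonneg (by linarith [hb.1]) hla.le
      have h1 : ((b - a) / (l - a)) ^ (k + 1) ≤ ((b - a) / (l - a)) ^ k :=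
        pow_le_pow_of_le_one h01 ((div_lt_one hla).2 (by linarith [hb.2])).le (Nat.le_succ k)
      have h2 := mul_le_mul_of_nonneg_left h1 hR.le
      simp only [ψ]
      have : γ = g b - g a - (F b - F a) := rfl
      linarith
    have hψl : g l - g a < ψ l := by
      have h1 : 0 ≤ (1 + η) * (F l - F a) :=
        mul_nonneg (by positivity) (sub_nonneg.2 (hmono haI hlI haI.2))
      simp only [ψ, div_self hla.ne', one_pow, mul_one, R]
      linarith [le_abs_self (g l - g a)]
    have hyb : g b - ψ b ≤ g y - ψ y := hy ⟨hb.1.le, hb.2.le⟩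
    have hya : y ≠ a := by rintro rfl; linarith
    have hyl : y ≠ l := by rintro rfl; linarith
    have hyI' : y ∈ Ioo a l := ⟨hyI.1.lt_of_ne' hya, hyI.2.lt_of_ne hyl⟩
    have hy0 : y ∈ Ioo 0 l := ⟨ha.trans_lt hyI'.1, hyI'.2⟩
    have := h y hy0 ψ _ hψc (hψd y) (hy.isLocalMax (Icc_mem_nhds hyI'.1 hyI'.2))
    have h1 := (le_abs_self _).trans this
    have h2 : 0 ≤ R * ((k + 1 : ℕ) * ((y - a) / (l - a)) ^ k * (1 / (l - a))) := by
      have : 0 ≤ (y - a) / (l - a) := div_nonneg (by linarith [hyI.1]) hla.le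
      positivity
    have h3 := mul_pos hη (hf0 y (Ioo_subset_Icc_self hy0))
    linarith
  -- The penalty argument needs b < l; continuity adds b = l.
  have hbc : b ∈ closure (Ioo a l) := by
    rw [closure_Ioo (hab.trans_le hb).ne]
    exact ⟨hab.le, hb⟩
  exact ContinuousWithinAt.closure_le hbc (hg.sub continuous_const).continuousWithinAt
    (hFc.sub continuous_const).continuousWithinAt key

theorem ViscositySubOn.reflect {l : ℝ} {f g : ℝ → ℝ} (h : ViscositySubOn l f g) :
    ViscositySubOn l (fun y => f (l - y)) (fun y => g (l - y)) := by
  intro y hy ψ p hψ hp hmax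
  have e : l - (l - y) = y := by ring
  have hd : HasDerivAt (fun t => l - t) (-1) (l - y) := (hasDerivAt_id (l - y)).const_sub l
  have hp' : HasDerivAt (fun t => ψ (l - t)) (p * -1) (l - y) :=
    HasDerivAt.comp (h₂ := ψ) (l - y) (by rw [e]; exact hp) hd
  have := h (l - y) ⟨by linarith [hy.2], by linarith [hy.1]⟩ (fun t => ψ (l - t)) _
    (hψ.comp (continuous_const.sub continuous_id)) hp' ?_
  · simpa using this
  · have ht : Tendsto (fun t => l - t) (𝓝 (l - y)) (𝓝 y) := by
      simpa only [e] using hd.continuousAt.tendsto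
    filter_upwards [ht.eventually hmax] with t ht
    simpa only [sub_sub_cancel] using ht

/-- The equation does not see orientation, so the one-sided estimate for the reversed interval
supplies the other inequality. -/
theorem ViscositySubOn.abs_sub_le {l : ℝ} {f g : ℝ → ℝ} (h : ViscositySubOn l f g)
    (hf : Continuous f) (hg : Continuous g) (hf0 : ∀ y ∈ Icc 0 l, 0 < f y) {a b : ℝ}
    (ha : 0 ≤ a) (hab : a ≤ b) (hb : b ≤ l) :
    |g b - g a| ≤ (∫ t in (0 : ℝ)..b, f t) - ∫ t in (0 : ℝ)..a, f t := by
  refine abs_sub_le_iff.2 ⟨h.sub_le hf hg hf0 ha hab hb, ?_⟩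
  have := h.reflect.sub_le (hf.comp (continuous_const.sub continuous_id))
    (hg.comp (continuous_const.sub continuous_id))
    (fun y hy => hf0 _ ⟨by linarith [hy.2], by linarith [hy.1]⟩) (a := l - b) (b := l - a)
    (by linarith) (by linarith) (by linarith)
  rw [integral_reflect hf, integral_reflect hf] at this
  simp only [sub_sub_cancel] at this
  linarith

/-- If g dipped below the envelope, a smooth envelope with slopes strictly below f, lying under g at
both ends and above it at `y₀`, would touch g from below at an interior point. -/
theorem ViscositySuperOn.min_le {l : ℝ} {f g : ℝ → ℝ} (h : ViscositySuperOn l f g) (hl : 0 < l)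
    (hf : Continuous f) (hg : Continuous g) (hf0 : ∀ y ∈ Icc 0 l, 0 < f y) {y₀ : ℝ}
    (hy₀ : y₀ ∈ Icc 0 l) :
    min (g 0 + ∫ t in (0 : ℝ)..y₀, f t)
      (g l + ((∫ t in (0 : ℝ)..l, f t) - ∫ t in (0 : ℝ)..y₀, f t)) ≤ g y₀ := by
  set F : ℝ → ℝ := fun y => ∫ t in (0 : ℝ)..y, f t
  change min (g 0 + F y₀) (g l + (F l - F y₀)) ≤ g y₀
  have hFc : Continuous F := continuous_integral hf
  have hmono := monotoneOn_integral hf hf0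
  have h0I : (0 : ℝ) ∈ Icc 0 l := ⟨le_rfl, hl.le⟩
  have hlI : l ∈ Icc 0 l := ⟨hl.le, le_rfl⟩
  have hF0 : F 0 = 0 := by simp [F]
  have hFy : 0 ≤ F y₀ := hF0 ▸ hmono h0I hy₀ hy₀.1
  have hFl : F y₀ ≤ F l := hmono hy₀ hlI hy₀.2
  by_contra! hgap
  set γ : ℝ := min (g 0 + F y₀) (g l + (F l - F y₀)) - g y₀
  have hγ : 0 < γ := sub_pos.2 hgap
  have hγ1 : γ ≤ g 0 + F y₀ - g y₀ := sub_le_sub_right (min_le_left _ _) _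
  have hγ2 : γ ≤ g l + (F l - F y₀) - g y₀ := sub_le_sub_right (min_le_right _ _) _
  set η : ℝ := min (1 / 2) (γ / (2 * (F l + 1)))
  have hFl0 : 0 ≤ F l := hFy.trans hFl
  have hη : 0 < η := by positivity
  have hη1 : η ≤ 1 / 2 := min_le_left _ _
  have hηF : η * F l ≤ γ / 2 := by
    have : η ≤ γ / (2 * (F l + 1)) := min_le_right _ _
    rw [le_div_iff₀ (by positivity)] at this
    nlinarith
  set c : ℝ := 1 - η
  have hc0 : 0 < c := by simp only [c]; linarith
  -- The minimum of two numbers is half their sum minus half the modulus of their difference. X is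
  -- the difference of the profiles with slopes ±c f, and the modulus is smoothed to S = √(X² +
  -- (γ/2)²), which lowers the envelope by at most γ/4. Since |X| ≤ S and c < 1, the slope stays
  -- below f.
  let X : ℝ → ℝ := fun y => g 0 - g l - c * F l + 2 * c * F y
  let S : ℝ → ℝ := fun y => √(X y ^ 2 + (γ / 2) ^ 2)
  let ψ : ℝ → ℝ := fun y => (g 0 + g l + c * F l) / 2 - S y / 2
  have hpos : ∀ y, 0 < X y ^ 2 + (γ / 2) ^ 2 := fun y => by positivity
  have hSX : ∀ y, |X y| ≤ S y := fun y => Real.abs_le_sqrt (by nlinarith)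
  have hSX' : ∀ y, S y ≤ |X y| + γ / 2 := fun y => by
    rw [Real.sqrt_le_left (by positivity)]
    nlinarith [abs_nonneg (X y), sq_abs (X y)]
  have hψc : Continuous ψ := by fun_prop
  have hψd : ∀ y, HasDerivAt ψ (-(2 * X y * (2 * c * f y) / (2 * S y)) / 2) y := by
    intro y
    have hX : HasDerivAt X (2 * c * f y) y :=
      ((hasDerivAt_integral hf y).const_mul (2 * c)).const_add _
    have hS : HasDerivAt S (2 * X y * (2 * c * f y) / (2 * S y)) y := by
      have := ((hX.pow 2).add_const ((γ / 2) ^ 2)).sqrt (hpos y).ne'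
      simpa using this
    have := (hS.div_const 2).const_sub ((g 0 + g l + c * F l) / 2)
    rwa [← neg_div] at this
  obtain ⟨y, hyI, hy⟩ := isCompact_Icc.exists_isMinOn (nonempty_Icc.2 hl.le)
    (hg.sub hψc).continuousOn (s := Icc 0 l)
  have hψ0 : ψ 0 ≤ g 0 := by
    have := (neg_abs_le (X 0)).trans' (neg_le_neg (hSX 0))
    simp only [ψ, X, hF0] at this ⊢
    linarith
  have hψl : ψ l ≤ g l := by
    have := (le_abs_self (X l)).trans (hSX l)
    simp only [ψ, X] at this ⊢
    linarith
  have hψy : g y₀ < ψ y₀ := by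
    have h1 := hSX' y₀
    have h2 : |X y₀| < g 0 + g l + c * F l - 2 * g y₀ - γ / 2 := by
      have hcF : η * F y₀ ≤ η * F l := mul_le_mul_of_nonneg_left hFl hη.le
      have hcF' : 0 ≤ η * F y₀ := mul_nonneg hη.le hFy
      refine abs_lt.2 ⟨?_, ?_⟩ <;> simp only [X, c] <;> nlinarith
    simp only [ψ]
    linarith
  have hyy : g y - ψ y ≤ g y₀ - ψ y₀ := hy hy₀
  have hy0 : y ≠ 0 := by rintro rfl; linarith
  have hyl : y ≠ l := by rintro rfl; linarith
  have hyI' : y ∈ Ioo 0 l := ⟨hyI.1.lt_of_ne' hy0, hyI.2.lt_of_ne hyl⟩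
  have := h y hyI' ψ _ hψc (hψd y) (hy.isLocalMin (Icc_mem_nhds hyI'.1 hyI'.2))
  have hSpos : 0 < S y := Real.sqrt_pos.2 (hpos y)
  have hfy := hf0 y hyI
  have e : -(2 * X y * (2 * c * f y) / (2 * S y)) / 2 = -(X y / S y * (c * f y)) := by
    field_simp
  rw [e, abs_neg, abs_mul, abs_div, abs_of_pos hSpos, abs_of_pos (mul_pos hc0 hfy)] at this
  have h1 : |X y| / S y ≤ 1 := (div_le_one hSpos).2 (hSX y)
  have h2 : |X y| / S y * (c * f y) ≤ c * f y :=
    mul_le_of_le_one_left (mul_pos hc0 hfy).le h1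
  have h3 := mul_pos hη hfy
  simp only [c] at h2 this
  linarith

/-- At a local minimum the one-sided derivatives point upwards. -/
theorem mul_sub_nonneg_of_isLocalMinOn {s : Set ℝ} (hs : Convex ℝ s) {h : ℝ → ℝ} {p x b : ℝ}
    (hx : x ∈ s) (hb : b ∈ s) (hd : HasDerivWithinAt h p s x) (hmin : IsLocalMinOn h s x) :
    0 ≤ p * (b - x) := by
  have := hmin.hasFDerivWithinAt_nonneg hd.hasFDerivWithinAt
    (sub_mem_posTangentConeAt_of_segment_subset (hs.segment_subset hx hb))
  simpa [mul_comm] using this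

namespace TopologicalNetwork

variable {n : ℕ} {I J : Type*} [Fintype I] [Fintype J] (G : TopologicalNetwork n I J)

/-! ### Optical length -/

/-- The length of the part `[0, y]` of the edge `j`, weighted by `f`. -/
noncomputable def len (f : G.carrier → ℝ) (j : J) (y : ℝ) : ℝ := ∫ t in (0 : ℝ)..y, G.restr f j t

/-- The weighted length of an edge. -/
noncomputable def edgeLen (f : G.carrier → ℝ) (j : J) : ℝ := G.len f j (G.l j)

/-- The weighted distance along the edge `j` from the vertex `i`. -/
noncomputable def lenFrom (f : G.carrier → ℝ) (i : I) (j : J) (y : ℝ) : ℝ :=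
  G.sign i j * (G.len f j y - G.len f j (G.vertexParam i j))

variable {G} in
theorem IsLipschitz.continuous_restr {f : G.carrier → ℝ} (hf : G.IsLipschitz f) (j : J) :
    Continuous (G.restr f j) := by
  obtain ⟨K, hK⟩ := hf j
  have := continuousOn_iff_continuous_domRestrict.1 hK.continuousOn
  have h2 : Continuous fun y : Icc 0 (G.l j) => f (G.point j y) := by
    convert this using 2 with y
    exact (G.restr_apply f j y).symm
  exact h2.Icc_extend'

@[simp]
theorem len_zero (f : G.carrier → ℝ) (j : J) : G.len f j 0 = 0 := intervalIntegral.integral_same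

variable {f : G.carrier → ℝ} (hf : ∀ j, Continuous (G.restr f j)) (hf0 : ∀ x, 0 < f x)

include hf0 in
theorem restr_pos {j : J} {y : ℝ} (hy : y ∈ Icc 0 (G.l j)) : 0 < G.restr f j y := by
  rw [restr_of_mem _ _ hy]; exact hf0 _

include hf in
theorem hasDerivAt_len (j : J) (y : ℝ) : HasDerivAt (G.len f j) (G.restr f j y) y :=
  hasDerivAt_integral (hf j) y

include hf in
theorem continuous_len (j : J) : Continuous (G.len f j) := continuous_integral (hf j)

include hf hf0 in
theorem len_mono {j : J} : MonotoneOn (G.len f j) (Icc 0 (G.l j)) :=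
  monotoneOn_integral (hf j) fun _ hy => G.restr_pos hf0 hy

include hf hf0 in
theorem len_nonneg {j : J} {y : ℝ} (hy : y ∈ Icc 0 (G.l j)) : 0 ≤ G.len f j y := by
  have := G.len_mono hf hf0 (G.zero_mem_Icc j) hy hy.1
  rwa [len_zero] at this

include hf hf0 in
theorem len_le {j : J} {y : ℝ} (hy : y ∈ Icc 0 (G.l j)) : G.len f j y ≤ G.edgeLen f j :=
  G.len_mono hf hf0 hy (G.length_mem_Icc j) hy.2

include hf hf0 in
theorem edgeLen_pos (j : J) : 0 < G.edgeLen f j :=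
  intervalIntegral.intervalIntegral_pos_of_pos_on ((hf j).intervalIntegrable _ _)
    (fun _ hy => G.restr_pos hf0 (Ioo_subset_Icc_self hy)) (G.l_pos j)

include hf hf0 in
theorem lenFrom_nonneg {i : I} {j : J} (h : j ∈ G.inc i) {y : ℝ} (hy : y ∈ Icc 0 (G.l j)) :
    0 ≤ G.lenFrom f i j y := by
  unfold lenFrom
  rcases G.inc_cases h with ⟨-, h2, h3, -⟩ | ⟨-, h2, h3, -⟩ <;> rw [h2, h3]
  · simpa using G.len_nonneg hf hf0 hy
  · have := G.len_le hf hf0 hy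
    unfold edgeLen at this
    linarith

theorem lenFrom_vertexParam (i : I) (j : J) : G.lenFrom f i j (G.vertexParam i j) = 0 := by
  simp [lenFrom]

/-! ### Local extrema along edges -/

theorem eventually_range_point {j : J} (y : Icc 0 (G.l j)) {P : G.carrier → Prop} :
    (∀ᶠ x in 𝓝[range (G.point j)] (G.point j y), P x) ↔
      ∀ᶠ z in 𝓝[Icc 0 (G.l j)] y.1, ∀ hz : z ∈ Icc 0 (G.l j), P (G.point j ⟨z, hz⟩) := by
  rw [nhdsWithin_range_point, eventually_map, nhdsWithin_eq_map_subtype_coe y.2, eventually_map]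
  exact eventually_congr (Eventually.of_forall fun z => ⟨fun h _ => h, fun h => h z.2⟩)

theorem isLocalMaxOn_range_iff {j : J} (y : Icc 0 (G.l j)) {u φ : G.carrier → ℝ} :
    IsLocalMaxOn (fun x => u x - φ x) (range (G.point j)) (G.point j y) ↔
      ∀ᶠ z in 𝓝[Icc 0 (G.l j)] y.1,
        G.restr u j z - G.restr φ j z ≤ G.restr u j y - G.restr φ j y := by
  refine (G.eventually_range_point y).trans ?_
  refine ⟨fun h => ?_, fun h => ?_⟩
  · filter_upwards [h, self_mem_nhdsWithin] with z hz hzI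
    rw [restr_of_mem _ _ hzI, restr_of_mem _ _ hzI, restr_apply, restr_apply]
    exact hz hzI
  · filter_upwards [h] with z hz hzI
    rwa [restr_of_mem _ _ hzI, restr_of_mem _ _ hzI, restr_apply, restr_apply] at hz

theorem isLocalMinOn_range_iff {j : J} (y : Icc 0 (G.l j)) {u φ : G.carrier → ℝ} :
    IsLocalMinOn (fun x => u x - φ x) (range (G.point j)) (G.point j y) ↔
      ∀ᶠ z in 𝓝[Icc 0 (G.l j)] y.1,
        G.restr u j y - G.restr φ j y ≤ G.restr u j z - G.restr φ j z := by
  refine (G.eventually_range_point y).trans ?_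
  refine ⟨fun h => ?_, fun h => ?_⟩
  · filter_upwards [h, self_mem_nhdsWithin] with z hz hzI
    rw [restr_of_mem _ _ hzI, restr_of_mem _ _ hzI, restr_apply, restr_apply]
    exact hz hzI
  · filter_upwards [h] with z hz hzI
    rwa [restr_of_mem _ _ hzI, restr_of_mem _ _ hzI, restr_apply, restr_apply] at hz

theorem isLocalMax_point_iff {j : J} {y : Icc 0 (G.l j)} (hy : y.1 ∈ Ioo 0 (G.l j))
    {u φ : G.carrier → ℝ} : IsLocalMax (fun x => u x - φ x) (G.point j y) ↔
      ∀ᶠ z in 𝓝[Icc 0 (G.l j)] y.1,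
        G.restr u j z - G.restr φ j z ≤ G.restr u j y - G.restr φ j y := by
  rw [← isLocalMaxOn_range_iff, IsLocalMaxOn, IsLocalMax, nhdsWithin_range_point, nhds_point _ hy]

theorem isLocalMin_point_iff {j : J} {y : Icc 0 (G.l j)} (hy : y.1 ∈ Ioo 0 (G.l j))
    {u φ : G.carrier → ℝ} : IsLocalMin (fun x => u x - φ x) (G.point j y) ↔
      ∀ᶠ z in 𝓝[Icc 0 (G.l j)] y.1,
        G.restr u j y - G.restr φ j y ≤ G.restr u j z - G.restr φ j z := by
  rw [← isLocalMinOn_range_iff, IsLocalMinOn, IsLocalMin, nhdsWithin_range_point, nhds_point _ hy]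

theorem edgeDeriv_one (j : J) (u : G.carrier → ℝ) (y : ℝ) :
    G.edgeDeriv 1 j u y = derivWithin (G.restr u j) (Icc 0 (G.l j)) y := by
  rw [edgeDeriv, iteratedDerivWithin_one]

/-! ### The structure of viscosity solutions of the eikonal equation -/

theorem exists_test {j : J} {y p : ℝ} (hy : y ∈ Ioo 0 (G.l j)) {ψ : ℝ → ℝ} (hψ : Continuous ψ)
    (hp : HasDerivAt ψ p y) : ∃ φ : G.carrier → ℝ, G.IsTestAt φ j y ∧ G.edgeDeriv 1 j φ y = p ∧
      ∀ z ∈ Icc 0 (G.l j), G.restr φ j z = ψ z := by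
  obtain ⟨φ, hφ, hφψ⟩ := G.exists_extension j hψ.continuousOn
  have hd : HasDerivWithinAt (G.restr φ j) p (Icc 0 (G.l j)) y :=
    hp.hasDerivWithinAt.congr hφψ (hφψ y (Ioo_subset_Icc_self hy))
  refine ⟨φ, ⟨hφ, hd.differentiableWithinAt⟩, ?_, hφψ⟩
  rw [edgeDeriv_one, hd.derivWithin (uniqueDiffOn_Icc (G.l_pos j) y (Ioo_subset_Icc_self hy))]

variable {G} {B : Set I} {u : G.carrier → ℝ}

theorem SolvesEikonal.viscositySubOn (hu : G.SolvesEikonal B f u) (j : J) :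
    ViscositySubOn (G.l j) (G.restr f j) (G.restr u j) := by
  intro y hy ψ p hψ hp hmax
  obtain ⟨φ, hφ, hφp, hφψ⟩ := G.exists_test hy hψ hp
  have hyI := Ioo_subset_Icc_self hy
  have := hu.1.2.1.2.1 j ⟨y, hyI⟩ hy φ hφ ((G.isLocalMax_point_iff hy).2 ?_)
  · rw [hφp] at this
    linarith
  · filter_upwards [hmax.filter_mono nhdsWithin_le_nhds, self_mem_nhdsWithin] with z hz hzI
    rwa [hφψ z hzI, hφψ y hyI]

theorem SolvesEikonal.viscositySuperOn (hu : G.SolvesEikonal B f u) (j : J) :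
    ViscositySuperOn (G.l j) (G.restr f j) (G.restr u j) := by
  intro y hy ψ p hψ hp hmin
  obtain ⟨φ, hφ, hφp, hφψ⟩ := G.exists_test hy hψ hp
  have hyI := Ioo_subset_Icc_self hy
  have := hu.1.2.2.2.1 j ⟨y, hyI⟩ hy φ hφ ((G.isLocalMin_point_iff hy).2 ?_)
  · rw [hφp] at this
    linarith
  · filter_upwards [hmin.filter_mono nhdsWithin_le_nhds, self_mem_nhdsWithin] with z hz hzI
    rwa [hφψ z hzI, hφψ y hyI]

include hf hf0 in
theorem SolvesEikonal.abs_sub_le (hu : G.SolvesEikonal B f u) {j : J} {a b : ℝ} (ha : 0 ≤ a)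
    (hab : a ≤ b) (hb : b ≤ G.l j) :
    |G.restr u j b - G.restr u j a| ≤ G.len f j b - G.len f j a :=
  (hu.viscositySubOn j).abs_sub_le (hf j) (G.continuous_restr hu.1.1 j)
    (fun _ hy => G.restr_pos hf0 hy) ha hab hb

include hf hf0 in
theorem SolvesEikonal.abs_vertex_sub_le (hu : G.SolvesEikonal B f u) (j : J) :
    |u (G.vertex (G.tgt j)) - u (G.vertex (G.src j))| ≤ G.edgeLen f j := by
  have := hu.abs_sub_le hf hf0 (j := j) le_rfl (G.l_pos j).le le_rfl
  rwa [restr_length, restr_zero, len_zero, sub_zero] at this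

include hf hf0 in
theorem SolvesEikonal.vertex_le (hu : G.SolvesEikonal B f u) {i : I} {j : J} (h : j ∈ G.inc i) :
    u (G.vertex i) ≤ u (G.vertex (G.other i j)) + G.edgeLen f j := by
  have := abs_le.1 (hu.abs_vertex_sub_le hf hf0 j)
  rcases G.inc_cases h with ⟨h1, -, -, h2⟩ | ⟨h1, -, -, h2⟩ <;> rw [h2, ← h1] <;>
    linarith [this.1, this.2]

include hf hf0 in
-- The Lipschitz bound from each end gives ≤, the supersolution estimate gives ≥. Vertex values
-- therefore determine the solution.
theorem SolvesEikonal.restr_eq (hu : G.SolvesEikonal B f u) {j : J} {y : ℝ}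
    (hy : y ∈ Icc 0 (G.l j)) : G.restr u j y =
      min (u (G.vertex (G.src j)) + G.len f j y)
        (u (G.vertex (G.tgt j)) + (G.edgeLen f j - G.len f j y)) := by
  refine le_antisymm (le_min ?_ ?_) ?_
  · have := abs_le.1 (hu.abs_sub_le hf hf0 le_rfl hy.1 hy.2)
    rw [restr_zero, len_zero] at this
    linarith [this.2]
  · have := abs_le.1 (hu.abs_sub_le hf hf0 hy.1 hy.2 le_rfl)
    rw [restr_length] at this
    unfold edgeLen
    linarith [this.1]
  · have := (hu.viscositySuperOn j).min_le (G.l_pos j) (hf j) (G.continuous_restr hu.1.1 j)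
      (fun _ hy => G.restr_pos hf0 hy) hy
    rwa [restr_zero, restr_length] at this

theorem min_eq_lenFrom (U : I → ℝ) {i : I} {j : J} (h : j ∈ G.inc i) (y : ℝ) :
    min (U (G.src j) + G.len f j y) (U (G.tgt j) + (G.edgeLen f j - G.len f j y)) =
      min (U i + G.lenFrom f i j y) (U (G.other i j) + (G.edgeLen f j - G.lenFrom f i j y)) := by
  unfold lenFrom
  rcases G.inc_cases h with ⟨h1, h2, h3, h4⟩ | ⟨h1, h2, h3, h4⟩ <;> rw [h2, h3, h4, ← h1]
  · simp
  · rw [min_comm]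
    unfold edgeLen
    congr 1 <;> ring

include hf in
theorem continuous_lenFrom (i : I) (j : J) : Continuous (G.lenFrom f i j) :=
  continuous_const.mul ((G.continuous_len hf j).sub continuous_const)

include hf hf0 in
-- Otherwise the envelope formula makes u nondecreasing away from the vertex, locally, along every
-- incident edge. The zero function is then an admissible test function at a local minimum, forcing
-- f ≤ 0 there whichever edge is feasible.
theorem SolvesEikonal.exists_vertex_ge (hu : G.SolvesEikonal B f u) {i : I} (hi : i ∉ B) :
    ∃ j ∈ G.inc i, u (G.vertex (G.other i j)) + G.edgeLen f j ≤ u (G.vertex i) := by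
  by_contra! hcon
  have hloc : ∀ j ∈ G.inc i,
      IsLocalMinOn (fun x => u x - (fun _ => 0 : G.carrier → ℝ) x) (range (G.point j))
        (G.vertex i) := by
    intro j hj
    rw [← G.point_vertexParam hj, isLocalMinOn_range_iff]
    have hc : Continuous fun z => u (G.vertex (G.other i j)) +
        (G.edgeLen f j - G.lenFrom f i j z) :=
      continuous_const.add (continuous_const.sub (continuous_lenFrom hf i j))
    have ht := (hc.tendsto (G.vertexParam i j)).eventually_const_lt
      (u := u (G.vertex i)) (by rw [lenFrom_vertexParam]; linarith [hcon j hj])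
    filter_upwards [ht.filter_mono nhdsWithin_le_nhds, self_mem_nhdsWithin] with z hz hzI
    rw [restr_of_mem _ (fun _ => (0 : ℝ)) hzI, restr_of_mem _ (fun _ => (0 : ℝ))
      (G.vertexParam_mem hj), sub_zero, sub_zero, G.restr_vertexParam u hj,
      hu.restr_eq hf hf0 hzI, min_eq_lenFrom (fun i => u (G.vertex i)) hj]
    exact le_min (by linarith [G.lenFrom_nonneg hf hf0 hj hzI]) hz.le
  obtain ⟨j, hj⟩ := G.inc_nonempty i
  obtain ⟨k, hk, -, hjk⟩ := hu.1.2.2.2.2 i hi j hj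
  have hrestr : ∀ j, G.restr (fun _ => (0 : ℝ)) j = fun _ => 0 := fun j => by
    funext y; rfl
  have hder : ∀ j y, G.edgeDeriv 1 j (fun _ => (0 : ℝ)) y = 0 := fun j y => by
    rw [edgeDeriv_one, hrestr]; simp
  have := hjk (fun _ => 0) ⟨continuous_const, by rw [hrestr]; exact differentiableWithinAt_const _,
    by rw [hrestr]; exact differentiableWithinAt_const _, by simp [hder]⟩ (by
      rw [edgePair_eq, IsLocalMinOn, IsMinFilter, nhdsWithin_union, eventually_sup]
      exact ⟨hloc j hj, hloc k hk⟩)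
  rw [hder] at this
  beta_reduce at this
  rw [abs_zero] at this
  linarith [G.restr_pos hf0 (G.vertexParam_mem hj)]

/-- Uniqueness for the eikonal equation. -/
theorem SolvesEikonal.unique (hf : ∀ j, Continuous (G.restr f j)) (hf0 : ∀ x, 0 < f x)
    {w : G.carrier → ℝ} (hu : G.SolvesEikonal B f u) (hw : G.SolvesEikonal B f w) : u = w := by
  have key : ∀ {u w : G.carrier → ℝ}, G.SolvesEikonal B f u → G.SolvesEikonal B f w →
      ∀ i, u (G.vertex i) ≤ w (G.vertex i) := fun hu hw =>
    G.vertex_comparison (G.edgeLen_pos hf hf0)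
      (P := fun i => _) (Q := fun i => _) (fun i _ j hj => hu.vertex_le hf hf0 hj)
      (fun i hi => hw.exists_vertex_ge hf hf0 hi) (fun i hi => by rw [hu.2 i hi, hw.2 i hi])
  have hv : ∀ i, u (G.vertex i) = w (G.vertex i) := fun i => le_antisymm (key hu hw i) (key hw hu i)
  refine G.ext_restr fun j y hy => ?_
  rw [hu.restr_eq hf hf0 hy, hw.restr_eq hf hf0 hy, hv, hv]

end TopologicalNetwork

namespace TopologicalNetwork

variable {n : ℕ} {I J : Type*} [Fintype I] [Fintype J] (G : TopologicalNetwork n I J)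
variable {f : G.carrier → ℝ} (hf : ∀ j, Continuous (G.restr f j)) (hf0 : ∀ x, 0 < f x)

/-! ### Existence for the eikonal equation -/

theorem add_mul_sub_nonneg {s : Set ℝ} (hs : Convex ℝ s) {φ E : ℝ → ℝ} {p e x b : ℝ}
    (hx : x ∈ s) (hb : b ∈ s) (hd : HasDerivWithinAt φ p s x) (hE : HasDerivWithinAt E e s x)
    (hmin : ∀ᶠ z in 𝓝[s] x, φ x + E x ≤ φ z + E z) : 0 ≤ (p + e) * (b - x) :=
  mul_sub_nonneg_of_isLocalMinOn hs hx hb (hd.add hE) hmin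

theorem sign_mul_opposite {i : I} {j : J} (h : j ∈ G.inc i) :
    ∃ b ∈ Icc 0 (G.l j), b - G.vertexParam i j = G.sign i j * G.l j := by
  rcases G.inc_cases h with ⟨-, h2, h3, -⟩ | ⟨-, h2, h3, -⟩ <;> rw [h2, h3]
  · exact ⟨_, G.length_mem_Icc j, by ring⟩
  · exact ⟨_, G.zero_mem_Icc j, by ring⟩

include hf in
theorem hasDerivAt_lenFrom (i : I) (j : J) (y : ℝ) :
    HasDerivAt (G.lenFrom f i j) (G.sign i j * G.restr f j y) y :=
  ((G.hasDerivAt_len hf j y).sub_const _).const_mul _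

include hf in
/-- A test function touching from above a function that decreases at most at rate `f`. -/
theorem neg_le_sign_mul {i : I} {j : J} (h : j ∈ G.inc i) {u φ : ℝ → ℝ} {p : ℝ}
    (hd : HasDerivWithinAt φ p (Icc 0 (G.l j)) (G.vertexParam i j))
    (hmax : ∀ᶠ z in 𝓝[Icc 0 (G.l j)] G.vertexParam i j,
      u z - φ z ≤ u (G.vertexParam i j) - φ (G.vertexParam i j))
    (hu : ∀ z ∈ Icc 0 (G.l j), u (G.vertexParam i j) - G.lenFrom f i j z ≤ u z) :
    -G.restr f j (G.vertexParam i j) ≤ G.sign i j * p := by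
  obtain ⟨b, hb, hbt⟩ := G.sign_mul_opposite h
  have := add_mul_sub_nonneg (convex_Icc _ _) (G.vertexParam_mem h) hb hd
    (G.hasDerivAt_lenFrom hf i j _).hasDerivWithinAt (by
      filter_upwards [hmax, self_mem_nhdsWithin] with z hz hzI
      rw [lenFrom_vertexParam]
      linarith [hu z hzI])
  rw [hbt, ← mul_assoc] at this
  have h2 := nonneg_of_mul_nonneg_left this (G.l_pos j)
  have e : (p + G.sign i j * G.restr f j (G.vertexParam i j)) * G.sign i j =
      G.sign i j * p + (G.sign i j * G.sign i j) * G.restr f j (G.vertexParam i j) := by ring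
  rw [e, G.sign_mul_self h] at h2
  linarith

include hf in
/-- A test function touching from below a function that decreases at least at rate `f`. -/
theorem sign_mul_le_neg {i : I} {j : J} (h : j ∈ G.inc i) {u φ : ℝ → ℝ} {p : ℝ}
    (hd : HasDerivWithinAt φ p (Icc 0 (G.l j)) (G.vertexParam i j))
    (hmin : ∀ᶠ z in 𝓝[Icc 0 (G.l j)] G.vertexParam i j,
      u (G.vertexParam i j) - φ (G.vertexParam i j) ≤ u z - φ z)
    (hu : ∀ z ∈ Icc 0 (G.l j), u z ≤ u (G.vertexParam i j) - G.lenFrom f i j z) :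
    G.sign i j * p ≤ -G.restr f j (G.vertexParam i j) := by
  obtain ⟨b, hb, hbt⟩ := G.sign_mul_opposite h
  have := add_mul_sub_nonneg (convex_Icc _ _) (G.vertexParam_mem h) hb hd.neg
    (G.hasDerivAt_lenFrom hf i j _).neg.hasDerivWithinAt (by
      filter_upwards [hmin, self_mem_nhdsWithin] with z hz hzI
      simp only [Pi.neg_apply]
      rw [lenFrom_vertexParam]
      linarith [hu z hzI])
  rw [hbt, ← mul_assoc] at this
  have h2 := nonneg_of_mul_nonneg_left this (G.l_pos j)
  have e : (-p + -(G.sign i j * G.restr f j (G.vertexParam i j))) * G.sign i j =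
      -(G.sign i j * p) - (G.sign i j * G.sign i j) * G.restr f j (G.vertexParam i j) := by ring
  rw [e, G.sign_mul_self h] at h2
  linarith

/-- The profile on an edge of a solution of the eikonal equation with vertex values `U`. -/
noncomputable def edgeProfile (f : G.carrier → ℝ) (U : I → ℝ) (j : J) (y : ℝ) : ℝ :=
  min (U (G.src j) + G.len f j y) (U (G.tgt j) + (G.edgeLen f j - G.len f j y))

/-- A minimum of two functions that are 1-Lipschitz for optical length is again 1-Lipschitz. -/
theorem edgeProfile_sub_le (f : G.carrier → ℝ) (U : I → ℝ) (j : J) (x z : ℝ) :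
    G.edgeProfile f U j x - G.edgeProfile f U j z ≤ |G.len f j x - G.len f j z| := by
  have h1 := le_abs_self (G.len f j x - G.len f j z)
  have h2 := neg_abs_le (G.len f j x - G.len f j z)
  rw [sub_le_iff_le_add']
  unfold edgeProfile
  rw [← min_add_add_right]
  exact min_le_min (by linarith) (by linarith)

include hf hf0 in
theorem edgeProfile_sub_lenFrom_le (U : I → ℝ) {i : I} {j : J} (h : j ∈ G.inc i) {z : ℝ}
    (hz : z ∈ Icc 0 (G.l j)) : G.edgeProfile f U j (G.vertexParam i j) - G.lenFrom f i j z ≤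
      G.edgeProfile f U j z := by
  have := G.edgeProfile_sub_le f U j (G.vertexParam i j) z
  have e : |G.len f j (G.vertexParam i j) - G.len f j z| = G.lenFrom f i j z := by
    rw [← abs_of_nonneg (G.lenFrom_nonneg hf hf0 h hz), lenFrom, abs_mul, G.abs_sign h, one_mul,
      abs_sub_comm]
  linarith

include hf hf0 in
-- Envelopes with the discrete solution as vertex values are glued. The subsolution conditions use
-- only the Lipschitz bound; at a vertex the supersolution condition uses an edge along which u
-- descends at full rate f.
theorem exists_solvesEikonal {B : Set I} (hB : B.Nonempty) (hleaf : ∀ i, (G.inc i).card = 1 → i ∈ B) :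
    ∃ u, G.SolvesEikonal B f u := by
  obtain ⟨U, hU0, hUnn, hUle, hUge⟩ := G.exists_vertex_solution hB (G.edgeLen_pos hf hf0)
  -- The inequality also holds at boundary vertices, since U vanishes there and is nonnegative;
  -- without it the envelopes would not attain the prescribed end values.
  have hUle' : ∀ i, ∀ j ∈ G.inc i, U i ≤ U (G.other i j) + G.edgeLen f j := fun i j hj => by
    by_cases hi : i ∈ B
    · rw [hU0 i hi]; linarith [hUnn (G.other i j), G.edgeLen_pos hf hf0 j]
    · exact hUle i hi j hj
  obtain ⟨u, huc, hur, huv⟩ := G.exists_glue U (G.edgeProfile f U)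
    (fun j => by
      have := G.continuous_len hf j
      exact Continuous.continuousOn (by unfold edgeProfile; fun_prop))
    (fun j => by
      have := hUle' _ _ (G.src_inc j)
      rw [other_src] at this
      simp only [edgeProfile, len_zero, add_zero, sub_zero]
      exact min_eq_left this)
    (fun j => by
      have := hUle' _ _ (G.tgt_inc j)
      rw [other_tgt] at this
      simp only [edgeProfile]
      rw [show G.len f j (G.l j) = G.edgeLen f j from rfl, sub_self, add_zero]
      exact min_eq_right this)
  have hlip : ∀ {i : I} {j : J}, j ∈ G.inc i → ∀ z ∈ Icc 0 (G.l j),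
      G.restr u j (G.vertexParam i j) - G.lenFrom f i j z ≤ G.restr u j z := by
    intro i j hj z hz
    rw [hur j z hz, hur j _ (G.vertexParam_mem hj)]
    exact G.edgeProfile_sub_lenFrom_le hf hf0 U hj hz
  have hvd : ∀ {φ : G.carrier → ℝ} {i : I} {j : J},
      DifferentiableWithinAt ℝ (G.restr φ j) (Icc 0 (G.l j)) (G.vertexParam i j) →
      HasDerivWithinAt (G.restr φ j) (G.edgeDeriv 1 j φ (G.vertexParam i j)) (Icc 0 (G.l j))
        (G.vertexParam i j) := fun h => by
    rw [edgeDeriv_one]; exact h.hasDerivWithinAt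
  refine ⟨u, ⟨huc, ⟨huc.upperSemicontinuous, ?_, ?_⟩, huc.lowerSemicontinuous, ?_, ?_⟩,
    fun i hi => by rw [huv, hU0 i hi]⟩
  · intro j y hy φ hφ hmax
    rw [isLocalMax_point_iff _ hy] at hmax
    have hd : HasDerivWithinAt (G.restr φ j) (G.edgeDeriv 1 j φ y) (Icc 0 (G.l j)) y := by
      rw [edgeDeriv_one]; exact hφ.2.hasDerivWithinAt
    -- The right half of the edge bounds the derivative below by -f, the left half (`hL`) bounds it
    -- above by f.
    have hR := add_mul_sub_nonneg (convex_Icc y.1 (G.l j)) ⟨le_rfl, hy.2.le⟩ ⟨hy.2.le, le_rfl⟩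
      (hd.mono (Icc_subset_Icc_left y.2.1)) (G.hasDerivAt_len hf j y).hasDerivWithinAt (by
        filter_upwards [hmax.filter_mono (nhdsWithin_mono _ (Icc_subset_Icc_left y.2.1)),
          self_mem_nhdsWithin] with z hz hzI
        have hzI' : z ∈ Icc 0 (G.l j) := ⟨y.2.1.trans hzI.1, hzI.2⟩
        have := G.edgeProfile_sub_le f U j y z
        rw [abs_sub_comm, abs_of_nonneg (sub_nonneg.2 (G.len_mono hf hf0 y.2 hzI' hzI.1)),
          ← hur j z hzI', ← hur j y y.2] at this
        linarith)
    have hL := add_mul_sub_nonneg (convex_Icc 0 y.1) ⟨hy.1.le, le_rfl⟩ ⟨le_rfl, hy.1.le⟩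
      (hd.mono (Icc_subset_Icc_right y.2.2)) (G.hasDerivAt_len hf j y).neg.hasDerivWithinAt (by
        filter_upwards [hmax.filter_mono (nhdsWithin_mono _ (Icc_subset_Icc_right y.2.2)),
          self_mem_nhdsWithin] with z hz hzI
        have hzI' : z ∈ Icc 0 (G.l j) := ⟨hzI.1, hzI.2.trans y.2.2⟩
        have := G.edgeProfile_sub_le f U j y z
        rw [abs_of_nonneg (sub_nonneg.2 (G.len_mono hf hf0 hzI' y.2 hzI.2)),
          ← hur j z hzI', ← hur j y y.2] at this
        simp only [Pi.neg_apply]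
        linarith)
    have h1 := nonneg_of_mul_nonneg_left hR (sub_pos.2 hy.2)
    have h2 : G.edgeDeriv 1 j φ y + -G.restr f j y ≤ 0 := by
      by_contra! hpos
      have := mul_pos hpos hy.1
      linarith
    exact sub_nonpos.2 (abs_le.2 ⟨by linarith, by linarith⟩)
  · intro i _ j hj k hk _ φ hφ hmax
    rw [edgePair_eq] at hmax
    have hmj := hmax.on_subset subset_union_left
    have hmk := hmax.on_subset subset_union_right
    rw [← G.point_vertexParam hj, isLocalMaxOn_range_iff] at hmj
    rw [← G.point_vertexParam hk, isLocalMaxOn_range_iff] at hmk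
    have h1 := G.neg_le_sign_mul hf hj (hvd hφ.2.1) hmj (hlip hj)
    have h2 := G.neg_le_sign_mul hf hk (hvd hφ.2.2.1) hmk (hlip hk)
    rw [G.restr_vertexParam f hj] at h1
    rw [G.restr_vertexParam f hk] at h2
    have h3 := hφ.2.2.2
    beta_reduce
    rw [sub_nonpos, G.restr_vertexParam f hj,
      ← one_mul |G.edgeDeriv 1 j φ (G.vertexParam i j)|, ← G.abs_sign hj, ← abs_mul]
    exact abs_le.2 ⟨by linarith, by linarith⟩
  · intro j y hy φ hφ hmin
    rw [isLocalMin_point_iff _ hy] at hmin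
    have hnhds : Icc 0 (G.l j) ∈ 𝓝 y.1 := Icc_mem_nhds hy.1 hy.2
    rw [nhdsWithin_eq_nhds.2 hnhds] at hmin
    have hd : HasDerivAt (G.restr φ j) (G.edgeDeriv 1 j φ y) y := by
      rw [edgeDeriv_one]; exact hφ.2.hasDerivWithinAt.hasDerivAt hnhds
    beta_reduce
    rw [sub_nonneg]
    -- The branch attaining the minimum at y dominates u and equals it there, so φ also touches that
    -- differentiable branch from below, and its derivative is ±f.
    rcases min_choice (U (G.src j) + G.len f j y) (U (G.tgt j) + (G.edgeLen f j - G.len f j y))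
      with h | h
    · have : IsLocalMax (fun z => G.restr φ j z - G.len f j z) y := by
        filter_upwards [hmin, hnhds] with z hz hzI
        rw [hur j z hzI, hur j y y.2] at hz
        unfold edgeProfile at hz
        rw [h] at hz
        linarith [min_le_left (U (G.src j) + G.len f j z)
          (U (G.tgt j) + (G.edgeLen f j - G.len f j z))]
      have := this.hasDerivAt_eq_zero (hd.sub (G.hasDerivAt_len hf j y))
      rw [← sub_eq_zero.1 this]
      exact le_abs_self _
    · have : IsLocalMax (fun z => G.restr φ j z + G.len f j z) y := by
        filter_upwards [hmin, hnhds] with z hz hzI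
        rw [hur j z hzI, hur j y y.2] at hz
        unfold edgeProfile at hz
        rw [h] at hz
        linarith [min_le_right (U (G.src j) + G.len f j z)
          (U (G.tgt j) + (G.edgeLen f j - G.len f j z))]
      have := this.hasDerivAt_eq_zero (hd.add (G.hasDerivAt_len hf j y))
      rw [← neg_eq_of_add_eq_zero_right this]
      exact neg_le_abs _
  · intro i hi j hj
    obtain ⟨m, hm, hmU⟩ := hUge i hi
    have hdec : ∀ z ∈ Icc 0 (G.l m),
        G.restr u m z ≤ G.restr u m (G.vertexParam i m) - G.lenFrom f i m z := by
      intro z hz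
      rw [G.restr_vertexParam u hm, huv, hur m z hz, edgeProfile, min_eq_lenFrom U hm]
      exact (min_le_right _ _).trans (by linarith)
    have key : ∀ φ : G.carrier → ℝ,
        DifferentiableWithinAt ℝ (G.restr φ m) (Icc 0 (G.l m)) (G.vertexParam i m) →
        IsLocalMinOn (fun x => u x - φ x) (range (G.point m)) (G.vertex i) →
        G.sign i m * G.edgeDeriv 1 m φ (G.vertexParam i m) ≤ -f (G.vertex i) := by
      intro φ hφ hmin
      rw [← G.point_vertexParam hm, isLocalMinOn_range_iff] at hmin
      have := G.sign_mul_le_neg hf hm (hvd hφ) hmin hdec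
      rwa [G.restr_vertexParam f hm] at this
    have habs : ∀ φ : G.carrier → ℝ, f (G.vertex i) ≤
        |G.sign i j * G.edgeDeriv 1 j φ (G.vertexParam i j)| →
        0 ≤ |G.edgeDeriv 1 j φ (G.vertexParam i j)| - G.restr f j (G.vertexParam i j) := by
      intro φ h
      rw [abs_mul, G.abs_sign hj, one_mul] at h
      rw [G.restr_vertexParam f hj]
      linarith
    by_cases hjm : j = m
    · subst hjm
      -- When j itself is the descending edge, any other incident edge is feasible; one exists
      -- because vertices with a single edge belong to the boundary.
      have hcard : 1 < (G.inc i).card := by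
        have h0 := (G.inc_nonempty i).card_pos
        have h1 : (G.inc i).card ≠ 1 := fun h => hi (hleaf i h)
        omega
      obtain ⟨k, hk, hkj⟩ := Finset.exists_mem_ne hcard j
      refine ⟨k, hk, hkj, fun φ hφ hmin => habs φ ?_⟩
      rw [edgePair_eq] at hmin
      have := key φ hφ.2.1 (hmin.on_subset subset_union_left)
      exact le_trans (by linarith) (neg_le_abs _)
    · refine ⟨m, hm, Ne.symm hjm, fun φ hφ hmin => habs φ ?_⟩
      rw [edgePair_eq] at hmin
      have := key φ hφ.2.2.1 (hmin.on_subset subset_union_right)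
      have h3 := hφ.2.2.2
      exact le_trans (by linarith) (le_abs_self _)

end TopologicalNetwork

/-! ### The Hopf–Cole transform -/

open Classical in
/-- The solution of `z'' = c z` on `[0, l]` with `z(0) = 0`, `z'(0) = 1`, and its derivative. -/
noncomputable def fundamentalSolution (c : ℝ → ℝ) (l : ℝ) : (ℝ → ℝ) × (ℝ → ℝ) :=
  if h : ∃ p : (ℝ → ℝ) × (ℝ → ℝ), SolvesLinear c l p.1 p.2 ∧ p.1 0 = 0 ∧ p.2 0 = 1 then h.choose
  else 0

theorem fundamentalSolution_spec {c : ℝ → ℝ} {l : ℝ} (hl : 0 < l) (hc : Continuous c) :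
    SolvesLinear c l (fundamentalSolution c l).1 (fundamentalSolution c l).2 ∧
      (fundamentalSolution c l).1 0 = 0 ∧ (fundamentalSolution c l).2 0 = 1 := by
  have h : ∃ p : (ℝ → ℝ) × (ℝ → ℝ), SolvesLinear c l p.1 p.2 ∧ p.1 0 = 0 ∧ p.2 0 = 1 := by
    obtain ⟨z, z', h⟩ := SolvesLinear.exists_fundamental hl hc.continuousOn
    exact ⟨(z, z'), h⟩
  rw [fundamentalSolution, dif_pos h]
  exact h.choose_spec

namespace TopologicalNetwork

variable {n : ℕ} {I J : Type*} [Fintype I] [Fintype J] (G : TopologicalNetwork n I J)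

/-- The fundamental solution of `ε² z'' = f² z` on the edge `j`, started at its initial vertex. -/
noncomputable def fundSrc (f : G.carrier → ℝ) (ε : ℝ) (j : J) : (ℝ → ℝ) × (ℝ → ℝ) :=
  fundamentalSolution (fun y => G.restr f j y ^ 2 / ε ^ 2) (G.l j)

/-- The fundamental solution of `ε² z'' = f² z` on the edge `j`, started at its terminal vertex. -/
noncomputable def fundTgt (f : G.carrier → ℝ) (ε : ℝ) (j : J) : (ℝ → ℝ) × (ℝ → ℝ) :=
  fundamentalSolution (fun y => G.restr f j (G.l j - y) ^ 2 / ε ^ 2) (G.l j)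

open Classical in
/-- The fundamental solution on the edge `j` started at the vertex `i`. -/
noncomputable def fundFrom (f : G.carrier → ℝ) (ε : ℝ) (i : I) (j : J) : (ℝ → ℝ) × (ℝ → ℝ) :=
  if G.src j = i then G.fundSrc f ε j else G.fundTgt f ε j

/-- The solution of `ε² w'' = f² w` on the edge `j` with boundary values `W`. -/
noncomputable def wave (f : G.carrier → ℝ) (ε : ℝ) (W : I → ℝ) (j : J) (y : ℝ) : ℝ :=
  W (G.src j) * ((G.fundTgt f ε j).1 (G.l j - y) / (G.fundTgt f ε j).1 (G.l j)) +
    W (G.tgt j) * ((G.fundSrc f ε j).1 y / (G.fundSrc f ε j).1 (G.l j))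

/-- The derivative of `wave`. -/
noncomputable def waveDeriv (f : G.carrier → ℝ) (ε : ℝ) (W : I → ℝ) (j : J) (y : ℝ) : ℝ :=
  W (G.src j) * (-(G.fundTgt f ε j).2 (G.l j - y) / (G.fundTgt f ε j).1 (G.l j)) +
    W (G.tgt j) * ((G.fundSrc f ε j).2 y / (G.fundSrc f ε j).1 (G.l j))

/-- The dependence of the flux at the vertex `i` into the edge `j` on the opposite vertex value. -/
noncomputable def transRate (f : G.carrier → ℝ) (ε : ℝ) (i : I) (j : J) : ℝ :=
  1 / (G.fundFrom f ε i j).1 (G.l j)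

/-- The dependence of the flux at the vertex `i` into the edge `j` on the value at `i`. -/
noncomputable def exitRate (f : G.carrier → ℝ) (ε : ℝ) (i : I) (j : J) : ℝ :=
  (G.fundFrom f ε (G.other i j) j).2 (G.l j) / (G.fundFrom f ε (G.other i j) j).1 (G.l j)

theorem fundFrom_src (f : G.carrier → ℝ) (ε : ℝ) (j : J) :
    G.fundFrom f ε (G.src j) j = G.fundSrc f ε j := if_pos rfl

theorem fundFrom_tgt (f : G.carrier → ℝ) (ε : ℝ) (j : J) :
    G.fundFrom f ε (G.tgt j) j = G.fundTgt f ε j := if_neg (G.src_ne_tgt j)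

variable {f : G.carrier → ℝ} (hf : ∀ j, Continuous (G.restr f j)) (hf0 : ∀ x, 0 < f x)

theorem reflect_mem {j : J} {y : ℝ} (hy : y ∈ Icc 0 (G.l j)) : G.l j - y ∈ Icc 0 (G.l j) :=
  ⟨sub_nonneg.2 hy.2, sub_le_self _ hy.1⟩

include hf in
theorem fundSrc_spec (ε : ℝ) (j : J) :
    SolvesLinear (fun y => G.restr f j y ^ 2 / ε ^ 2) (G.l j) (G.fundSrc f ε j).1
      (G.fundSrc f ε j).2 ∧ (G.fundSrc f ε j).1 0 = 0 ∧ (G.fundSrc f ε j).2 0 = 1 :=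
  fundamentalSolution_spec (G.l_pos j) (by have := hf j; fun_prop)

include hf in
theorem fundTgt_spec (ε : ℝ) (j : J) :
    SolvesLinear (fun y => G.restr f j (G.l j - y) ^ 2 / ε ^ 2) (G.l j) (G.fundTgt f ε j).1
      (G.fundTgt f ε j).2 ∧ (G.fundTgt f ε j).1 0 = 0 ∧ (G.fundTgt f ε j).2 0 = 1 :=
  fundamentalSolution_spec (G.l_pos j) (by have := hf j; fun_prop)

include hf in
theorem le_fundSrc (ε : ℝ) {j : J} {y : ℝ} (hy : y ∈ Icc 0 (G.l j)) :
    y ≤ (G.fundSrc f ε j).1 y := by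
  obtain ⟨h, h0, h1⟩ := G.fundSrc_spec hf ε j
  exact h.le_self_of_fundamental (fun y _ => by positivity) h0 h1 y hy

include hf in
theorem le_fundTgt (ε : ℝ) {j : J} {y : ℝ} (hy : y ∈ Icc 0 (G.l j)) :
    y ≤ (G.fundTgt f ε j).1 y := by
  obtain ⟨h, h0, h1⟩ := G.fundTgt_spec hf ε j
  exact h.le_self_of_fundamental (fun y _ => by positivity) h0 h1 y hy

include hf in
theorem fundSrc_length_pos (ε : ℝ) (j : J) : 0 < (G.fundSrc f ε j).1 (G.l j) :=
  (G.l_pos j).trans_le (G.le_fundSrc hf ε (G.length_mem_Icc j))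

include hf in
theorem fundTgt_length_pos (ε : ℝ) (j : J) : 0 < (G.fundTgt f ε j).1 (G.l j) :=
  (G.l_pos j).trans_le (G.le_fundTgt hf ε (G.length_mem_Icc j))

include hf in
theorem length_le_fundFrom (ε : ℝ) (i : I) (j : J) :
    G.l j ≤ (G.fundFrom f ε i j).1 (G.l j) := by
  unfold fundFrom
  split_ifs
  · exact G.le_fundSrc hf ε (G.length_mem_Icc j)
  · exact G.le_fundTgt hf ε (G.length_mem_Icc j)

include hf hf0 in
theorem fundFrom_lt {ε : ℝ} (hε : 0 < ε) (i : I) (j : J) :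
    (G.fundFrom f ε i j).1 (G.l j) < G.l j * (G.fundFrom f ε i j).2 (G.l j) := by
  unfold fundFrom
  split_ifs
  · obtain ⟨h, h0, h1⟩ := G.fundSrc_spec hf ε j
    exact h.lt_mul_deriv (G.l_pos j) (fun y hy => by
      have := G.restr_pos hf0 hy
      positivity) h0 h1
  · obtain ⟨h, h0, h1⟩ := G.fundTgt_spec hf ε j
    exact h.lt_mul_deriv (G.l_pos j) (fun y hy => by
      have := G.restr_pos hf0 (G.reflect_mem hy)
      positivity) h0 h1

include hf in
theorem transRate_pos (ε : ℝ) (i : I) (j : J) : 0 < G.transRate f ε i j :=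
  one_div_pos.2 ((G.l_pos j).trans_le (G.length_le_fundFrom hf ε i j))

include hf hf0 in
theorem inv_length_lt_exitRate {ε : ℝ} (hε : 0 < ε) (i : I) (j : J) :
    1 / G.l j < G.exitRate f ε i j := by
  have h := G.fundFrom_lt hf hf0 hε (G.other i j) j
  rw [exitRate, div_lt_div_iff₀ (G.l_pos j)
    ((G.l_pos j).trans_le (G.length_le_fundFrom hf ε _ j))]
  linarith

include hf hf0 in
theorem transRate_lt_exitRate {ε : ℝ} (hε : 0 < ε) (i : I) (j : J) :
    G.transRate f ε i j < G.exitRate f ε i j :=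
  (one_div_le_one_div_of_le (G.l_pos j) (G.length_le_fundFrom hf ε i j)).trans_lt
    (G.inv_length_lt_exitRate hf hf0 hε i j)

include hf in
theorem wave_solves (ε : ℝ) (W : I → ℝ) (j : J) :
    SolvesLinear (fun y => G.restr f j y ^ 2 / ε ^ 2) (G.l j) (G.wave f ε W j)
      (G.waveDeriv f ε W j) := by
  have h := (G.fundTgt_spec hf ε j).1.reflect
  simp only [sub_sub_cancel] at h
  convert! h.comb (G.fundSrc_spec hf ε j).1 (W (G.src j) / (G.fundTgt f ε j).1 (G.l j))
    (W (G.tgt j) / (G.fundSrc f ε j).1 (G.l j)) using 1 <;> funext y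
  · unfold wave; ring
  · unfold waveDeriv; ring

include hf in
theorem wave_zero (ε : ℝ) (W : I → ℝ) (j : J) : G.wave f ε W j 0 = W (G.src j) := by
  rw [wave, (G.fundSrc_spec hf ε j).2.1, sub_zero, div_self (G.fundTgt_length_pos hf ε j).ne']
  ring

include hf in
theorem wave_length (ε : ℝ) (W : I → ℝ) (j : J) : G.wave f ε W j (G.l j) = W (G.tgt j) := by
  rw [wave, sub_self, (G.fundTgt_spec hf ε j).2.1, div_self (G.fundSrc_length_pos hf ε j).ne']
  ring

include hf in
theorem wave_vertexParam (ε : ℝ) (W : I → ℝ) {i : I} {j : J} (h : j ∈ G.inc i) :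
    G.wave f ε W j (G.vertexParam i j) = W i := by
  rcases G.inc_cases h with ⟨h1, h2, -⟩ | ⟨h1, h2, -⟩ <;> rw [h2, ← h1]
  · exact G.wave_zero hf ε W j
  · exact G.wave_length hf ε W j

include hf in
-- Of the two fundamental solutions on the edge, the one vanishing at `v_i` has unit inward slope
-- there and carries the opposite value; the other carries the value at `v_i`.
theorem sign_mul_waveDeriv (ε : ℝ) (W : I → ℝ) {i : I} {j : J} (h : j ∈ G.inc i) :
    G.sign i j * G.waveDeriv f ε W j (G.vertexParam i j) =
      G.transRate f ε i j * W (G.other i j) - G.exitRate f ε i j * W i := by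
  unfold transRate exitRate waveDeriv
  rcases G.inc_cases h with ⟨h1, h2, h3, h4⟩ | ⟨h1, h2, h3, h4⟩ <;> rw [h2, h3, h4, ← h1]
  · rw [fundFrom_tgt, fundFrom_src, sub_zero, (G.fundSrc_spec hf ε j).2.2]
    ring
  · rw [fundFrom_tgt, fundFrom_src, sub_self, (G.fundTgt_spec hf ε j).2.2]
    ring

include hf in
theorem wave_pos (ε : ℝ) {W : I → ℝ} (hW : ∀ i, 0 < W i) {j : J} {y : ℝ}
    (hy : y ∈ Icc 0 (G.l j)) : 0 < G.wave f ε W j y := by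
  have hS := G.fundSrc_length_pos hf ε j
  have hT := G.fundTgt_length_pos hf ε j
  have h1 := G.le_fundSrc hf ε hy
  have h2 := G.le_fundTgt hf ε (G.reflect_mem hy)
  rcases hy.2.eq_or_lt with rfl | hlt
  · rw [wave_length _ hf]; exact hW _
  · refine add_pos_of_pos_of_nonneg ?_ ?_
    · exact mul_pos (hW _) (div_pos (by linarith) hT)
    · exact mul_nonneg (hW _).le (div_nonneg (hy.1.trans h1) hS.le)

/-- The discrete equation satisfied by the vertex values of `exp (-u_ε / ε)`. -/
def SolvesVertexSystem (f : G.carrier → ℝ) (β : I → J → ℝ) (ε : ℝ) (B : Set I) (W : I → ℝ) :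
    Prop :=
  (∀ i ∈ B, W i = 1) ∧ ∀ i ∉ B, (∑ j ∈ G.inc i, β i j * G.exitRate f ε i j) * W i =
    ∑ j ∈ G.inc i, β i j * G.transRate f ε i j * W (G.other i j)

include hf in
theorem solvesVertexSystem_flux {β : I → J → ℝ} {ε : ℝ} {W : I → ℝ} {i : I} :
    (∑ j ∈ G.inc i, β i j * G.exitRate f ε i j) * W i =
      ∑ j ∈ G.inc i, β i j * G.transRate f ε i j * W (G.other i j) ↔
    ∑ j ∈ G.inc i, β i j * (G.sign i j * G.waveDeriv f ε W j (G.vertexParam i j)) = 0 := by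
  have e : ∑ j ∈ G.inc i, β i j * (G.sign i j * G.waveDeriv f ε W j (G.vertexParam i j)) =
      ∑ j ∈ G.inc i, β i j * G.transRate f ε i j * W (G.other i j) -
        (∑ j ∈ G.inc i, β i j * G.exitRate f ε i j) * W i := by
    rw [Finset.sum_mul, ← Finset.sum_sub_distrib]
    exact Finset.sum_congr rfl fun j hj => by rw [G.sign_mul_waveDeriv hf ε W hj]; ring
  rw [e, sub_eq_zero, eq_comm]

/-! ### The vertex system and well-posedness of the viscous problem -/

section System

variable {β : I → J → ℝ} {B : Set I} (hβ : ∀ i ∉ B, ∀ j ∈ G.inc i, 0 < β i j)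

include hf hβ in
theorem system_coeff_pos (ε : ℝ) : ∀ i ∉ B, ∀ j ∈ G.inc i, 0 < β i j * G.transRate f ε i j :=
  fun i hi j hj => mul_pos (hβ i hi j hj) (G.transRate_pos hf ε i j)

include hf hf0 hβ in
theorem system_dominant {ε : ℝ} (hε : 0 < ε) : ∀ i ∉ B,
    ∑ j ∈ G.inc i, β i j * G.transRate f ε i j < ∑ j ∈ G.inc i, β i j * G.exitRate f ε i j :=
  fun i hi => Finset.sum_lt_sum_of_nonempty (G.inc_nonempty i) fun j hj =>
    mul_lt_mul_of_pos_left (G.transRate_lt_exitRate hf hf0 hε i j) (hβ i hi j hj)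

include hf in
-- The Hopf–Cole transform of u and the wave solve the same linear equation on the open edge with
-- the same end values, so their difference solves a homogeneous Dirichlet problem.
theorem SolvesViscousEikonal.exp_eq_wave {ε : ℝ} (hε : 0 < ε) {u : G.carrier → ℝ}
    (hu : G.SolvesViscousEikonal B β f ε u) {j : J} {y : ℝ} (hy : y ∈ Icc 0 (G.l j)) :
    Real.exp (-G.restr u j y / ε) =
      G.wave f ε (fun i => Real.exp (-u (G.vertex i) / ε)) j y := by
  set W : I → ℝ := fun i => Real.exp (-u (G.vertex i) / ε)
  have hl := G.l_pos j
  have hC := hasDerivWithinAt_of_contDiffOn_two hl (hu.1.1.2 j)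
  have hw := G.wave_solves hf ε W j
  have key := SolvesLinear.eq_zero (c := fun y => G.restr f j y ^ 2 / ε ^ 2)
    (z := fun y => Real.exp (-G.restr u j y / ε) - G.wave f ε W j y)
    (z' := fun y => Real.exp (-G.restr u j y / ε) * (-G.edgeDeriv 1 j u y / ε) -
      G.waveDeriv f ε W j y)
    (z2 := fun y => (Real.exp (-G.restr u j y / ε) * (-G.edgeDeriv 1 j u y / ε) *
        (-G.edgeDeriv 1 j u y / ε) + Real.exp (-G.restr u j y / ε) * (-G.edgeDeriv 2 j u y / ε)) -
      G.restr f j y ^ 2 / ε ^ 2 * G.wave f ε W j y)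
    hl (fun y _ => by positivity)
    (fun y hy => ((hC y hy).1.neg.div_const ε).exp.sub (hw.hasDeriv y hy))
    (fun y hy => (((hC y hy).1.neg.div_const ε).exp.mul ((hC y hy).2.neg.div_const ε)).sub
      (hw.hasDeriv' y hy))
    (fun y hy => by
      have h := hu.2.1 j y hy
      rw [sq_abs] at h
      have : G.edgeDeriv 2 j u y = (G.edgeDeriv 1 j u y ^ 2 - G.restr f j y ^ 2) / ε := by
        rw [eq_div_iff hε.ne']; linarith
      rw [this]
      field_simp
      ring)
    (by rw [G.wave_zero hf, G.restr_zero]; exact sub_self _)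
    (by rw [G.wave_length hf, G.restr_length]; exact sub_self _) y hy
  exact sub_eq_zero.1 key

include hf in
-- At a vertex each inward derivative of w is -W_i/ε times that of u. This factor is common to all
-- incident edges, so the Kirchhoff sum of w vanishes with that of u.
theorem SolvesViscousEikonal.solvesVertexSystem {ε : ℝ} (hε : 0 < ε) {u : G.carrier → ℝ}
    (hu : G.SolvesViscousEikonal B β f ε u) :
    G.SolvesVertexSystem f β ε B fun i => Real.exp (-u (G.vertex i) / ε) := by
  refine ⟨fun i hi => by simp [hu.2.2 i hi], fun i hi => ?_⟩
  refine (G.solvesVertexSystem_flux hf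
    (W := fun i => Real.exp (-u (G.vertex i) / ε))).2 ?_
  have hk := hu.1.2 i hi
  unfold kirchhoff at hk
  set W : I → ℝ := fun i => Real.exp (-u (G.vertex i) / ε)
  have hder : ∀ j ∈ G.inc i, G.waveDeriv f ε W j (G.vertexParam i j) =
      W i * (-G.edgeDeriv 1 j u (G.vertexParam i j) / ε) := by
    intro j hj
    have ht := G.vertexParam_mem hj
    have h1 := ((hasDerivWithinAt_of_contDiffOn_two (G.l_pos j) (hu.1.1.2 j) _
      ht).1.neg.div_const ε).exp
    have h2 := ((G.wave_solves hf ε W j).hasDeriv _ ht).congr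
      (fun y hy => hu.exp_eq_wave G hf hε hy) (hu.exp_eq_wave G hf hε ht)
    have := (uniqueDiffOn_Icc (G.l_pos j) _ ht).eq_deriv _ h2 h1
    rw [this]
    simp only [Pi.neg_apply, G.restr_vertexParam u hj]
    rfl
  rw [Finset.sum_congr rfl fun j hj => show β i j * (G.sign i j *
      G.waveDeriv f ε W j (G.vertexParam i j)) = -(W i / ε) *
        (β i j * G.sign i j * G.edgeDeriv 1 j u (G.vertexParam i j)) by rw [hder j hj]; ring,
    ← Finset.mul_sum, hk, mul_zero]

include hf hf0 hβ in
theorem SolvesViscousEikonal.unique {ε : ℝ} (hε : 0 < ε) {u w : G.carrier → ℝ}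
    (hu : G.SolvesViscousEikonal B β f ε u) (hw : G.SolvesViscousEikonal B β f ε w) : u = w := by
  have hU := hu.solvesVertexSystem G hf hε
  have hW := hw.solvesVertexSystem G hf hε
  have hUW := G.linear_vertex_unique (G.system_coeff_pos hf hβ ε) (G.system_dominant hf hf0 hβ hε)
    (fun i hi => (hU.1 i hi).trans (hW.1 i hi).symm) hU.2 hW.2
  refine G.ext_restr fun j y hy => ?_
  have h := hu.exp_eq_wave G hf hε hy
  rw [hUW, ← hw.exp_eq_wave G hf hε hy, Real.exp_eq_exp, div_left_inj' hε.ne'] at h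
  exact neg_injective h

include hf hf0 hβ in
-- The transform is inverted by u = -ε log w, which is legitimate because the positive vertex values
-- make the waves positive.
theorem exists_solvesViscousEikonal (hB : B.Nonempty) {ε : ℝ} (hε : 0 < ε) :
    ∃ u, G.SolvesViscousEikonal B β f ε u := by
  have ha := G.system_coeff_pos hf hβ ε
  have hb := G.system_dominant hf hf0 hβ hε
  obtain ⟨W, hW1, hW⟩ := G.exists_linear_vertex ha hb
  have hWpos := G.linear_vertex_pos hB ha hb hW1 hW
  have hpos : ∀ {j : J} {y : ℝ}, y ∈ Icc 0 (G.l j) → 0 < G.wave f ε W j y :=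
    fun hy => G.wave_pos hf ε hWpos hy
  have hsol := G.wave_solves hf ε W
  obtain ⟨u, huc, hur, huv⟩ := G.exists_glue (fun i => -ε * Real.log (W i))
    (fun j y => -ε * Real.log (G.wave f ε W j y))
    (fun j => continuousOn_const.mul ((hsol j).continuousOn.log fun y hy => (hpos hy).ne'))
    (fun j => by rw [G.wave_zero hf]) (fun j => by rw [G.wave_length hf])
  have hd1 : ∀ j, ∀ y ∈ Icc 0 (G.l j), HasDerivWithinAt (G.restr u j)
      (-ε * (G.waveDeriv f ε W j y / G.wave f ε W j y)) (Icc 0 (G.l j)) y := fun j y hy =>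
    ((((hsol j).hasDeriv y hy).log (hpos hy).ne').const_mul (-ε)).congr (hur j) (hur j y hy)
  have hd2 : ∀ j, ∀ y ∈ Icc 0 (G.l j), HasDerivWithinAt
      (fun y => -ε * (G.waveDeriv f ε W j y / G.wave f ε W j y))
      (-ε * ((G.restr f j y ^ 2 / ε ^ 2 * G.wave f ε W j y * G.wave f ε W j y -
        G.waveDeriv f ε W j y * G.waveDeriv f ε W j y) / G.wave f ε W j y ^ 2))
      (Icc 0 (G.l j)) y := fun j y hy =>
    (((hsol j).hasDeriv' y hy).div ((hsol j).hasDeriv y hy) (hpos hy).ne').const_mul (-ε)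
  have hC : ∀ j, _ := fun j => contDiffOn_two_of_hasDerivWithinAt (G.l_pos j) (hd1 j) (hd2 j) (by
    have h1 := (hsol j).continuousOn
    have h2 := (hsol j).continuousOn'
    have h3 := (hf j).continuousOn (s := Icc 0 (G.l j))
    exact continuousOn_const.mul (((((h3.pow 2).div_const _).mul h1).mul h1 |>.sub
      (h2.mul h2)).div (h1.pow 2) fun y hy => pow_ne_zero 2 (hpos hy).ne'))
  refine ⟨u, ⟨⟨huc, fun j => (hC j).1⟩, fun i hi => ?_⟩, fun j y hy => ?_, fun i hi => ?_⟩
  · have h0 := (G.solvesVertexSystem_flux hf (W := W)).1 (hW i hi)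
    have hder : ∀ j ∈ G.inc i, G.edgeDeriv 1 j u (G.vertexParam i j) =
        -ε * (G.waveDeriv f ε W j (G.vertexParam i j) / W i) := fun j hj => by
      rw [edgeDeriv, ((hC j).2 _ (G.vertexParam_mem hj)).1, G.wave_vertexParam hf ε W hj]
    unfold kirchhoff
    rw [Finset.sum_congr rfl fun j hj => show β i j * G.sign i j *
        G.edgeDeriv 1 j u (G.vertexParam i j) = (-ε / W i) *
          (β i j * (G.sign i j * G.waveDeriv f ε W j (G.vertexParam i j))) by
        rw [hder j hj]; ring, ← Finset.mul_sum, h0, mul_zero]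
  · have hyI := Ioo_subset_Icc_self hy
    have hw := (hpos hyI).ne'
    rw [edgeDeriv, edgeDeriv, ((hC j).2 y hyI).1, ((hC j).2 y hyI).2, sq_abs]
    field_simp
    ring
  · rw [huv, hW1 i hi]; simp

end System

end TopologicalNetwork

/-! ### Vanishing viscosity -/

theorem eventually_div_sq_le_exp (K : ℝ) {δ : ℝ} (hδ : 0 < δ) :
    ∀ᶠ ε : ℝ in 𝓝[>] 0, K / ε ^ 2 ≤ Real.exp (δ / ε) := by
  have hx : Tendsto (fun ε : ℝ => δ / ε) (𝓝[>] 0) atTop :=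
    tendsto_inv_nhdsGT_zero.const_mul_atTop hδ
  have h := (Real.tendsto_pow_mul_exp_neg_atTop_nhds_zero 2).comp hx
  have hK : 0 < δ ^ 2 / (|K| + 1) := by positivity
  filter_upwards [h.eventually_lt_const hK, self_mem_nhdsWithin] with ε h1 hε
  have hε : 0 < ε := hε
  simp only [Function.comp_apply] at h1
  rw [Real.exp_neg, ← div_eq_mul_inv, div_lt_iff₀ (Real.exp_pos _), div_pow] at h1
  have h2 : (|K| + 1) / ε ^ 2 ≤ Real.exp (δ / ε) := by
    have h3 := mul_le_mul_of_nonneg_left h1.le (show 0 ≤ (|K| + 1) / δ ^ 2 by positivity)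
    calc (|K| + 1) / ε ^ 2 = (|K| + 1) / δ ^ 2 * (δ ^ 2 / ε ^ 2) := by field_simp
      _ ≤ (|K| + 1) / δ ^ 2 * (δ ^ 2 / (|K| + 1) * Real.exp (δ / ε)) := h3
      _ = Real.exp (δ / ε) := by field_simp
  exact (div_le_div_of_nonneg_right (by linarith [le_abs_self K]) (by positivity)).trans h2

theorem eventually_mem_Ioc {a : ℝ} (ha : 0 < a) : ∀ᶠ ε : ℝ in 𝓝[>] 0, ε ∈ Ioc 0 a :=
  Ioc_mem_nhdsGT ha

theorem eventually_const_le_exp (K : ℝ) {δ : ℝ} (hδ : 0 < δ) :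
    ∀ᶠ ε : ℝ in 𝓝[>] 0, K ≤ Real.exp (δ / ε) := by
  filter_upwards [eventually_div_sq_le_exp |K| hδ, eventually_mem_Ioc one_pos] with ε h hε
  refine (le_abs_self K).trans (le_trans ?_ h)
  have hp := hε.1
  rw [le_div_iff₀ (by positivity)]
  exact mul_le_of_le_one_right (abs_nonneg K) (pow_le_one₀ hp.le hε.2)

theorem SolvesLinear.eventually_exp_bounds {f : ℝ → ℝ} {l α δ : ℝ} (hl : 0 < l)
    (hf : Continuous f) (hα : 0 < α) (hfα : ∀ y ∈ Icc 0 l, α ≤ f y) (hδ : 0 < δ) :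
    ∀ᶠ ε : ℝ in 𝓝[>] 0, ∀ z z', SolvesLinear (fun y => f y ^ 2 / ε ^ 2) l z z' →
      z 0 = 0 → z' 0 = 1 → ∀ y ∈ Icc 0 l,
        z y ≤ Real.exp (((∫ t in (0 : ℝ)..y, f t) + δ) / ε) ∧
        y * Real.exp (((∫ t in (0 : ℝ)..y, f t) - δ) / ε) ≤ z y := by
  obtain ⟨K, hK, h⟩ := SolvesLinear.exists_exp_bounds hl hf hα hfα (half_pos hδ)
  filter_upwards [eventually_const_le_exp K (half_pos hδ), eventually_div_sq_le_exp K (half_pos hδ),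
    eventually_mem_Ioc one_pos] with ε h1 h2 hε z z' hz h0 h0' y hy
  obtain ⟨ha, hb⟩ := h ε hε.1 hε.2 z z' hz h0 h0' y hy
  have hz0 := hz.nonneg_of_fundamental (fun y _ => by positivity) h0 h0' y hy
  constructor
  · refine ha.trans ((mul_le_mul_of_nonneg_right h1 (Real.exp_pos _).le).trans_eq ?_)
    rw [← Real.exp_add]
    congr 1
    ring
  · have h3 := hb.trans (mul_le_mul_of_nonneg_right h2 hz0)
    have e : ((∫ t in (0 : ℝ)..y, f t) - δ / 2) / ε =
        ((∫ t in (0 : ℝ)..y, f t) - δ) / ε + δ / 2 / ε := by ring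
    rw [e, Real.exp_add, ← mul_assoc, mul_comm (Real.exp (δ / 2 / ε))] at h3
    exact le_of_mul_le_mul_right h3 (Real.exp_pos _)

/-! ### Exponential asymptotics of the vertex system -/

namespace TopologicalNetwork

variable {n : ℕ} {I J : Type*} [Fintype I] [Fintype J] (G : TopologicalNetwork n I J)
variable {f : G.carrier → ℝ} (hf : ∀ j, Continuous (G.restr f j)) {α : ℝ} (hα : 0 < α)
  (hfα : ∀ x, α ≤ f x)

include hf in
theorem exists_restr_bound : ∃ M > 0, ∀ j, ∀ y ∈ Icc 0 (G.l j), G.restr f j y ≤ M := by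
  have : ∀ j, ∃ M, ∀ y ∈ Icc 0 (G.l j), G.restr f j y ≤ M := fun j => by
    obtain ⟨C, hC⟩ := isCompact_Icc.exists_bound_of_continuousOn (hf j).continuousOn
    exact ⟨C, fun y hy => (le_abs_self _).trans (hC y hy)⟩
  choose M hM using this
  obtain ⟨C, hC⟩ := (finite_range M).bddAbove
  exact ⟨max 1 C, by positivity, fun j y hy =>
    ((hM j y hy).trans (hC (mem_range_self j))).trans (le_max_right _ _)⟩

include hf in
theorem integral_reflect_eq (j : J) (y : ℝ) :
    ∫ t in (0 : ℝ)..y, G.restr f j (G.l j - t) = G.edgeLen f j - G.len f j (G.l j - y) :=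
  integral_reflect (hf j) (G.l j) y

include hf in
theorem len_sub_le {M : ℝ} {j : J} (hM : ∀ y ∈ Icc 0 (G.l j), G.restr f j y ≤ M) {a b : ℝ}
    (ha : a ∈ Icc 0 (G.l j)) (hb : b ∈ Icc 0 (G.l j)) (hab : a ≤ b) :
    G.len f j b - G.len f j a ≤ M * (b - a) := by
  have : MonotoneOn (fun y => M * y - G.len f j y) (Icc 0 (G.l j)) :=
    monotoneOn_of_hasDerivWithinAt_nonneg (convex_Icc _ _)
      ((continuous_const.mul continuous_id).sub (G.continuous_len hf j)).continuousOn
      (fun y _ => (((hasDerivAt_id y).const_mul M).sub (G.hasDerivAt_len hf j y)).hasDerivWithinAt)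
      (fun y hy => by linarith [hM y (interior_subset hy)])
  have := this ha hb hab
  simp only at this
  linarith

include hf hα hfα in
/-- The solutions on the edges are exponentials of the weighted length, to leading order. -/
theorem eventually_fund_bounds {δ : ℝ} (hδ : 0 < δ) : ∀ᶠ ε : ℝ in 𝓝[>] 0, ∀ j,
    ∀ y ∈ Icc 0 (G.l j),
      ((G.fundSrc f ε j).1 y ≤ Real.exp ((G.len f j y + δ) / ε) ∧
        y * Real.exp ((G.len f j y - δ) / ε) ≤ (G.fundSrc f ε j).1 y) ∧
      ((G.fundTgt f ε j).1 (G.l j - y) ≤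
          Real.exp ((G.edgeLen f j - G.len f j y + δ) / ε) ∧
        (G.l j - y) * Real.exp ((G.edgeLen f j - G.len f j y - δ) / ε) ≤
          (G.fundTgt f ε j).1 (G.l j - y)) := by
  have hfα' : ∀ j, ∀ y ∈ Icc 0 (G.l j), α ≤ G.restr f j y := fun j y hy => by
    rw [restr_of_mem _ _ hy]; exact hfα _
  refine eventually_all.2 fun j => ?_
  have hr : Continuous fun y => G.restr f j (G.l j - y) := by have := hf j; fun_prop
  filter_upwards [SolvesLinear.eventually_exp_bounds (G.l_pos j) (hf j) hα (hfα' j) hδ,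
    SolvesLinear.eventually_exp_bounds (G.l_pos j) hr hα
      (fun y hy => hfα' j _ (G.reflect_mem hy)) hδ] with ε h1 h2 y hy
  obtain ⟨a, b, c⟩ := G.fundSrc_spec hf ε j
  obtain ⟨a', b', c'⟩ := G.fundTgt_spec hf ε j
  refine ⟨h1 _ _ a b c y hy, ?_⟩
  have := h2 _ _ a' b' c' _ (G.reflect_mem hy)
  rwa [integral_reflect_eq _ hf, sub_sub_cancel] at this

include hf hα hfα in
theorem eventually_fundFrom_bounds {δ : ℝ} (hδ : 0 < δ) : ∀ᶠ ε : ℝ in 𝓝[>] 0, ∀ i j,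
    (G.fundFrom f ε i j).1 (G.l j) ≤ Real.exp ((G.edgeLen f j + δ) / ε) ∧
      G.l j * Real.exp ((G.edgeLen f j - δ) / ε) ≤ (G.fundFrom f ε i j).1 (G.l j) := by
  filter_upwards [G.eventually_fund_bounds hf hα hfα hδ] with ε h i j
  unfold fundFrom
  split_ifs
  · exact (h j _ (G.length_mem_Icc j)).1
  · have := (h j _ (G.zero_mem_Icc j)).2
    simpa only [sub_zero, len_zero] using this

include hf in
-- The diagonal coefficients grow at most like a power of 1/ε, so they do not contribute on the
-- exponential scale.
theorem exists_exitRate_le (hf0 : ∀ x, 0 < f x) : ∃ C > 0, ∀ ε : ℝ, 0 < ε → ε ≤ 1 → ∀ i j,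
    G.exitRate f ε i j ≤ C / ε ^ 2 := by
  obtain ⟨M, hM0, hM⟩ := G.exists_restr_bound hf
  obtain ⟨C, hC⟩ := (finite_range fun j => 1 / G.l j + M ^ 2 * G.l j).bddAbove
  refine ⟨max 1 C, by positivity, fun ε hε hε1 i j => ?_⟩
  have hl := G.l_pos j
  have hbound : ∀ y, 0 ≤ G.restr f j y ^ 2 / ε ^ 2 := fun y => by positivity
  have hsq : ∀ y, 0 ≤ G.restr f j y → G.restr f j y ≤ M →
      G.restr f j y ^ 2 / ε ^ 2 ≤ M ^ 2 / ε ^ 2 := fun y h0 h =>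
    div_le_div_of_nonneg_right (pow_le_pow_left₀ h0 h 2) (by positivity)
  have key : ∀ i, (G.fundFrom f ε i j).2 (G.l j) ≤
      1 + M ^ 2 / ε ^ 2 * (G.l j * (G.fundFrom f ε i j).1 (G.l j)) := by
    intro i
    unfold fundFrom
    split_ifs
    · obtain ⟨h, h0, h1⟩ := G.fundSrc_spec hf ε j
      exact h.deriv_le_of_le (fun y _ => hbound _)
        (fun y hy => hsq y (G.restr_pos hf0 hy).le (hM j y hy)) h0 h1 _ (G.length_mem_Icc j)
    · obtain ⟨h, h0, h1⟩ := G.fundTgt_spec hf ε j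
      exact h.deriv_le_of_le (fun y _ => hbound _)
        (fun y hy => hsq _ (G.restr_pos hf0 (G.reflect_mem hy)).le (hM j _ (G.reflect_mem hy)))
        h0 h1 _ (G.length_mem_Icc j)
  have hS := G.length_le_fundFrom hf ε (G.other i j) j
  have hSpos := hl.trans_le hS
  unfold exitRate
  rw [div_le_iff₀ hSpos]
  have e1 : 1 ≤ 1 / G.l j / ε ^ 2 * (G.fundFrom f ε (G.other i j) j).1 (G.l j) := by
    rw [div_div, one_div_mul_eq_div, one_le_div (by positivity)]
    exact (mul_le_of_le_one_right hl.le (pow_le_one₀ hε.le hε1)).trans hS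
  calc _ ≤ 1 + M ^ 2 / ε ^ 2 * (G.l j * (G.fundFrom f ε (G.other i j) j).1 (G.l j)) := key _
    _ ≤ (1 / G.l j + M ^ 2 * G.l j) / ε ^ 2 * (G.fundFrom f ε (G.other i j) j).1 (G.l j) := by
      rw [add_div, add_mul]
      refine add_le_add e1 (le_of_eq ?_)
      ring
    _ ≤ _ := by
      have := (hC (mem_range_self j)).trans (le_max_right 1 C)
      gcongr

variable {β : I → J → ℝ} {B : Set I} (hβ : ∀ i ∉ B, ∀ j ∈ G.inc i, 0 < β i j)
  {uε : ℝ → G.carrier → ℝ} (huε : ∀ ε : ℝ, 0 < ε → G.SolvesViscousEikonal B β f ε (uε ε))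

include hf hα hfα hβ huε in
-- All terms on the right of the vertex equation are nonnegative, so the one for j alone is at most
-- the diagonal term. The transition rate is about exp(-L_j/ε); the other factors are absorbed in δ
-- after taking logarithms.
theorem eventually_vertex_le {δ : ℝ} (hδ : 0 < δ) : ∀ᶠ ε : ℝ in 𝓝[>] 0, ∀ i, i ∉ B →
    ∀ j, j ∈ G.inc i →
      uε ε (G.vertex i) ≤ uε ε (G.vertex (G.other i j)) + (G.edgeLen f j + δ) := by
  have hf0 : ∀ x, 0 < f x := fun x => hα.trans_le (hfα x)
  obtain ⟨C, hC0, hC⟩ := G.exists_exitRate_le hf hf0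
  refine eventually_all.2 fun i => ?_
  by_cases hi : i ∈ B
  · exact Eventually.of_forall fun ε h => absurd hi h
  refine Eventually.mono (eventually_all.2 fun j => ?_) (fun ε h _ => h)
  by_cases hj : j ∈ G.inc i
  swap
  · exact Eventually.of_forall fun ε h => absurd h hj
  have hβj := hβ i hi j hj
  filter_upwards [G.eventually_fundFrom_bounds hf hα hfα (half_pos hδ),
    eventually_div_sq_le_exp ((∑ k ∈ G.inc i, β i k) * C / β i j) (half_pos hδ),
    eventually_mem_Ioc one_pos] with ε hS hK hε _
  have hsys := ((huε ε hε.1).solvesVertexSystem G hf hε.1).2 i hi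
  beta_reduce at hsys
  set Wi := Real.exp (-uε ε (G.vertex i) / ε)
  set Wo := Real.exp (-uε ε (G.vertex (G.other i j)) / ε)
  set S := (G.fundFrom f ε i j).1 (G.l j)
  have hSpos : 0 < S := (G.l_pos j).trans_le (G.length_le_fundFrom hf ε i j)
  have hWi : 0 < Wi := Real.exp_pos _
  have h1 : β i j * G.transRate f ε i j * Wo ≤ (∑ k ∈ G.inc i, β i k * G.exitRate f ε i k) * Wi := by
    rw [hsys]
    exact Finset.single_le_sum (f := fun j => β i j * G.transRate f ε i j *
      Real.exp (-uε ε (G.vertex (G.other i j)) / ε)) (fun k hk =>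
        mul_nonneg (G.system_coeff_pos hf hβ ε i hi k hk).le (Real.exp_pos _).le) hj
  have h2 : ∑ k ∈ G.inc i, β i k * G.exitRate f ε i k ≤
      (∑ k ∈ G.inc i, β i k) * (C / ε ^ 2) := by
    rw [Finset.sum_mul]
    exact Finset.sum_le_sum fun k hk =>
      mul_le_mul_of_nonneg_left (hC ε hε.1 hε.2 i k) (hβ i hi k hk).le
  have h3 : Wo ≤ ((∑ k ∈ G.inc i, β i k) * C / β i j / ε ^ 2) * S * Wi := by
    have h4 := h1.trans (mul_le_mul_of_nonneg_right h2 hWi.le)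
    have h5 := mul_le_mul_of_nonneg_left h4 (show 0 ≤ S / β i j by positivity)
    have e1 : S / β i j * (β i j * G.transRate f ε i j * Wo) = Wo := by
      change S / β i j * (β i j * (1 / S) * Wo) = Wo
      field_simp
    rw [e1] at h5
    refine h5.trans_eq ?_
    ring
  have h6 : Wo ≤ Real.exp (δ / 2 / ε) * Real.exp ((G.edgeLen f j + δ / 2) / ε) * Wi := by
    refine h3.trans (mul_le_mul_of_nonneg_right ?_ hWi.le)
    exact mul_le_mul hK (hS i j).1 hSpos.le (Real.exp_pos _).le
  rw [← Real.exp_add, ← Real.exp_add, Real.exp_le_exp, ← add_div, ← add_div,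
    div_le_div_iff_of_pos_right hε.1] at h6
  linarith

include hf hα hfα hβ huε in
-- The sum in the vertex equation is at most the number of terms times the largest one, and the
-- diagonal is at least β/l for the edge attaining it. That edge is the one sought; it may depend on
-- ε.
theorem eventually_vertex_ge {δ : ℝ} (hδ : 0 < δ) : ∀ᶠ ε : ℝ in 𝓝[>] 0, ∀ i, i ∉ B →
    ∃ j ∈ G.inc i,
      uε ε (G.vertex (G.other i j)) + (G.edgeLen f j - δ) ≤ uε ε (G.vertex i) := by
  have hf0 : ∀ x, 0 < f x := fun x => hα.trans_le (hfα x)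
  refine eventually_all.2 fun i => ?_
  by_cases hi : i ∈ B
  · exact Eventually.of_forall fun ε h => absurd hi h
  filter_upwards [G.eventually_fundFrom_bounds hf hα hfα (half_pos hδ),
    eventually_const_le_exp ((G.inc i).card : ℝ) (half_pos hδ),
    eventually_mem_Ioc one_pos] with ε hS hK hε _
  have hsys := ((huε ε hε.1).solvesVertexSystem G hf hε.1).2 i hi
  beta_reduce at hsys
  obtain ⟨j, hj, hmax⟩ := (G.inc i).exists_max_image (fun j => β i j * G.transRate f ε i j *
      Real.exp (-uε ε (G.vertex (G.other i j)) / ε)) (G.inc_nonempty i)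
  refine ⟨j, hj, ?_⟩
  have h1 := Finset.sum_le_card_nsmul _ _ _ hmax
  rw [← hsys, nsmul_eq_mul] at h1
  set Wi := Real.exp (-uε ε (G.vertex i) / ε)
  set Wo := Real.exp (-uε ε (G.vertex (G.other i j)) / ε)
  set S := (G.fundFrom f ε i j).1 (G.l j)
  have hSpos : 0 < S := (G.l_pos j).trans_le (G.length_le_fundFrom hf ε i j)
  have hWi : 0 < Wi := Real.exp_pos _
  have hWo : 0 < Wo := Real.exp_pos _
  have hβj := hβ i hi j hj
  have hl := G.l_pos j
  have h2 : β i j * (1 / G.l j) ≤ ∑ k ∈ G.inc i, β i k * G.exitRate f ε i k :=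
    (mul_le_mul_of_nonneg_left (G.inv_length_lt_exitRate hf hf0 hε.1 i j).le hβj.le).trans
      (Finset.single_le_sum (f := fun k => β i k * G.exitRate f ε i k) (fun k hk =>
        mul_nonneg (hβ i hi k hk).le ((one_div_pos.2 (G.l_pos k)).trans
          (G.inv_length_lt_exitRate hf hf0 hε.1 i k)).le) hj)
  have h3 := (mul_le_mul_of_nonneg_right h2 hWi.le).trans h1
  have h4 : S * Wi ≤ G.l j * ((G.inc i).card * Wo) := by
    have h5 := mul_le_mul_of_nonneg_left h3 (show 0 ≤ S * G.l j / β i j by positivity)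
    have e1 : S * G.l j / β i j * (β i j * (1 / G.l j) * Wi) = S * Wi := by field_simp
    have e2 : S * G.l j / β i j * ((G.inc i).card * (β i j * G.transRate f ε i j * Wo)) =
        G.l j * ((G.inc i).card * Wo) := by
      change S * G.l j / β i j * ((G.inc i).card * (β i j * (1 / S) * Wo)) = _
      field_simp
    rwa [e1, e2] at h5
  have h6 : Real.exp ((G.edgeLen f j - δ / 2) / ε) * Wi ≤ Real.exp (δ / 2 / ε) * Wo := by
    have h7 := (mul_le_mul_of_nonneg_right (hS i j).2 hWi.le).trans h4
    rw [mul_assoc] at h7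
    exact (le_of_mul_le_mul_left h7 hl).trans (mul_le_mul_of_nonneg_right hK hWo.le)
  rw [← Real.exp_add, ← Real.exp_add, Real.exp_le_exp, ← add_div, ← add_div,
    div_le_div_iff_of_pos_right hε.1] at h6
  linarith

include hf hα hfα hβ huε in
theorem eventually_vertex_close {u : G.carrier → ℝ} (hu : G.SolvesEikonal B f u) {η : ℝ}
    (hη : 0 < η) : ∀ᶠ ε : ℝ in 𝓝[>] 0, ∀ i, |uε ε (G.vertex i) - u (G.vertex i)| ≤ η := by
  have hf0 : ∀ x, 0 < f x := fun x => hα.trans_le (hfα x)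
  have hL := G.edgeLen_pos hf hf0
  obtain ⟨lam, hlam, hlamL⟩ : ∃ lam > 0, ∀ j, lam ≤ G.edgeLen f j := by
    rcases isEmpty_or_nonempty J with h | h
    · exact ⟨1, one_pos, fun j => isEmptyElim j⟩
    · obtain ⟨j, hj⟩ := Finite.exists_min (G.edgeLen f)
      exact ⟨_, hL j, hj⟩
  obtain ⟨R, hR, hRu⟩ : ∃ R > 0, ∀ i, |u (G.vertex i)| ≤ R := by
    obtain ⟨C, hC⟩ := (finite_range fun i => |u (G.vertex i)|).bddAbove
    exact ⟨max 1 C, by positivity, fun i => (hC (mem_range_self i)).trans (le_max_right _ _)⟩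
  -- Scaling u by 1 ± κ scales the lengths, which absorbs an error κ·lam in each edge length and
  -- moves the vertex values by at most η. The bound κ ≤ 1/2 keeps the shortened lengths positive.
  set κ : ℝ := min (1 / 2) (η / R)
  have hκ : 0 < κ := by positivity
  have hκ1 : κ ≤ 1 / 2 := min_le_left _ _
  have hκR : κ * R ≤ η := by
    have : κ ≤ η / R := min_le_right _ _
    rwa [le_div_iff₀ hR] at this
  have hκu : ∀ i, |κ * u (G.vertex i)| ≤ η := fun i => by
    rw [abs_mul, abs_of_pos hκ]
    exact (mul_le_mul_of_nonneg_left (hRu i) hκ.le).trans hκR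
  have hκL : ∀ j, κ * lam ≤ κ * G.edgeLen f j := fun j => mul_le_mul_of_nonneg_left (hlamL j) hκ.le
  have hδ : 0 < κ * lam := mul_pos hκ hlam
  filter_upwards [G.eventually_vertex_le hf hα hfα hβ huε hδ,
    G.eventually_vertex_ge hf hα hfα hβ huε hδ, self_mem_nhdsWithin] with ε hle hge hε i
  have hbd := (huε ε hε).2.2
  have up := G.vertex_comparison (B := B) (ℓ := fun j => G.edgeLen f j + κ * lam)
    (fun j => add_pos (hL j) hδ) (P := fun i => uε ε (G.vertex i))
    (Q := fun i => u (G.vertex i) + κ * u (G.vertex i)) hle (fun i hi => by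
      obtain ⟨j, hj, h⟩ := hu.exists_vertex_ge hf hf0 hi
      refine ⟨j, hj, ?_⟩
      have := mul_le_mul_of_nonneg_left h hκ.le
      linarith [hκL j]) (fun i hi => by rw [hbd i hi, hu.2 i hi]; simp) i
  have lo := G.vertex_comparison (B := B) (ℓ := fun j => G.edgeLen f j - κ * lam)
    (fun j => by nlinarith [hlamL j]) (Q := fun i => uε ε (G.vertex i))
    (P := fun i => u (G.vertex i) - κ * u (G.vertex i)) (fun i hi j hj => by
      have h := hu.vertex_le hf hf0 hj
      have := mul_le_mul_of_nonneg_left h (show 0 ≤ 1 - κ by linarith)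
      linarith [hκL j]) hge (fun i hi => by rw [hbd i hi, hu.2 i hi]; simp) i
  have := abs_le.1 (hκu i)
  exact abs_le.2 ⟨by linarith, by linarith⟩

end TopologicalNetwork

/-! ### Asymptotics inside the edges and uniform convergence -/

namespace TopologicalNetwork

variable {n : ℕ} {I J : Type*} [Fintype I] [Fintype J] (G : TopologicalNetwork n I J)
variable {f : G.carrier → ℝ} (hf : ∀ j, Continuous (G.restr f j)) {α : ℝ} (hα : 0 < α)
  (hfα : ∀ x, α ≤ f x)

theorem sub_le_of_wave_le {x m δ ε K : ℝ} (hε : 0 < ε) (hK : K ≤ Real.exp (δ / ε))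
    (h : Real.exp (-x / ε) ≤ K * Real.exp (-m / ε)) : m - δ ≤ x := by
  have h1 := h.trans (mul_le_mul_of_nonneg_right hK (Real.exp_pos _).le)
  rw [← Real.exp_add, Real.exp_le_exp, ← add_div, div_le_div_iff_of_pos_right hε] at h1
  linarith

theorem le_add_of_le_wave {x m δ ε K : ℝ} (hε : 0 < ε) (hK : 1 ≤ K * Real.exp (δ / ε))
    (h : K * Real.exp (-m / ε) ≤ Real.exp (-x / ε)) : x ≤ m + δ := by
  have h1 := (mul_le_mul_of_nonneg_right hK (Real.exp_pos (-m / ε)).le)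
  have h2 := mul_le_mul_of_nonneg_right h (Real.exp_pos (δ / ε)).le
  have h3 : Real.exp (-m / ε) ≤ Real.exp (-x / ε) * Real.exp (δ / ε) := by
    calc _ = 1 * Real.exp (-m / ε) := (one_mul _).symm
      _ ≤ K * Real.exp (δ / ε) * Real.exp (-m / ε) := h1
      _ = K * Real.exp (-m / ε) * Real.exp (δ / ε) := by ring
      _ ≤ _ := h2
  rw [← Real.exp_add, Real.exp_le_exp, ← add_div, div_le_div_iff_of_pos_right hε] at h3
  linarith

/-- A quotient of two solutions that are known to leading exponential order. -/
theorem div_exp_bounds {p q l t a b δ ε : ℝ} (hl : 0 < l) (ht : 0 ≤ t) (hq : 0 < q)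
    (hp1 : p ≤ Real.exp ((a + δ) / ε)) (hp2 : t * Real.exp ((a - δ) / ε) ≤ p)
    (hq1 : q ≤ Real.exp ((b + δ) / ε)) (hq2 : l * Real.exp ((b - δ) / ε) ≤ q) :
    p / q ≤ 1 / l * Real.exp (-(b - a - 2 * δ) / ε) ∧
      t * Real.exp (-(b - a + 2 * δ) / ε) ≤ p / q := by
  have e1 : -(b - a - 2 * δ) / ε = (a + δ) / ε - (b - δ) / ε := by ring
  have e2 : -(b - a + 2 * δ) / ε = (a - δ) / ε - (b + δ) / ε := by ring
  rw [e1, e2, Real.exp_sub, Real.exp_sub]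
  constructor
  · calc p / q ≤ Real.exp ((a + δ) / ε) / (l * Real.exp ((b - δ) / ε)) :=
        div_le_div₀ (Real.exp_pos _).le hp1 (mul_pos hl (Real.exp_pos _)) hq2
      _ = _ := by field_simp
  · rw [← mul_div_assoc]
    exact div_le_div₀ ((mul_nonneg ht (Real.exp_pos _).le).trans hp2) hp2 hq hq1

include hf hα hfα in
/-- On an edge, the solution of the viscous problem is close to the minimum of the two eikonal
profiles started at the end-points. -/
theorem eventually_edge_close {β : I → J → ℝ} {B : Set I} {uε : ℝ → G.carrier → ℝ}
    (huε : ∀ ε : ℝ, 0 < ε → G.SolvesViscousEikonal B β f ε (uε ε)) {δ : ℝ} (hδ : 0 < δ) (j : J) :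
    ∀ᶠ ε : ℝ in 𝓝[>] 0, ∀ y ∈ Icc 0 (G.l j),
      min (uε ε (G.vertex (G.src j)) + G.len f j y)
        (uε ε (G.vertex (G.tgt j)) + (G.edgeLen f j - G.len f j y)) - δ ≤ G.restr (uε ε) j y ∧
      (ε ≤ G.l j - y →
        G.restr (uε ε) j y ≤ uε ε (G.vertex (G.src j)) + G.len f j y + δ) ∧
      (ε ≤ y → G.restr (uε ε) j y ≤
        uε ε (G.vertex (G.tgt j)) + (G.edgeLen f j - G.len f j y) + δ) := by
  have hδ3 : 0 < δ / 3 := by positivity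
  have hl := G.l_pos j
  filter_upwards [G.eventually_fund_bounds hf hα hfα hδ3,
    eventually_const_le_exp (2 / G.l j) hδ3, eventually_div_sq_le_exp 1 hδ3,
    eventually_mem_Ioc one_pos] with ε hB h2l h1 hε y hy
  have hεp := hε.1
  -- The lower exponential bounds carry the factors y and l - y, which vanish at an end. Where the
  -- relevant factor is at least ε, this inequality makes it cost only δ/3; the quotient costs the
  -- other 2δ/3.
  have hε' : 1 ≤ ε * Real.exp (δ / 3 / ε) := by
    have : 1 / ε ≤ 1 / ε ^ 2 := one_div_le_one_div_of_le (by positivity)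
      (by nlinarith [hε.2])
    have := this.trans h1
    rw [div_le_iff₀ hεp] at this
    linarith
  have hw := (huε ε hεp).exp_eq_wave G hf hεp hy
  unfold wave at hw
  obtain ⟨⟨s1, s2⟩, t1, t2⟩ := hB j y hy
  obtain ⟨⟨s3, s4⟩, -⟩ := hB j _ (G.length_mem_Icc j)
  obtain ⟨-, t3, t4⟩ := hB j _ (G.zero_mem_Icc j)
  simp only [sub_zero, len_zero] at t3 t4
  have hS := div_exp_bounds hl hy.1 (G.fundSrc_length_pos hf ε j) s1 s2 s3 s4
  have hT := div_exp_bounds hl (sub_nonneg.2 hy.2) (G.fundTgt_length_pos hf ε j) t1 t2 t3 t4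
  change _ ≤ 1 / G.l j * Real.exp (-(G.edgeLen f j - _ - _) / ε) ∧
    _ * Real.exp (-(G.edgeLen f j - _ + _) / ε) ≤ _ at hS
  set p := (G.fundSrc f ε j).1 y / (G.fundSrc f ε j).1 (G.l j)
  set q := (G.fundTgt f ε j).1 (G.l j - y) / (G.fundTgt f ε j).1 (G.l j)
  set us := uε ε (G.vertex (G.src j))
  set ut := uε ε (G.vertex (G.tgt j))
  have hp0 : 0 ≤ p := (mul_nonneg hy.1 (Real.exp_pos _).le).trans hS.2
  have hq0 : 0 ≤ q := (mul_nonneg (sub_nonneg.2 hy.2) (Real.exp_pos _).le).trans hT.2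
  have hs := Real.exp_pos (-us / ε)
  have ht := Real.exp_pos (-ut / ε)
  refine ⟨?_, fun hyl => ?_, fun hyl => ?_⟩
  · set m := min (us + G.len f j y) (ut + (G.edgeLen f j - G.len f j y))
    have hm1 : m ≤ us + G.len f j y := min_le_left _ _
    have hm2 : m ≤ ut + (G.edgeLen f j - G.len f j y) := min_le_right _ _
    have := sub_le_of_wave_le (x := G.restr (uε ε) j y) (m := m - 2 * (δ / 3)) hεp h2l ?_
    · linarith
    rw [hw]
    -- Both terms of the wave are bounded by the exponential belonging to the smaller profile, so
    -- their sum has the prefactor 2/l absorbed by `h2l`.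
    have a1 : Real.exp (-us / ε) * q ≤ 1 / G.l j * Real.exp (-(m - 2 * (δ / 3)) / ε) := by
      refine (mul_le_mul_of_nonneg_left hT.1 hs.le).trans ?_
      rw [mul_left_comm, ← Real.exp_add, ← add_div]
      refine mul_le_mul_of_nonneg_left (Real.exp_le_exp.2 ?_) (by positivity)
      exact div_le_div_of_nonneg_right (by linarith) hεp.le
    have a2 : Real.exp (-ut / ε) * p ≤ 1 / G.l j * Real.exp (-(m - 2 * (δ / 3)) / ε) := by
      refine (mul_le_mul_of_nonneg_left hS.1 ht.le).trans ?_
      rw [mul_left_comm, ← Real.exp_add, ← add_div]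
      refine mul_le_mul_of_nonneg_left (Real.exp_le_exp.2 ?_) (by positivity)
      exact div_le_div_of_nonneg_right (by linarith) hεp.le
    refine (add_le_add a1 a2).trans_eq ?_
    ring
  · have := le_add_of_le_wave (x := G.restr (uε ε) j y)
      (m := us + G.len f j y + 2 * (δ / 3)) hεp hε' ?_
    · linarith
    rw [hw]
    refine le_trans ?_ (le_add_of_nonneg_right (mul_nonneg ht.le hp0))
    have a1 := mul_le_mul_of_nonneg_left ((mul_le_mul_of_nonneg_right hyl
      (Real.exp_pos _).le).trans hT.2) hs.le
    refine le_trans (le_of_eq ?_) a1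
    rw [mul_left_comm, ← Real.exp_add, ← add_div]
    congr 3
    ring
  · have := le_add_of_le_wave (x := G.restr (uε ε) j y)
      (m := ut + (G.edgeLen f j - G.len f j y) + 2 * (δ / 3)) hεp hε' ?_
    · linarith
    rw [hw]
    refine le_trans ?_ (le_add_of_nonneg_left (mul_nonneg hs.le hq0))
    have a1 := mul_le_mul_of_nonneg_left ((mul_le_mul_of_nonneg_right hyl
      (Real.exp_pos _).le).trans hS.2) ht.le
    refine le_trans (le_of_eq ?_) a1
    rw [mul_left_comm, ← Real.exp_add, ← add_div]
    congr 3
    ring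

include hf hα hfα in
/-- Vanishing viscosity: the solutions of the viscous problems converge uniformly. -/
theorem tendstoUniformly_of_solves {β : I → J → ℝ} {B : Set I}
    (hβ : ∀ i ∉ B, ∀ j ∈ G.inc i, 0 < β i j) {u : G.carrier → ℝ} {uε : ℝ → G.carrier → ℝ}
    (hu : G.SolvesEikonal B f u)
    (huε : ∀ ε : ℝ, 0 < ε → G.SolvesViscousEikonal B β f ε (uε ε)) :
    TendstoUniformly uε u (𝓝[>] 0) := by
  have hf0 : ∀ x, 0 < f x := fun x => hα.trans_le (hfα x)
  rw [Metric.tendstoUniformly_iff]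
  intro η hη
  set δ : ℝ := η / 5
  have hδ : 0 < δ := by positivity
  obtain ⟨M, hM0, hM⟩ := G.exists_restr_bound hf
  have hsmall : ∀ j, ∀ᶠ ε : ℝ in 𝓝[>] 0, ε ≤ G.l j / 2 := fun j =>
    (eventually_mem_Ioc (half_pos (G.l_pos j))).mono fun ε h => h.2
  filter_upwards [G.eventually_vertex_close hf hα hfα hβ huε hu hδ,
    eventually_all.2 fun j => G.eventually_edge_close hf hα hfα huε hδ j,
    eventually_all.2 hsmall, eventually_mem_Ioc (div_pos hδ hM0)] with ε hv he hl hε x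
  obtain ⟨j, ⟨y, hy⟩, rfl⟩ := G.exists_point x
  rw [← G.restr_apply u, ← G.restr_apply (uε ε), Real.dist_eq, abs_sub_comm]
  change |G.restr (uε ε) j y - G.restr u j y| < η
  obtain ⟨h1, h2, h3⟩ := he j y hy
  have hs := abs_le.1 (hv (G.src j))
  have ht := abs_le.1 (hv (G.tgt j))
  have hMε : M * ε ≤ δ := by
    have := hε.2
    rwa [le_div_iff₀ hM0, mul_comm] at this
  have h0y := abs_le.1 (hu.abs_sub_le hf hf0 le_rfl hy.1 hy.2)
  have hyl := abs_le.1 (hu.abs_sub_le hf hf0 hy.1 hy.2 le_rfl)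
  rw [restr_zero, len_zero] at h0y
  rw [restr_length] at hyl
  have eL : G.len f j (G.l j) = G.edgeLen f j := rfl
  rw [eL] at hyl
  have hF := G.len_sub_le hf (hM j) (G.zero_mem_Icc j) hy hy.1
  have hF' := G.len_sub_le hf (hM j) hy (G.length_mem_Icc j) hy.2
  rw [len_zero] at hF
  rw [eL] at hF'
  have heq := hu.restr_eq hf hf0 hy
  have hup : G.restr (uε ε) j y ≤ G.restr u j y + 4 * δ := by
    -- Away from both ends the two upper bounds combine into the minimum. Within ε of an end only
    -- the bound from that end is available, but there u and the optical length vary by at most M ε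
    -- ≤ δ. Since ε ≤ l/2, the two end zones do not interfere.
    by_cases c1 : ε ≤ G.l j - y
    · have a1 := h2 c1
      by_cases c2 : ε ≤ y
      · have a2 := h3 c2
        rw [heq, ← min_add_add_right]
        exact le_min (by linarith) (by linarith)
      · have := mul_le_mul_of_nonneg_left (not_le.1 c2).le hM0.le
        linarith
    · have a2 := h3 (by linarith [hl j])
      have := mul_le_mul_of_nonneg_left (not_le.1 c1).le hM0.le
      linarith
  have hlo : G.restr u j y - 2 * δ ≤ G.restr (uε ε) j y := by
    refine le_trans ?_ h1
    rw [heq, le_sub_iff_add_le]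
    refine le_min ?_ ?_
    · linarith [min_le_left (u (G.vertex (G.src j)) + G.len f j y)
        (u (G.vertex (G.tgt j)) + (G.edgeLen f j - G.len f j y))]
    · linarith [min_le_right (u (G.vertex (G.src j)) + G.len f j y)
        (u (G.vertex (G.tgt j)) + (G.edgeLen f j - G.len f j y))]
  have h5 : η = 5 * δ := by simp only [δ]; ring
  exact abs_lt.2 ⟨by linarith, by linarith⟩

end TopologicalNetwork

theorem fact4 {n : ℕ} {I J : Type*} [Fintype I] [Fintype J] (G : TopologicalNetwork n I J)
    (B : Set I) (hB : B.Nonempty) (hleaf : ∀ i, (G.inc i).card = 1 → i ∈ B)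
    (f : G.carrier → ℝ) (hf : G.IsLipschitz f) (α : ℝ) (hα : 0 < α) (hfα : ∀ x, α ≤ f x)
    (β : I → J → ℝ) (hβ : ∀ i ∉ B, ∀ j ∈ G.inc i, 0 < β i j) :
    (∃! u : G.carrier → ℝ, G.SolvesEikonal B f u) ∧
    (∀ ε : ℝ, 0 < ε → ∃! u : G.carrier → ℝ, G.SolvesViscousEikonal B β f ε u) ∧
    ∀ (u : G.carrier → ℝ) (uε : ℝ → G.carrier → ℝ), G.SolvesEikonal B f u →
      (∀ ε : ℝ, 0 < ε → G.SolvesViscousEikonal B β f ε (uε ε)) →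
      TendstoUniformly uε u (𝓝[>] 0) := by
  have hfc : ∀ j, Continuous (G.restr f j) := hf.continuous_restr
  have hf0 : ∀ x, 0 < f x := fun x => hα.trans_le (hfα x)
  refine ⟨?_, fun ε hε => ?_, fun u uε hu huε =>
    G.tendstoUniformly_of_solves hfc hα hfα hβ hu huε⟩
  · obtain ⟨u, hu⟩ := G.exists_solvesEikonal hfc hf0 hB hleaf
    exact ⟨u, hu, fun w hw => hw.unique hfc hf0 hu⟩
  · obtain ⟨u, hu⟩ := G.exists_solvesViscousEikonal hfc hf0 hβ hB hε
    exact ⟨u, hu, fun w hw => hw.unique G hfc hf0 hβ hε hu⟩
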